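/- **Setting.** An information structure $\mathcal I$ consists of a probability space $(\Omega,\mathbb P)$, random variables $\sigma:\Omega\to\mathcal S$ (Alice's signal) and $\tau:\Omega\to\mathcal T$ (Bob's signal), and a random variable $Y:\Omega\to[0,1]$. Write $\mu_{\sigma\tau}=\mathbb E[Y\mid\sigma,\tau]$ and, for measurable $S\subseteq\mathcal S$, $T\subseteq\mathcal T$, $\mu_{\sigma T}=\mathbb E[Y\mid\tau\in T,\sigma]$, $\mu_{S\tau}=\mathbb E[Y\mid\sigma\in S,\tau]$, $\mu_{ST}=\mathbb E[Y\mid\sigma\in S,\tau\in T]$. For a strictly convex $G:[0,1]\to\mathbb R$ that is differentiable on $(0,1)$ let $D_G(y\,\|\,x)=G(y)-G(x)-(y-x)G'(x)$ and $$\mathrm{JB}_G(a,b)=\tfrac12\Big(D_G\big(a\,\big\|\,\tfrac{a+b}2\big)+D_G\big(b\,\big\|\,\tfrac{a+b}2\big)\Big)=\tfrac{G(a)+G(b)}2-G\big(\tfrac{a+b}2\big).$$ (At $x\in\{0,1\}$ only $D_G(x\,\|\,x)=0$ matters below, up to events of probability $0$.) $\mathrm{JB}_G$ satisfies the $c$-approximate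 triangle inequality if $\mathrm{JB}_G(a,x)+\mathrm{JB}_G(x,b)\ge c\,\mathrm{JB}_G(a,b)$ for all $a,b,x\in[0,1]$. $\mathcal I$ satisfies rectangle substitutes with respect to $G$ if for all measurable $S\subseteq\mathcal S$, $T\subseteq\mathcal T$ with $\mathbb P[\sigma\in S,\tau\in T]>0$, all expectations being conditional on $\sigma\in S,\ \tau\in T$, $$\mathbb E[D_G(Y\|\mu_{S\tau})]-\mathbb E[D_G(Y\|\mu_{\sigma\tau})]\le\mathbb E[D_G(Y\|\mu_{ST})]-\mathbb E[D_G(Y\|\mu_{\sigma T})].$$ In a deterministic communication protocol Alice and Bob send messages in a standard Borel space (for instance a finite or countable alphabet, or $\mathbb R$), in a prescribed order of turns (for instance alternating). Each message is a measurable function of the sender's signal and all previous messages. A measurable rule depending on the messages sent so far decides when the protocol stops, and it stops almost surely. Alice's expectation $a$ and Bob's expectation $b$ after termination are the conditional expectations of $Y$ given the final transcript and, respectively, $\sigma$ or $\tau$; when the transcript determines a rectangle $S\times T$ of positive probability these are $\mu_{\sigma T}$ and $\mu_{S\tau}$. The protocol causes Alice and Bob to $\epsilon$-agree on $\mathcal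 I$ with respect to $G$ if $\mathbb E[\mathrm{JB}_G(a,b)]\le\epsilon$. Alice is $\delta$-accurate if $D_G(\mu_{\sigma\tau}\,\|\,a)$ is integrable and $\mathbb E[D_G(\mu_{\sigma\tau}\,\|\,a)]\le\delta$; likewise Bob, with $b$ in place of $a$. **Theorem 4.4.** Let $G:[0,1]\to\mathbb R$ be strictly convex, differentiable on $(0,1)$, and symmetric about $x=\frac12$, that is, $G(1-x)=G(x)$. Let $c>0$ be such that $\mathrm{JB}_G$ satisfies the $c$-approximate triangle inequality, and let $\mathcal I$ be an information structure that satisfies rectangle substitutes with respect to $G$. Then for every communication protocol that causes Alice and Bob to $\epsilon$-agree on $\mathcal I$ with respect to $G$, and every $\beta>0$ with $\beta\ge\frac2c\epsilon$, both Alice and Bob are $$\left(\frac{8}{c^2}\beta+16\left(G(0)-G\left(\Big(\frac{\epsilon}{\beta}\Big)^{1/(1-\log_2 c)}\right)\right)\right)\text{-accurate}$$ after the protocol terminates. -/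

import Mathlib

open MeasureTheory ProbabilityTheory Set

noncomputable section

/-- An information structure: a probability space `(Ω, P)`, Alice's signal `σ : Ω → 𝒮`, Bob's signal
`τ : Ω → 𝒯`, and the quantity of interest `Y : Ω → [0, 1]`. -/
structure InformationStructure (Ω 𝒮 𝒯 : Type*)
    [MeasurableSpace Ω] [MeasurableSpace 𝒮] [MeasurableSpace 𝒯] where
  P : Measure Ω
  isProb : IsProbabilityMeasure P
  σ : Ω → 𝒮
  measurable_σ : Measurable σ
  τ : Ω → 𝒯
  measurable_τ : Measurable τ
  Y : Ω → ℝ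
  measurable_Y : Measurable Y
  Y_mem : ∀ ω, Y ω ∈ Icc (0 : ℝ) 1

attribute [instance] InformationStructure.isProb

/-- The Bregman divergence `D_G(y ‖ x) = G(y) - G(x) - (y - x) G'(x)` for `x, y ∈ [0, 1]`.
The derivative is taken within `[0, 1]`: it is `G'(x)` for `0 < x < 1`. Its value at `x = 0, 1` is
immaterial below: when a conditional expectation `x` of `Y` equals `0` or `1`, then every better
informed estimate `y` (and `Y` itself) almost surely equals `x`, and `D_G(x ‖ x) = 0`. -/
def bregman (G : ℝ → ℝ) (y x : ℝ) : ℝ :=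
  G y - G x - (y - x) * derivWithin G (Icc 0 1) x

/-- The Jensen-Bregman divergence `JB_G(a, b)`. -/
def jensenBregman (G : ℝ → ℝ) (a b : ℝ) : ℝ :=
  (1 / 2) * (bregman G a ((a + b) / 2) + bregman G b ((a + b) / 2))

theorem jensenBregman_eq (G : ℝ → ℝ) (a b : ℝ) :
    jensenBregman G a b = (G a + G b) / 2 - G ((a + b) / 2) := by
  unfold jensenBregman bregman
  ring

/-- `JB_G` satisfies the `c`-approximate triangle inequality. -/
def ApproxTriangle (G : ℝ → ℝ) (c : ℝ) : Prop :=
  ∀ a ∈ Icc (0 : ℝ) 1, ∀ b ∈ Icc (0 : ℝ) 1, ∀ x ∈ Icc (0 : ℝ) 1,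
    c * jensenBregman G a b ≤ jensenBregman G a x + jensenBregman G x b

namespace InformationStructure

variable {Ω 𝒮 𝒯 : Type*} [MeasurableSpace Ω] [mS : MeasurableSpace 𝒮] [mT : MeasurableSpace 𝒯]

/-- `μ_{στ} = E[Y | σ, τ]`. -/
def truth (I : InformationStructure Ω 𝒮 𝒯) : Ω → ℝ :=
  I.P[I.Y | mS.comap I.σ ⊔ mT.comap I.τ]

/-- `μ_{σT} = E[Y | τ ∈ T, σ]`. -/
def muAlice (I : InformationStructure Ω 𝒮 𝒯) (T : Set 𝒯) : Ω → ℝ :=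
  (I.P[|I.τ ⁻¹' T])[I.Y | mS.comap I.σ]

/-- `μ_{Sτ} = E[Y | σ ∈ S, τ]`. -/
def muBob (I : InformationStructure Ω 𝒮 𝒯) (S : Set 𝒮) : Ω → ℝ :=
  (I.P[|I.σ ⁻¹' S])[I.Y | mT.comap I.τ]

/-- The probability measure `P[ · | σ ∈ S, τ ∈ T]` (it is the zero measure if the rectangle `S × T`
has probability zero). -/
def condRect (I : InformationStructure Ω 𝒮 𝒯) (S : Set 𝒮) (T : Set 𝒯) : Measure Ω :=
  I.P[|I.σ ⁻¹' S ∩ I.τ ⁻¹' T]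

/-- `μ_{ST} = E[Y | σ ∈ S, τ ∈ T]`. -/
def muRect (I : InformationStructure Ω 𝒮 𝒯) (S : Set 𝒮) (T : Set 𝒯) : ℝ :=
  ∫ ω, I.Y ω ∂(I.condRect S T)

/-- Rectangle substitutes with respect to `G`. For a rectangle of probability zero the inequality
reads `0 ≤ 0`, so only rectangles of positive probability count. -/
def RectangleSubstitutes (I : InformationStructure Ω 𝒮 𝒯) (G : ℝ → ℝ) : Prop :=
  ∀ (S : Set 𝒮) (T : Set 𝒯), MeasurableSet S → MeasurableSet T →
    (∫ ω, bregman G (I.Y ω) (I.muBob S ω) ∂(I.condRect S T))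
        - (∫ ω, bregman G (I.Y ω) (I.truth ω) ∂(I.condRect S T))
      ≤ (∫ ω, bregman G (I.Y ω) (I.muRect S T) ∂(I.condRect S T))
        - (∫ ω, bregman G (I.Y ω) (I.muAlice T ω) ∂(I.condRect S T))

end InformationStructure

/-- A deterministic communication protocol with messages in `M`. The message number `n`
(`n = 0, 1, …`) is sent by Alice if `aliceSpeaks n` holds (for instance for `n` even) and by Bob
otherwise; it is a function of the sender's signal and of the previous `n` messages. The protocol
stops as soon as the messages sent so far, `n` in number, form an element of `halts n`, so the
running time need not be known in advance. -/
structure Protocol (𝒮 𝒯 M : Type*)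
    [MeasurableSpace 𝒮] [MeasurableSpace 𝒯] [MeasurableSpace M] where
  aliceSpeaks : ℕ → Bool
  alice : (n : ℕ) → 𝒮 × (Fin n → M) → M
  measurable_alice : ∀ n, Measurable (alice n)
  bob : (n : ℕ) → 𝒯 × (Fin n → M) → M
  measurable_bob : ∀ n, Measurable (bob n)
  halts : (n : ℕ) → Set (Fin n → M)
  measurableSet_halts : ∀ n, MeasurableSet (halts n)

namespace Protocol

variable {Ω 𝒮 𝒯 M : Type*} [MeasurableSpace Ω] [mS : MeasurableSpace 𝒮]
  [mT : MeasurableSpace 𝒯] [MeasurableSpace M]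

/-- The first `n` messages on the signal pair `(s, t)`, disregarding the stopping rule. -/
def transcript (π : Protocol 𝒮 𝒯 M) (s : 𝒮) (t : 𝒯) : (n : ℕ) → Fin n → M
  | 0 => Fin.elim0
  | n + 1 => Fin.snoc (α := fun _ => M) (π.transcript s t n)
      (if π.aliceSpeaks n then π.alice n (s, π.transcript s t n)
        else π.bob n (t, π.transcript s t n))

/-- The number of messages sent until the protocol stops (`0` if it never stops). -/
def haltTime (π : Protocol 𝒮 𝒯 M) (s : 𝒮) (t : 𝒯) : ℕ :=
  sInf {n | π.transcript s t n ∈ π.halts n}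

/-- The protocol almost surely terminates on the information structure. -/
def Terminates (π : Protocol 𝒮 𝒯 M) (I : InformationStructure Ω 𝒮 𝒯) : Prop :=
  ∀ᵐ ω ∂I.P, ∃ n, π.transcript (I.σ ω) (I.τ ω) n ∈ π.halts n

/-- The whole transcript at termination, a finite sequence of messages, as a random variable. -/
def finalTranscript (π : Protocol 𝒮 𝒯 M) (I : InformationStructure Ω 𝒮 𝒯) (ω : Ω) :
    Σ n : ℕ, (Fin n → M) :=
  ⟨π.haltTime (I.σ ω) (I.τ ω), π.transcript (I.σ ω) (I.τ ω) (π.haltTime (I.σ ω) (I.τ ω))⟩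

theorem measurable_transcript (π : Protocol 𝒮 𝒯 M) (I : InformationStructure Ω 𝒮 𝒯) (n : ℕ) :
    Measurable fun ω => π.transcript (I.σ ω) (I.τ ω) n := by
  induction n with
  | zero => exact measurable_pi_lambda _ fun i => i.elim0
  | succ n ih =>
    refine measurable_pi_lambda _ fun i => ?_
    refine Fin.lastCases ?_ (fun j => ?_) i
    · simp only [transcript, Fin.snoc_last]
      split_ifs
      · exact (π.measurable_alice n).comp (I.measurable_σ.prodMk ih)
      · exact (π.measurable_bob n).comp (I.measurable_τ.prodMk ih)
    · simp only [transcript, Fin.snoc_castSucc]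
      exact (measurable_pi_apply j).comp ih

theorem measurable_haltTime (π : Protocol 𝒮 𝒯 M) (I : InformationStructure Ω 𝒮 𝒯) :
    Measurable fun ω => π.haltTime (I.σ ω) (I.τ ω) := by
  classical
  have hm : ∀ n, MeasurableSet {ω | π.transcript (I.σ ω) (I.τ ω) n ∈ π.halts n} := fun n =>
    π.measurable_transcript I n (π.measurableSet_halts n)
  refine measurable_of_Iic fun n => ?_
  have : (fun ω => π.haltTime (I.σ ω) (I.τ ω)) ⁻¹' Iic n
      = (⋃ k ∈ Iic n, {ω | π.transcript (I.σ ω) (I.τ ω) k ∈ π.halts k})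
        ∪ ⋂ k, {ω | π.transcript (I.σ ω) (I.τ ω) k ∈ π.halts k}ᶜ := by
    ext ω
    simp only [mem_preimage, mem_Iic, mem_union, mem_iUnion, mem_ofPred_eq, mem_iInter,
      mem_compl_iff, haltTime, exists_prop]
    constructor
    · intro h
      by_cases hne : {k | π.transcript (I.σ ω) (I.τ ω) k ∈ π.halts k}.Nonempty
      · exact Or.inl ⟨_, h, Nat.sInf_mem hne⟩
      · exact Or.inr fun k hk => hne ⟨k, hk⟩
    · rintro (⟨k, hk, hk'⟩ | h)
      · exact (Nat.sInf_le hk').trans hk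
      · have : {k | π.transcript (I.σ ω) (I.τ ω) k ∈ π.halts k} = ∅ :=
          eq_empty_of_forall_notMem h
        simp [this]
  rw [this]
  exact (MeasurableSet.biUnion (to_countable _) fun k _ => hm k).union
    (MeasurableSet.iInter fun k => (hm k).compl)

theorem measurable_finalTranscript (π : Protocol 𝒮 𝒯 M) (I : InformationStructure Ω 𝒮 𝒯) :
    Measurable (π.finalTranscript I) := by
  intro s hs
  have : π.finalTranscript I ⁻¹' s = ⋃ n, ((fun ω => π.haltTime (I.σ ω) (I.τ ω)) ⁻¹' {n} ∩
      (fun ω => π.transcript (I.σ ω) (I.τ ω) n) ⁻¹' {x | (⟨n, x⟩ : Σ k : ℕ, (Fin k → M)) ∈ s}) := by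
    ext ω
    simp [finalTranscript]
  rw [this]
  refine MeasurableSet.iUnion fun n => ?_
  have hn : MeasurableSet {x : Fin n → M | (⟨n, x⟩ : Σ k : ℕ, (Fin k → M)) ∈ s} :=
    MeasurableSpace.measurableSet_iInf.1 hs n
  exact (π.measurable_haltTime I (measurableSet_singleton n)).inter
    (π.measurable_transcript I n hn)

/-- Alice's expectation at the end of the protocol: the conditional expectation of `Y` given her
signal and the transcript. On the event that the transcript takes a given value of positive
probability, i.e. `(σ, τ) ∈ S × T` for the corresponding rectangle, this is `μ_{σT}`. -/
def aliceExpectation (π : Protocol 𝒮 𝒯 M) (I : InformationStructure Ω 𝒮 𝒯) : Ω → ℝ :=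
  I.P[I.Y | mS.comap I.σ ⊔ MeasurableSpace.comap (π.finalTranscript I) inferInstance]

/-- Bob's expectation at the end of the protocol: the conditional expectation of `Y` given his
signal and the transcript. -/
def bobExpectation (π : Protocol 𝒮 𝒯 M) (I : InformationStructure Ω 𝒮 𝒯) : Ω → ℝ :=
  I.P[I.Y | mT.comap I.τ ⊔ MeasurableSpace.comap (π.finalTranscript I) inferInstance]

/-- The protocol terminates and causes Alice and Bob to `ε`-agree on `I` with respect to `G`:
`E[JB_G(a, b)] ≤ ε` for their expectations `a, b` at the end. -/
def CausesAgreement (π : Protocol 𝒮 𝒯 M) (I : InformationStructure Ω 𝒮 𝒯) (G : ℝ → ℝ)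
    (ε : ℝ) : Prop :=
  π.Terminates I ∧
    ∫ ω, jensenBregman G (π.aliceExpectation I ω) (π.bobExpectation I ω) ∂I.P ≤ ε

end Protocol

/-- An agent with expectation `a` is `δ`-accurate with respect to `G`: `E[D_G(μ_{στ} ‖ a)] ≤ δ`,
the expected value being finite. -/
def InformationStructure.Accurate {Ω 𝒮 𝒯 : Type*} [MeasurableSpace Ω] [MeasurableSpace 𝒮]
    [MeasurableSpace 𝒯] (I : InformationStructure Ω 𝒮 𝒯) (G : ℝ → ℝ) (δ : ℝ) (a : Ω → ℝ) : Prop :=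
  Integrable (fun ω => bregman G (I.truth ω) (a ω)) I.P ∧
    ∫ ω, bregman G (I.truth ω) (a ω) ∂I.P ≤ δ

end

/-!
# Agreement implies accuracy under rectangle substitutes

Write `a` and `b` for the final expectations of Alice and Bob, `t = E[Y | σ, τ]`, and `𝒢` for the
σ-algebra generated by the transcript. For conditional expectations of `Y` the expected divergence
`E[D_G(t ‖ b)]` equals `E[G(t)] - E[G(b)]` (`ConvexOn.bregman_condExp`), so that everything can be
phrased through the numbers `E[G(E[Y | m])]`, which increase with the information `m`. It suffices to
treat Bob, since all hypotheses are symmetric.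

Rectangle substitutes say that on a rectangle `E[G(t)] - E[G(E[Y | τ])]`, the value of `σ` to Bob, is
at most `E[G(E[Y | σ])] - G(E[Y])`, the value of `σ` without Bob's signal. The same then holds
relative to any common knowledge `𝒢` which is a partition into rectangles. For messages in a continuum
`𝒢` is not such a partition, but it is a limit of such partitions (`RectApprox`), and the inequality
survives the limit (`RectSubmodular.integral_le`). The function `G` may jump at `0` and `1`; a jump
does no harm, since almost surely an expectation equal to `0` or `1` is already equal to `Y`.

Now let Alice also announce in which cell of a finite partition of `[0, 1]` her expectation lies. If
the cells have small Jensen–Bregman diameter, then Alice's exact expectation tells little beyond the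
announcement (`ConvexOn.integral_sub_condExp_le`), hence by rectangle substitutes `σ` as a whole is
worth little to Bob once he has heard the announcement. And if the partition rarely separates `a` from
`b`, then Bob can nearly always guess the announcement from his own expectation, so that hearing it is
worth little to him (`ConvexOn.integral_condExp_sub_le`). The two terms of the bound come from these
two losses (`RectSubmodular.accurate`).

A suitable partition is found among `2 ^ r` candidates (`exists_partitions`). Count the steps of
divergence `s` that fit into `[0, x]`, and group `2 ^ r` consecutive values of this count into one
cell. A random offset of the grouping separates `x` from `y` with probability at most
`(1 + JB(x, y) / s) / 2 ^ r + JB(x, y) / β`; the last term is needed only if `G` jumps so much at the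
endpoints that these form cells of their own. The cells are small because the approximate triangle inequality lets one
bisect an interval at the cost of a factor `c / 2` in divergence, so that an interval of divergence
`(2 / c) ^ r * s` contains `2 ^ r` steps. With `s = ε` and cells of diameter of order `β`, the
probability of separation is of order `(ε / β) ^ (1 / (1 - log₂ c))`
(`exists_partition_of_agreement`).
-/

open Filter Topology

/-! ### Jensen–Bregman divergences of a convex function on the unit interval -/

section Convex

variable {G : ℝ → ℝ}

theorem jensenBregman_self (G : ℝ → ℝ) (a : ℝ) : jensenBregman G a a = 0 := by
  rw [jensenBregman_eq]; ring_nf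

theorem jensenBregman_comm (G : ℝ → ℝ) (a b : ℝ) :
    jensenBregman G a b = jensenBregman G b a := by
  simp only [jensenBregman_eq]; rw [add_comm a b]; ring

theorem ConvexOn.jensenBregman_nonneg (hG : ConvexOn ℝ (Icc 0 1) G) {a b : ℝ}
    (ha : a ∈ Icc (0 : ℝ) 1) (hb : b ∈ Icc (0 : ℝ) 1) : 0 ≤ jensenBregman G a b := by
  have := hG.2 ha hb (by norm_num : (0 : ℝ) ≤ 1 / 2) (by norm_num : (0 : ℝ) ≤ 1 / 2) (by norm_num)
  simp only [smul_eq_mul] at this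
  rw [jensenBregman_eq]
  rw [show (a + b) / 2 = 1 / 2 * a + 1 / 2 * b by ring]
  linarith

theorem StrictConvexOn.eq_of_jensenBregman_eq_zero (hG : StrictConvexOn ℝ (Icc 0 1) G) {a b : ℝ}
    (ha : a ∈ Icc (0 : ℝ) 1) (hb : b ∈ Icc (0 : ℝ) 1) (h : jensenBregman G a b = 0) : a = b := by
  by_contra hne
  have := hG.2 ha hb hne (by norm_num : (0 : ℝ) < 1 / 2) (by norm_num : (0 : ℝ) < 1 / 2)
    (by norm_num)
  simp only [smul_eq_mul] at this
  rw [jensenBregman_eq, show (a + b) / 2 = 1 / 2 * a + 1 / 2 * b by ring] at h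
  linarith

/-- For a convex function the Jensen–Bregman divergence is superadditive along the line. The points
`(a + b) / 2` and `x` lie between `(a + x) / 2` and `(x + b) / 2` and have the same sum. -/
theorem ConvexOn.jensenBregman_add_le (hG : ConvexOn ℝ (Icc 0 1) G) {a x b : ℝ}
    (ha : 0 ≤ a) (hax : a ≤ x) (hxb : x ≤ b) (hb : b ≤ 1) :
    jensenBregman G a x + jensenBregman G x b ≤ jensenBregman G a b := by
  rcases eq_or_lt_of_le (hax.trans hxb) with hab | hab
  · obtain rfl : a = x := le_antisymm hax (by linarith)
    subst hab
    simp [jensenBregman_self]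
  · simp only [jensenBregman_eq]
    have hu : (a + x) / 2 ∈ Icc (0 : ℝ) 1 := ⟨by linarith, by linarith⟩
    have hv : (x + b) / 2 ∈ Icc (0 : ℝ) 1 := ⟨by linarith, by linarith⟩
    have hd : 0 < b - a := by linarith
    have t0 : 0 ≤ (b - x) / (b - a) := div_nonneg (by linarith) hd.le
    have t1 : 0 ≤ (x - a) / (b - a) := div_nonneg (by linarith) hd.le
    have hs : (b - x) / (b - a) + (x - a) / (b - a) = 1 := by field_simp; ring
    have h1 := hG.2 hu hv t0 t1 hs
    have h2 := hG.2 hu hv t1 t0 (by linarith)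
    simp only [smul_eq_mul] at h1 h2
    have e1 : (b - x) / (b - a) * ((a + x) / 2) + (x - a) / (b - a) * ((x + b) / 2) = x := by
      field_simp; ring
    have e2 : (x - a) / (b - a) * ((a + x) / 2) + (b - x) / (b - a) * ((x + b) / 2)
        = (a + b) / 2 := by
      field_simp; ring
    rw [e1] at h1
    rw [e2] at h2
    have e3 : (b - x) / (b - a) = 1 - (x - a) / (b - a) := by linarith
    rw [e3] at h1 h2
    nlinarith

theorem ConvexOn.jensenBregman_mono (hG : ConvexOn ℝ (Icc 0 1) G) {a x y b : ℝ}
    (ha : 0 ≤ a) (hax : a ≤ x) (hxy : x ≤ y) (hyb : y ≤ b) (hb : b ≤ 1) :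
    jensenBregman G x y ≤ jensenBregman G a b := by
  have h1 := hG.jensenBregman_add_le ha hax (hxy.trans hyb) hb
  have h2 := hG.jensenBregman_add_le (ha.trans hax) hxy hyb hb
  have h3 := hG.jensenBregman_nonneg (a := a) (b := x) ⟨ha, by linarith⟩ ⟨by linarith, by linarith⟩
  have h4 := hG.jensenBregman_nonneg (a := y) (b := b) ⟨by linarith, by linarith⟩
    ⟨by linarith, hb⟩
  linarith

theorem ConvexOn.le_apply_zero (hG : ConvexOn ℝ (Icc 0 1) G)
    (hs : ∀ x ∈ Icc (0 : ℝ) 1, G (1 - x) = G x) {x : ℝ} (hx : x ∈ Icc (0 : ℝ) 1) : G x ≤ G 0 := by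
  have := hG.2 (show (0 : ℝ) ∈ Icc (0 : ℝ) 1 by simp) (show (1 : ℝ) ∈ Icc (0 : ℝ) 1 by simp)
    (show 0 ≤ 1 - x by linarith [hx.2]) hx.1 (by ring)
  have h1 := hs 0 (by simp)
  simp only [smul_eq_mul, mul_zero, zero_add, mul_one, sub_zero] at this h1
  rw [h1] at this
  linarith

theorem ConvexOn.apply_half_le (hG : ConvexOn ℝ (Icc 0 1) G)
    (hs : ∀ x ∈ Icc (0 : ℝ) 1, G (1 - x) = G x) {x : ℝ} (hx : x ∈ Icc (0 : ℝ) 1) :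
    G (1 / 2) ≤ G x := by
  have h := hG.jensenBregman_nonneg hx (b := 1 - x) ⟨by linarith [hx.2], by linarith [hx.1]⟩
  rw [jensenBregman_eq, hs x hx, show (x + (1 - x)) / 2 = 1 / 2 by ring] at h
  linarith

/-- The Jensen gap of a random variable which is `x` with probability `1 - p` and spreads over
`[0, 1]` otherwise (contributing `w` to the mean). Replacing the unlikely values by the endpoints,
where `G` is largest, costs little since `G 0 - G` is concave and vanishes at `0`, hence is
subadditive. For `γ = 0` the quotient `p / γ` is a junk value, but then `p = 0`. -/
theorem ConvexOn.jensenGap_le (hG : ConvexOn ℝ (Icc 0 1) G)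
    (hs : ∀ x ∈ Icc (0 : ℝ) 1, G (1 - x) = G x) {γ p x w : ℝ} (hγ0 : 0 ≤ γ) (hγ : γ ≤ 1 / 2)
    (hp0 : 0 ≤ p) (hp1 : p ≤ 1) (hx : x ∈ Icc (0 : ℝ) 1) (hw0 : 0 ≤ w) (hwp : w ≤ p)
    (hγp : γ = 0 → p = 0) :
    (1 - p) * G x + p * G 0 - G ((1 - p) * x + w) ≤ 3 / 2 * (1 + p / γ) * (G 0 - G γ) := by
  have scale : ∀ u v : ℝ, 0 ≤ u → u ≤ v → v ≤ 1 → u * (G 0 - G v) ≤ v * (G 0 - G u) := by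
    intro u v hu huv hv
    rcases eq_or_lt_of_le (hu.trans huv) with h0 | h0
    · have hu0 : u = 0 := by linarith
      subst hu0; rw [← h0]
    · have := hG.2 (show (0 : ℝ) ∈ Icc (0 : ℝ) 1 by simp) ⟨h0.le, hv⟩
        (show 0 ≤ 1 - u / v by rw [sub_nonneg, div_le_one h0]; exact huv)
        (show 0 ≤ u / v by positivity) (by ring)
      simp only [smul_eq_mul, mul_zero, zero_add, div_mul_cancel₀ u h0.ne'] at this
      have h2 := mul_le_mul_of_nonneg_left this h0.le
      have e : v * ((1 - u / v) * G 0 + u / v * G v) = (v - u) * G 0 + u * G v := by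
        field_simp
      rw [e] at h2
      linarith
  have le0 := fun {x : ℝ} (hx : x ∈ Icc (0 : ℝ) 1) => hG.le_apply_zero hs hx
  have mono : ∀ u v : ℝ, 0 ≤ u → u ≤ v → v ≤ 1 / 2 → G v ≤ G u := by
    intro u v hu huv hv
    rcases eq_or_lt_of_le (show u ≤ 1 - u by linarith) with h0 | h0
    · have : u = v := by linarith
      rw [this]
    · have hd : 0 < 1 - 2 * u := by linarith
      have := hG.2 (show u ∈ Icc (0 : ℝ) 1 from ⟨hu, by linarith⟩)
        (show 1 - u ∈ Icc (0 : ℝ) 1 from ⟨by linarith, by linarith⟩)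
        (show 0 ≤ 1 - (v - u) / (1 - 2 * u) by rw [sub_nonneg, div_le_one hd]; linarith)
        (show 0 ≤ (v - u) / (1 - 2 * u) from div_nonneg (by linarith) hd.le) (by ring)
      simp only [smul_eq_mul] at this
      rw [hs u ⟨hu, by linarith⟩,
        show (1 - (v - u) / (1 - 2 * u)) * u + (v - u) / (1 - 2 * u) * (1 - u) = v by
          linear_combination div_mul_cancel₀ (v - u) hd.ne'] at this
      linarith
  have subadd : ∀ u v : ℝ, 0 ≤ u → 0 ≤ v → u + v ≤ 1 →
      G 0 - G (u + v) ≤ (G 0 - G u) + (G 0 - G v) := by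
    intro u v hu hv huv
    rcases eq_or_lt_of_le (add_nonneg hu hv) with h0 | h0
    · rw [show u + v = 0 from h0.symm]
      have := le0 (x := u) ⟨hu, by linarith⟩
      have := le0 (x := v) ⟨hv, by linarith⟩
      linarith
    · have h1 := scale u (u + v) hu (by linarith) huv
      have h2 := scale v (u + v) hv (by linarith) huv
      have h3 : (u + v) * (G 0 - G (u + v)) ≤ (u + v) * ((G 0 - G u) + (G 0 - G v)) := by
        linarith
      exact le_of_mul_le_mul_left h3 h0
  rcases hγ0.eq_or_lt with h0 | hγpos
  · have hp : p = 0 := hγp h0.symm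
    subst hp
    obtain rfl : w = 0 := le_antisymm hwp hw0
    simp [← h0]
  have hγI : γ ∈ Icc (0 : ℝ) 1 := ⟨hγ0, by linarith⟩
  have hhγ := le0 hγI
  have hx1 := hx.1
  have hx2 := hx.2
  have hbI : (1 - p) * x + w ∈ Icc (0 : ℝ) 1 := ⟨by nlinarith, by nlinarith⟩
  rcases le_or_gt p (1 / 2) with hp2 | hp2
  · have main : (1 - p) * G x + p * G 0 - G ((1 - p) * x + w) ≤ 3 / 2 * (G 0 - G p) := by
      have key : ∀ x w : ℝ, 0 ≤ x → x ≤ 1 / 2 → 0 ≤ w → w ≤ p →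
          (1 - p) * G x + p * G 0 - G ((1 - p) * x + w) ≤ 3 / 2 * (G 0 - G p) := by
        intro x w hx0 hx1 hw0 hwp
        have h1 := subadd ((1 - p) * x) w (by nlinarith) hw0 (by nlinarith)
        have h2 := mono ((1 - p) * x) x (by nlinarith) (by nlinarith) hx1
        have h3 := mono w p hw0 hwp hp2
        have h4 := scale p (1 / 2) hp0 hp2 (by norm_num)
        have h5 := mono x (1 / 2) hx0 hx1 le_rfl
        nlinarith
      rcases le_total x (1 / 2) with h | h
      · exact key x w hx1 h hw0 hwp
      · have := key (1 - x) (p - w) (by linarith) (by linarith) (by linarith) (by linarith)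
        rwa [hs x hx, show (1 - p) * (1 - x) + (p - w) = 1 - ((1 - p) * x + w) by ring,
          hs _ hbI] at this
    have : G 0 - G p ≤ (1 + p / γ) * (G 0 - G γ) := by
      rcases le_total p γ with h | h
      · have h1 := mono p γ hp0 h hγ
        have : 0 ≤ p / γ := by positivity
        nlinarith
      · have h1 := scale γ p hγ0 h hp1
        have : G 0 - G p ≤ p / γ * (G 0 - G γ) := by
          rw [div_mul_eq_mul_div, le_div_iff₀ hγpos]; linarith
        linarith
    linarith
  · have h1 := hG.apply_half_le hs hbI
    have h2 := le0 hx
    have h3 := scale γ (1 / 2) hγ0 hγ (by norm_num)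
    have h4 : p / γ ≥ 1 / (2 * γ) := by
      rw [ge_iff_le, div_le_div_iff₀ (by positivity) hγpos]; nlinarith
    have h5 : G 0 - G (1 / 2) ≤ 1 / (2 * γ) * (G 0 - G γ) := by
      rw [div_mul_eq_mul_div, le_div_iff₀ (by positivity)]; linarith
    have h6 : 1 / (2 * γ) * (G 0 - G γ) ≤ p / γ * (G 0 - G γ) :=
      mul_le_mul_of_nonneg_right h4 (by linarith)
    have h7 : 0 ≤ p / γ * (G 0 - G γ) := mul_nonneg (by positivity) (by linarith)
    nlinarith

/-! ### Tangent lines -/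

theorem ConvexOn.tangent_le (hG : ConvexOn ℝ (Icc 0 1) G) (hd : DifferentiableOn ℝ G (Ioo 0 1))
    {z y : ℝ} (hz : z ∈ Ioo (0 : ℝ) 1) (hy : y ∈ Icc (0 : ℝ) 1) :
    G z + (y - z) * deriv G z ≤ G y := by
  have hzI : z ∈ Icc (0 : ℝ) 1 := Ioo_subset_Icc_self hz
  have hdz : DifferentiableAt ℝ G z := hd.differentiableAt (Ioo_mem_nhds hz.1 hz.2)
  rcases lt_trichotomy y z with h | h | h
  · have := hG.slope_le_deriv hy hzI h hdz
    rw [slope_def_field, div_le_iff₀ (by linarith)] at this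
    linarith
  · subst h; simp
  · have := hG.deriv_le_slope hzI hy h hdz
    rw [slope_def_field, le_div_iff₀ (by linarith)] at this
    linarith

theorem bregman_of_mem_Ioo {y z : ℝ} (hz : z ∈ Ioo (0 : ℝ) 1) :
    bregman G y z = G y - G z - (y - z) * deriv G z := by
  rw [bregman, derivWithin_of_mem_nhds (Icc_mem_nhds hz.1 hz.2)]

/-- If Jensen–Bregman divergences from `x ≤ m` to points arbitrarily close to the reflection
`2 m - x` (or beyond it) are at most `D`, then the Bregman divergence of `x` from the midpoint `m`
is at most `2 D`. -/
theorem ConvexOn.le_tangent_add_of_le (hG : ConvexOn ℝ (Icc 0 1) G)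
    (hd : DifferentiableOn ℝ G (Ioo 0 1)) {x m D : ℝ} (hx : x ∈ Icc (0 : ℝ) 1)
    (hm : m ∈ Ioo (0 : ℝ) 1) (hxm : x ≤ m)
    (H : ∀ ρ < 2 * m - x, ∃ y ∈ Icc (0 : ℝ) 1, ρ < y ∧ jensenBregman G x y ≤ D) :
    G x ≤ G m + (x - m) * deriv G m + 2 * D := by
  rcases hxm.eq_or_lt with rfl | hxm
  · obtain ⟨y, hy, -, hyD⟩ := H (2 * x - x - 1) (by linarith)
    have := hG.jensenBregman_nonneg hx hy
    linarith
  have hdm : DifferentiableAt ℝ G m := hd.differentiableAt (Ioo_mem_nhds hm.1 hm.2)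
  have step : ∀ u ∈ Ioo x m, G x - G u + (u - x) * deriv G u ≤ 2 * D := by
    intro u hu
    obtain ⟨y, hy, hρ, hyD⟩ := H (2 * u - x) (by linarith [hu.2])
    have hu' : u ∈ Ioo (0 : ℝ) 1 := ⟨by linarith [hx.1, hu.1], by linarith [hu.2, hm.2]⟩
    have hz : (x + y) / 2 ∈ Ioo (0 : ℝ) 1 :=
      ⟨by linarith [hu'.1], by linarith [hy.2, hxm, hm.2]⟩
    have t1 := hG.tangent_le hd hz hy
    have t2 := hG.tangent_le hd hz (Ioo_subset_Icc_self hu')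
    have t3 := hG.tangent_le hd hu' (Ioo_subset_Icc_self hz)
    rw [jensenBregman_eq] at hyD
    have hlt : 0 < (x + y) / 2 - u := by linarith
    have hmono : deriv G u ≤ deriv G ((x + y) / 2) := by
      by_contra! hc
      nlinarith
    have := mul_le_mul_of_nonneg_left hmono (by linarith [hu.1] : 0 ≤ u - x)
    nlinarith
  have step2 : ∀ v ∈ Ioo x m, G x - G m + (m - x) * slope G v m ≤ 2 * D := by
    intro v hv
    have hlim : Tendsto (fun u => G x - G u + (u - x) * slope G v u) (𝓝[<] m)
        (𝓝 (G x - G m + (m - x) * slope G v m)) := by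
      have hc : ContinuousAt G m := hdm.continuousAt
      have : ContinuousAt (fun u => G x - G u + (u - x) * slope G v u) m := by
        simp only [slope_def_field]
        have : m - v ≠ 0 := by linarith [hv.2]
        fun_prop (disch := assumption)
      exact this.tendsto.mono_left nhdsWithin_le_nhds
    refine le_of_tendsto hlim ?_
    filter_upwards [Ioo_mem_nhdsLT hv.2] with u hu
    have hux : u ∈ Ioo x m := ⟨hv.1.trans hu.1, hu.2⟩
    have h1 := step u hux
    have hdu : DifferentiableAt ℝ G u :=
      hd.differentiableAt (Ioo_mem_nhds (by linarith [hx.1, hux.1]) (by linarith [hux.2, hm.2]))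
    have h2 := hG.slope_le_deriv (x := v) (y := u)
      ⟨by linarith [hx.1, hv.1], by linarith [hv.2, hm.2]⟩
      ⟨by linarith [hx.1, hux.1], by linarith [hux.2, hm.2]⟩ hu.1 hdu
    have := mul_le_mul_of_nonneg_left h2 (by linarith [hux.1] : 0 ≤ u - x)
    linarith
  have hlim : Tendsto (fun v => G x - G m + (m - x) * slope G v m) (𝓝[<] m)
      (𝓝 (G x - G m + (m - x) * deriv G m)) := by
    have h1 := hasDerivAt_iff_tendsto_slope.1 hdm.hasDerivAt
    have h2 : Tendsto (fun v => slope G v m) (𝓝[<] m) (𝓝 (deriv G m)) := by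
      simp only [slope_comm G _ m]
      exact h1.mono_left (nhdsWithin_mono _ fun y (hy : y < m) => hy.ne)
    exact tendsto_const_nhds.add (tendsto_const_nhds.mul h2)
  have := le_of_tendsto hlim (by filter_upwards [Ioo_mem_nhdsLT hxm] with v hv using step2 v hv)
  linarith

theorem ConvexOn.comp_one_sub (hG : ConvexOn ℝ (Icc 0 1) G) :
    ConvexOn ℝ (Icc 0 1) fun t => G (1 - t) := by
  refine ⟨convex_Icc 0 1, fun x hx y hy a b ha hb hab => ?_⟩
  have := hG.2 (show 1 - x ∈ Icc (0 : ℝ) 1 from ⟨by linarith [hx.2], by linarith [hx.1]⟩)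
    (show 1 - y ∈ Icc (0 : ℝ) 1 from ⟨by linarith [hy.2], by linarith [hy.1]⟩) ha hb hab
  simp only [smul_eq_mul] at this ⊢
  rwa [show 1 - (a * x + b * y) = a * (1 - x) + b * (1 - y) by linear_combination -hab]

/-- A subset of `[0, 1]` of small Jensen–Bregman diameter carries an affine minorant of `G` which is
nearly tight on it: the tangent line at the midpoint of its extreme points. Only at the endpoints
of `[0, 1]`, where `G` may have no tangent line, is there an exception. -/
theorem ConvexOn.exists_affine_minorant (hG : ConvexOn ℝ (Icc 0 1) G)
    (hd : DifferentiableOn ℝ G (Ioo 0 1)) {C : Set ℝ} (hC : C ⊆ Icc 0 1) {D : ℝ}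
    (hD : ∀ x ∈ C, ∀ y ∈ C, jensenBregman G x y ≤ D) :
    C ⊆ {0} ∨ C ⊆ {1} ∨ ∃ p q : ℝ, (∀ x ∈ C, G x ≤ p + q * x + 2 * D) ∧
      ∀ y ∈ Icc (0 : ℝ) 1, p + q * y ≤ G y := by
  rcases C.eq_empty_or_nonempty with rfl | hne
  · simp
  have hbb : BddBelow C := ⟨0, fun x hx => (hC hx).1⟩
  have hba : BddAbove C := ⟨1, fun x hx => (hC hx).2⟩
  set l := sInf C
  set r := sSup C
  have hl : ∀ x ∈ C, l ≤ x := fun x hx => csInf_le hbb hx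
  have hr : ∀ x ∈ C, x ≤ r := fun x hx => le_csSup hba hx
  have hl0 : 0 ≤ l := le_csInf hne fun x hx => (hC hx).1
  have hr1 : r ≤ 1 := csSup_le hne fun x hx => (hC hx).2
  by_cases hm : (l + r) / 2 ∈ Ioo (0 : ℝ) 1
  · right; right
    refine ⟨G ((l + r) / 2) - (l + r) / 2 * deriv G ((l + r) / 2), deriv G ((l + r) / 2),
      fun x hx => ?_, fun y hy => ?_⟩
    · rcases le_total x ((l + r) / 2) with h | h
      · have := hG.le_tangent_add_of_le hd (D := D) (hC hx) hm h fun ρ hρ => by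
          obtain ⟨y, hy, hρy⟩ := exists_lt_of_lt_csSup hne
            (show ρ < r by linarith [hl x hx])
          exact ⟨y, hC hy, hρy, hD x hx y hy⟩
        linarith
      · have hm' : 1 - (l + r) / 2 ∈ Ioo (0 : ℝ) 1 := ⟨by linarith [hm.2], by linarith [hm.1]⟩
        have hd' : DifferentiableOn ℝ (fun t => G (1 - t)) (Ioo 0 1) := by
          refine hd.comp (by fun_prop) fun t ht => ?_
          exact ⟨by linarith [ht.2], by linarith [ht.1]⟩
        have := hG.comp_one_sub.le_tangent_add_of_le hd' (D := D) (x := 1 - x)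
          ⟨by linarith [(hC hx).2], by linarith [(hC hx).1]⟩ hm' (by linarith) fun ρ hρ => by
            obtain ⟨y, hy, hρy⟩ := exists_lt_of_csInf_lt hne
              (show l < 1 - ρ by linarith [hr x hx])
            refine ⟨1 - y, ⟨by linarith [(hC hy).2], by linarith [(hC hy).1]⟩, by linarith, ?_⟩
            have := hD x hx y hy
            rw [jensenBregman_eq] at this ⊢
            rw [show 1 - (1 - x + (1 - y)) / 2 = (x + y) / 2 by ring]
            simpa using this
        rw [deriv_comp_const_sub] at this
        simp only [sub_sub_cancel] at this
        linarith
    · have := hG.tangent_le hd hm hy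
      linarith
  · obtain ⟨x, hx⟩ := hne
    have h1 := hl x hx
    have h2 := hr x hx
    rcases le_or_gt ((l + r) / 2) 0 with h | h
    · left
      intro y hy
      have := hl y hy
      have := hr y hy
      simp only [mem_singleton_iff]; linarith
    · right; left
      have h3 : 1 ≤ (l + r) / 2 := by
        by_contra! hc
        exact hm ⟨h, hc⟩
      intro y hy
      have := hl y hy
      have := hr y hy
      simp only [mem_singleton_iff]; linarith

end Convex

/-! ### Partitions of the unit interval into cells of small Jensen–Bregman diameter -/

section Partition

variable {G : ℝ → ℝ} {s c β : ℝ}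

/-- `Reaches G s n a b`: there is a chain `a = x₀ ≤ x₁ ≤ ⋯ ≤ xₙ ≤ b` whose `n` steps have
Jensen–Bregman divergence at least `s` each. -/
def Reaches (G : ℝ → ℝ) (s : ℝ) : ℕ → ℝ → ℝ → Prop
  | 0, a, b => a ≤ b
  | n + 1, a, b => ∃ x, a ≤ x ∧ s ≤ jensenBregman G a x ∧ Reaches G s n x b

theorem Reaches.le {n : ℕ} {a b : ℝ} (h : Reaches G s n a b) : a ≤ b := by
  induction n generalizing a with
  | zero => exact h
  | succ n ih =>
    obtain ⟨x, hx, -, h⟩ := h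
    exact hx.trans (ih h)

theorem Reaches.append {n m : ℕ} {a b d : ℝ} (h : Reaches G s n a b)
    (mono : ∀ x ≤ b, a ≤ x → Reaches G s m x d) : Reaches G s (n + m) a d := by
  induction n generalizing a with
  | zero => rw [zero_add]; exact mono a h le_rfl
  | succ n ih =>
    obtain ⟨x, hx, hs, h⟩ := h
    rw [Nat.succ_add]
    exact ⟨x, hx, hs, ih h fun y hy hxy => mono y hy (hx.trans hxy)⟩

theorem Reaches.mono_left (hG : ConvexOn ℝ (Icc 0 1) G) {n : ℕ} {a b d : ℝ} (ha : 0 ≤ a)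
    (hab : a ≤ b) (hd : d ≤ 1) (h : Reaches G s n b d) : Reaches G s n a d := by
  cases n with
  | zero => exact hab.trans h
  | succ n =>
    obtain ⟨x, hx, hs, h⟩ := h
    exact ⟨x, hab.trans hx, hs.trans (hG.jensenBregman_mono ha hab hx le_rfl (h.le.trans hd)), h⟩

theorem Reaches.trans (hG : ConvexOn ℝ (Icc 0 1) G) {n m : ℕ} {a b d : ℝ} (ha : 0 ≤ a)
    (hd : d ≤ 1) (h : Reaches G s n a b) (h' : Reaches G s m b d) : Reaches G s (n + m) a d :=
  h.append fun _ hxb hax => h'.mono_left hG (ha.trans hax) hxb hd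

theorem Reaches.mul_le (hG : ConvexOn ℝ (Icc 0 1) G) {n : ℕ} {a b : ℝ} (ha : 0 ≤ a)
    (hb : b ≤ 1) (h : Reaches G s n a b) : n * s ≤ jensenBregman G a b := by
  induction n generalizing a with
  | zero =>
    simpa using hG.jensenBregman_nonneg ⟨ha, le_trans h.le hb⟩ ⟨ha.trans h.le, hb⟩
  | succ n ih =>
    obtain ⟨x, hx, hs, h⟩ := h
    have h1 := ih (ha.trans hx) h
    have h2 := hG.jensenBregman_add_le ha hx h.le hb
    push_cast
    linarith

theorem Reaches.split (hG : ConvexOn ℝ (Icc 0 1) G) {n : ℕ} {a b d : ℝ} (ha : 0 ≤ a)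
    (hab : a ≤ b) (hbd : b ≤ d) (hd : d ≤ 1) (h : Reaches G s n a d) :
    ∃ n₁ n₂, n ≤ n₁ + n₂ + 1 ∧ Reaches G s n₁ a b ∧ Reaches G s n₂ b d := by
  induction n generalizing a with
  | zero => exact ⟨0, 0, by simp, hab, hbd⟩
  | succ n ih =>
    obtain ⟨x, hx, hs, h⟩ := h
    rcases le_total x b with hxb | hxb
    · obtain ⟨n₁, n₂, hn, h₁, h₂⟩ := ih (ha.trans hx) hxb h
      exact ⟨n₁ + 1, n₂, by omega, ⟨x, hx, hs, h₁⟩, h₂⟩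
    · exact ⟨0, n, by omega, hab, h.mono_left hG (ha.trans hab) hxb hd⟩

/-- Bisection: by the intermediate value theorem `[a, b]` splits into two parts of equal divergence,
and by the approximate triangle inequality each of them has at least `c / 2` of the total. -/
theorem reaches_two_pow (hc : 0 < c) (hT : ApproxTriangle G c)
    (hG : ConvexOn ℝ (Icc 0 1) G) (hcont : ContinuousOn G (Ioo 0 1)) {r : ℕ} {a b : ℝ}
    (ha : 0 < a) (hab : a ≤ b) (hb : b < 1) (h : (2 / c) ^ r * s ≤ jensenBregman G a b) :
    Reaches G s (2 ^ r) a b := by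
  induction r generalizing a b with
  | zero =>
    rw [pow_zero, one_mul] at h
    exact ⟨b, hab, h, le_rfl⟩
  | succ r ih =>
    have hcontI : ContinuousOn (fun x => jensenBregman G a x - jensenBregman G x b) (Icc a b) := by
      simp only [jensenBregman_eq]
      have h1 : ContinuousOn G (Icc a b) := hcont.mono fun x hx => ⟨by linarith [hx.1],
        by linarith [hx.2]⟩
      have h2 : ContinuousOn (fun x => G ((a + x) / 2)) (Icc a b) :=
        hcont.comp (by fun_prop) fun x hx => ⟨by linarith [hx.1], by linarith [hx.2]⟩
      have h3 : ContinuousOn (fun x => G ((x + b) / 2)) (Icc a b) :=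
        hcont.comp (by fun_prop) fun x hx => ⟨by linarith [hx.1], by linarith [hx.2]⟩
      exact (((continuousOn_const.add h1).div_const 2).sub h2).sub
        (((h1.add continuousOn_const).div_const 2).sub h3)
    have hnn := hG.jensenBregman_nonneg (a := a) (b := b) ⟨ha.le, by linarith⟩
      ⟨by linarith, hb.le⟩
    obtain ⟨x, hx, hx0⟩ := intermediate_value_Icc hab hcontI
      (show (0 : ℝ) ∈ Icc _ _ by simp [jensenBregman_self, hnn])
    have ht := hT a ⟨ha.le, by linarith⟩ b ⟨by linarith, hb.le⟩ x
      ⟨by linarith [hx.1], by linarith [hx.2]⟩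
    have key : (2 / c) ^ r * s ≤ jensenBregman G a x := by
      have e : (2 / c) ^ (r + 1) * s = 2 * ((2 / c) ^ r * s) / c := by
        rw [pow_succ]; field_simp
      rw [e, div_le_iff₀ hc] at h
      simp only at hx0
      linarith
    have key' : (2 / c) ^ r * s ≤ jensenBregman G x b := by
      simp only at hx0
      linarith
    have r1 := ih ha hx.1 (by linarith [hx.2]) key
    have r2 := ih (by linarith [hx.1]) hx.2 hb key'
    rw [pow_succ, mul_two]
    exact r1.trans hG ha.le hb.le r2

open scoped Classical in
/-- The largest number of steps of Jensen–Bregman divergence at least `s` which fit into `[0, x]`.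
By superadditivity the bound in the search is no restriction. -/
noncomputable def stepCount (G : ℝ → ℝ) (s x : ℝ) : ℕ :=
  Nat.findGreatest (fun n => Reaches G s n 0 x) ⌊jensenBregman G 0 1 / s⌋₊

theorem stepCount_le (x : ℝ) : stepCount G s x ≤ ⌊jensenBregman G 0 1 / s⌋₊ := by
  classical
  exact Nat.findGreatest_le _

theorem reaches_stepCount {x : ℝ} (hx : 0 ≤ x) : Reaches G s (stepCount G s x) 0 x := by
  classical
  unfold stepCount
  exact Nat.findGreatest_spec (P := fun n => Reaches G s n 0 x) (Nat.zero_le _) hx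

theorem le_stepCount (hG : ConvexOn ℝ (Icc 0 1) G) (hs : 0 < s) {n : ℕ} {x : ℝ} (hx : x ≤ 1)
    (h : Reaches G s n 0 x) : n ≤ stepCount G s x := by
  classical
  refine Nat.le_findGreatest (Nat.le_floor ?_) h
  rw [le_div_iff₀ hs]
  exact (h.mul_le hG le_rfl hx).trans (hG.jensenBregman_mono le_rfl le_rfl h.le hx le_rfl)

theorem stepCount_add_le (hG : ConvexOn ℝ (Icc 0 1) G) (hs : 0 < s) {n : ℕ} {a b : ℝ}
    (ha : 0 ≤ a) (hb : b ≤ 1) (h : Reaches G s n a b) :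
    stepCount G s a + n ≤ stepCount G s b :=
  le_stepCount hG hs hb ((reaches_stepCount ha).trans hG le_rfl hb h)

theorem stepCount_mono (hG : ConvexOn ℝ (Icc 0 1) G) (hs : 0 < s) {a b : ℝ}
    (ha : 0 ≤ a) (hab : a ≤ b) (hb : b ≤ 1) : stepCount G s a ≤ stepCount G s b :=
  stepCount_add_le hG hs (n := 0) ha hb hab

theorem stepCount_le_add (hG : ConvexOn ℝ (Icc 0 1) G) (hs : 0 < s) {a b : ℝ}
    (ha : 0 ≤ a) (hab : a ≤ b) (hb : b ≤ 1) :
    (stepCount G s b : ℝ) ≤ stepCount G s a + (1 + jensenBregman G a b / s) := by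
  obtain ⟨n₁, n₂, hn, h₁, h₂⟩ :=
    (reaches_stepCount (G := G) (s := s) (ha.trans hab)).split hG le_rfl ha hab hb
  have e1 := le_stepCount hG hs (hab.trans hb) h₁
  have e2 := h₂.mul_le hG ha hb
  rw [← le_div_iff₀ hs] at e2
  have : (stepCount G s b : ℝ) ≤ n₁ + n₂ + 1 := by exact_mod_cast hn
  have : (n₁ : ℝ) ≤ stepCount G s a := by exact_mod_cast e1
  linarith

/-- Hermite's identity. -/
theorem sum_range_add_div (m : ℕ) (hm : 0 < m) (N : ℕ) : ∑ j ∈ Finset.range m, (N + j) / m = N := by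
  induction N with
  | zero =>
    refine Finset.sum_eq_zero fun j hj => ?_
    rw [zero_add]
    exact Nat.div_eq_of_lt (Finset.mem_range.1 hj)
  | succ N ih =>
    have h1 := Finset.sum_range_succ (fun j => (N + j) / m) m
    have h2 := Finset.sum_range_succ' (fun j => (N + j) / m) m
    have h3 : (N + m) / m = N / m + 1 := Nat.add_div_right _ hm
    have h4 : ∑ j ∈ Finset.range m, (N + 1 + j) / m = ∑ j ∈ Finset.range m, (N + (j + 1)) / m :=
      Finset.sum_congr rfl fun j _ => by congr 1; ring
    simp only [add_zero] at h2
    omega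

/-- The projection of `ℝ` onto `[0, 1]`. -/
def unitClamp (x : ℝ) : ℝ := max 0 (min 1 x)

theorem unitClamp_mem (x : ℝ) : unitClamp x ∈ Icc (0 : ℝ) 1 :=
  ⟨le_max_left _ _, max_le zero_le_one (min_le_left _ _)⟩

theorem unitClamp_of_mem {x : ℝ} (hx : x ∈ Icc (0 : ℝ) 1) : unitClamp x = x := by
  rw [unitClamp, min_eq_right hx.2, max_eq_right hx.1]

theorem monotone_unitClamp : Monotone unitClamp := fun _ _ h =>
  max_le_max le_rfl (min_le_min le_rfl h)

theorem continuous_unitClamp : Continuous unitClamp := by unfold unitClamp; fun_prop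

theorem measurable_stepCount (hG : ConvexOn ℝ (Icc 0 1) G) (hs : 0 < s) :
    Measurable fun x => stepCount G s (unitClamp x) := by
  have : Monotone fun x => stepCount G s (unitClamp x) := fun x y h =>
    stepCount_mono hG hs (unitClamp_mem x).1 (monotone_unitClamp h) (unitClamp_mem y).2
  exact this.measurable

theorem ApproxTriangle.le_one (hG : StrictConvexOn ℝ (Icc 0 1) G) (hT : ApproxTriangle G c) :
    c ≤ 1 := by
  have h := hT 0 (by simp) 1 (by simp) 0 (by simp)
  rw [jensenBregman_self, zero_add] at h
  have h1 := hG.convexOn.jensenBregman_nonneg (a := 0) (b := 1) (by simp) (by simp)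
  have h2 : jensenBregman G 0 1 ≠ 0 := fun h0 =>
    zero_ne_one (hG.eq_of_jensenBregman_eq_zero (a := 0) (b := 1) (by simp) (by simp) h0)
  have h3 : 0 < jensenBregman G 0 1 := lt_of_le_of_ne h1 h2.symm
  by_contra! hc
  nlinarith

theorem jensenBregman_one_sub (hs : ∀ x ∈ Icc (0 : ℝ) 1, G (1 - x) = G x) {x y : ℝ}
    (hx : x ∈ Icc (0 : ℝ) 1) (hy : y ∈ Icc (0 : ℝ) 1) :
    jensenBregman G (1 - x) (1 - y) = jensenBregman G x y := by
  simp only [jensenBregman_eq]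
  rw [hs x hx, hs y hy, show (1 - x + (1 - y)) / 2 = 1 - (x + y) / 2 by ring,
    hs _ ⟨by linarith [hx.1, hy.1], by linarith [hx.2, hy.2]⟩]

/-- Grouping `2 ^ r` consecutive values of `stepCount`, at any of `2 ^ r` offsets, gives a partition
of `[0, 1]` into cells of Jensen–Bregman diameter at most `4 β / c ^ 2`; two points are separated
at few of the offsets. If the divergence jumps by at least `β` at the endpoints, where `G` may be
discontinuous, then `{0}` and `{1}` are made cells of their own. -/
theorem exists_partitions (hGs : StrictConvexOn ℝ (Icc 0 1) G)
    (hcont : ContinuousOn G (Ioo 0 1)) (hsym : ∀ x ∈ Icc (0 : ℝ) 1, G (1 - x) = G x)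
    (hc : 0 < c) (hT : ApproxTriangle G c) (hβ : 0 < β) (hs : 0 < s) (r : ℕ)
    (hr : (2 / c) ^ r * s ≤ β) :
    ∃ (n : ℕ) (k : Fin (2 ^ r) → ℝ → Fin n), (∀ j, Measurable (k j)) ∧
      (∀ j, ∀ x ∈ Icc (0 : ℝ) 1, ∀ y ∈ Icc (0 : ℝ) 1, k j x = k j y →
        jensenBregman G x y ≤ 4 * β / c ^ 2) ∧
      ∀ x ∈ Icc (0 : ℝ) 1, ∀ y ∈ Icc (0 : ℝ) 1,
        ∑ j, (if k j x = k j y then (0 : ℝ) else 1)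
          ≤ 1 + jensenBregman G x y / s + 2 ^ r * (jensenBregman G x y / β) := by
  classical
  have hG := hGs.convexOn
  have hc1 := hT.le_one hGs
  set m := 2 ^ r with hm
  have hmpos : 0 < m := by positivity
  set N := stepCount G s with hN
  set K := ⌊jensenBregman G 0 1 / s⌋₊
  -- The jump at the endpoints is at least `β`.
  set J : Prop := ∀ x ∈ Ioo (0 : ℝ) 1, β ≤ jensenBregman G 0 x with hJ
  set lab : ℕ → ℝ → ℕ := fun j x => if J ∧ x ≤ 0 then 0 else if J ∧ 1 ≤ x then 1 else
    (N (unitClamp x) + j) / m + 2 with hlab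
  have hlab_lt : ∀ j < m, ∀ x, lab j x < K + m + 3 := by
    intro j hj x
    simp only [hlab]
    split_ifs
    · omega
    · omega
    · have h1 : N (unitClamp x) ≤ K := stepCount_le _
      have := Nat.div_le_self (N (unitClamp x) + j) m
      omega
  have hlab_meas : ∀ j, Measurable (lab j) := by
    intro j
    refine Measurable.ite ?_ measurable_const (Measurable.ite ?_ measurable_const ?_)
    · exact (MeasurableSet.const J).inter measurableSet_Iic
    · exact (MeasurableSet.const J).inter measurableSet_Ici
    · exact (measurable_of_countable fun n : ℕ => (n + j) / m + 2).comp
        (measurable_stepCount hG hs)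
  have ndiv : ∀ (u v j : ℕ), (u + j) / m = (v + j) / m → v < u + m := by
    intro u v j h
    by_contra! hc
    have h1 : (u + j) / m + 1 ≤ (v + j) / m := by
      rw [← Nat.add_div_right _ hmpos]
      exact Nat.div_le_div_right (by omega)
    omega
  have interior : ∀ x y, 0 < x → x ≤ y → y < 1 → N y < N x + m → jensenBregman G x y < β := by
    intro x y hx hxy hy h
    by_contra! hcon
    have : N x + m ≤ N y := stepCount_add_le hG hs hx.le hy.le
      (reaches_two_pow hc hT hG hcont hx hxy hy (hr.trans hcon))
    omega
  have hβc : β ≤ β / c := by rw [le_div_iff₀ hc]; nlinarith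
  have hβc2 : β / c ≤ β / c ^ 2 := by
    rw [div_le_div_iff₀ hc (by positivity)]
    nlinarith [mul_pos hβ hc]
  have hbound : ∀ x y, 0 ≤ x → x ≤ y → y ≤ 1 → N y < N x + m →
      (J → 0 < x ∧ y < 1) → jensenBregman G x y ≤ 4 * β / c ^ 2 := by
    intro x y hx hxy hy h hJxy
    have e4 : 4 * β / c ^ 2 = 4 * (β / c ^ 2) := by ring
    rw [e4]
    by_cases hJ' : J
    · obtain ⟨h0, h1⟩ := hJxy hJ'
      have := interior x y h0 hxy h1 h
      linarith [div_pos hβ hc]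
    · simp only [hJ, not_forall, not_le] at hJ'
      obtain ⟨x0, hx0, hlt⟩ := hJ'
      have lefts : ∀ x1, 0 ≤ x1 → x1 ≤ x0 → jensenBregman G 0 x1 < β := fun x1 h0 h1 =>
        (hG.jensenBregman_mono le_rfl le_rfl h0 h1 hx0.2.le).trans_lt hlt
      have rights : ∀ x1, 1 - x0 ≤ x1 → x1 ≤ 1 → jensenBregman G x1 1 < β := by
        intro x1 h0 h1
        have := lefts (1 - x1) (by linarith) (by linarith)
        rw [← jensenBregman_one_sub hsym (by simp) ⟨by linarith, by linarith [hx0.1, hx0.2]⟩,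
          jensenBregman_comm] at this
        simpa using this
      have right : ∀ x, 0 < x → x ≤ 1 → N 1 < N x + m → jensenBregman G x 1 ≤ 2 * (β / c) := by
        intro x hx hx1 h
        rcases hx1.eq_or_lt with rfl | hx1
        · rw [jensenBregman_self]; positivity
        set x1 := max (1 - x0) x
        have a1 : x ≤ x1 := le_max_right _ _
        have a2 : 1 - x0 ≤ x1 := le_max_left _ _
        have a3 : x1 < 1 := max_lt (by linarith [hx0.1]) hx1
        have b1 := rights x1 a2 a3.le
        have b2 := interior x x1 hx a1 a3
          (lt_of_le_of_lt (stepCount_mono hG hs (hx.le.trans a1) a3.le le_rfl) h)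
        have := hT x ⟨hx.le, hx1.le⟩ 1 (by simp) x1 ⟨by linarith, a3.le⟩
        rw [show 2 * (β / c) = 2 * β / c by ring, le_div_iff₀ hc]
        linarith
      rcases hx.eq_or_lt with rfl | hxpos
      · rcases hy.eq_or_lt with rfl | hy1
        · have b1 := lefts x0 hx0.1.le le_rfl
          have b2 := right x0 hx0.1 hx0.2.le (lt_of_lt_of_le h
            (Nat.add_le_add_right (stepCount_mono hG hs le_rfl hx0.1.le hx0.2.le) m))
          have := hT 0 (by simp) 1 (by simp) x0 ⟨hx0.1.le, hx0.2.le⟩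
          rw [show 4 * (β / c ^ 2) = (4 * (β / c)) / c by field_simp, le_div_iff₀ hc]
          linarith
        · rcases hxy.eq_or_lt with rfl | hypos
          · rw [jensenBregman_self]; positivity
          set x1 := min x0 y
          have a1 : x1 ≤ y := min_le_right _ _
          have a2 : x1 ≤ x0 := min_le_left _ _
          have a3 : 0 < x1 := lt_min hx0.1 hypos
          have b1 := lefts x1 a3.le a2
          have b2 := interior x1 y a3 a1 hy1 (lt_of_lt_of_le h
            (Nat.add_le_add_right (stepCount_mono hG hs le_rfl a3.le (a1.trans hy)) m))
          have := hT 0 (by simp) y ⟨hxy, hy⟩ x1 ⟨a3.le, a1.trans hy⟩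
          have b3 : jensenBregman G 0 y ≤ 2 * β / c := by
            rw [le_div_iff₀ hc]
            linarith
          have : 2 * β / c = 2 * (β / c) := by ring
          linarith [div_pos hβ hc]
      · rcases hy.eq_or_lt with rfl | hy1
        · have := right x hxpos hxy h
          linarith [div_pos hβ hc]
        · have := interior x y hxpos hxy hy1 h
          linarith [div_pos hβ hc]
  refine ⟨K + m + 3, fun j x => ⟨lab j x, hlab_lt j j.2 x⟩, fun j => ?_, ?_, ?_⟩
  · refine measurable_to_countable' fun i => ?_
    have : (fun x => (⟨lab j x, hlab_lt j j.2 x⟩ : Fin (K + m + 3))) ⁻¹' {i} = lab j ⁻¹' {i.1} := by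
      ext x; simp [Fin.ext_iff]
    rw [this]
    exact hlab_meas j (measurableSet_singleton _)
  · intro j
    have key : ∀ x y, 0 ≤ x → x ≤ y → y ≤ 1 → lab j x = lab j y →
        jensenBregman G x y ≤ 4 * β / c ^ 2 := by
      intro x y hx hxy hy h
      have hux := unitClamp_of_mem (x := x) ⟨hx, hxy.trans hy⟩
      have huy := unitClamp_of_mem (x := y) ⟨hx.trans hxy, hy⟩
      simp only [hlab, hux, huy] at h
      by_cases hx0 : J ∧ x ≤ 0
      · rw [if_pos hx0] at h
        have hy0 : y ≤ 0 := by
          by_contra hy0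
          rw [if_neg (by tauto)] at h
          split_ifs at h
        have e1 : x = 0 := le_antisymm hx0.2 hx
        have e2 : y = 0 := le_antisymm hy0 (hx.trans hxy)
        rw [e1, e2, jensenBregman_self]; positivity
      rw [if_neg hx0] at h
      by_cases hx1 : J ∧ 1 ≤ x
      · have e1 : x = 1 := le_antisymm (hxy.trans hy) hx1.2
        have e2 : y = 1 := le_antisymm hy (e1 ▸ hxy)
        rw [e1, e2, jensenBregman_self]; positivity
      rw [if_neg hx1, if_neg (by intro h'; exact hx0 ⟨h'.1, hxy.trans h'.2⟩)] at h
      by_cases hy1 : J ∧ 1 ≤ y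
      · rw [if_pos hy1] at h
        simp at h
      rw [if_neg hy1] at h
      refine hbound x y hx hxy hy (ndiv _ _ j (Nat.add_right_cancel h)) fun hJ' => ⟨?_, ?_⟩
      · by_contra! h'; exact hx0 ⟨hJ', h'⟩
      · by_contra! h'; exact hy1 ⟨hJ', h'⟩
    intro x hx y hy h
    rw [Fin.mk.injEq] at h
    rcases le_total x y with hxy | hxy
    · exact key x y hx.1 hxy hy.2 h
    · rw [jensenBregman_comm]
      exact key y x hy.1 hxy hx.2 h.symm
  · have key : ∀ x y, 0 ≤ x → x ≤ y → y ≤ 1 →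
        ∑ j : Fin m, (if lab j x = lab j y then (0 : ℝ) else 1)
          ≤ 1 + jensenBregman G x y / s + 2 ^ r * (jensenBregman G x y / β) := by
      intro x y hx hxy hy
      have hnn := hG.jensenBregman_nonneg (a := x) (b := y) ⟨hx, hxy.trans hy⟩ ⟨hx.trans hxy, hy⟩
      have hd1 : 0 ≤ jensenBregman G x y / s := by positivity
      have hd2 : 0 ≤ jensenBregman G x y / β := by positivity
      by_cases hxy' : x = y
      · subst hxy'
        simp only [if_true, Finset.sum_const_zero]
        positivity
      have hlt : x < y := lt_of_le_of_ne hxy hxy'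
      by_cases hends : J ∧ (x ≤ 0 ∨ 1 ≤ y)
      · -- the crude bound `2 ^ r` suffices, since the divergence is at least `β`
        have hβJ : β ≤ jensenBregman G x y := by
          rcases hends.2 with h0 | h1
          · have e : x = 0 := le_antisymm h0 hx
            subst e
            have := hends.1 (y / 2) ⟨by linarith, by linarith⟩
            exact this.trans (hG.jensenBregman_mono le_rfl le_rfl (by linarith) (by linarith) hy)
          · have e : y = 1 := le_antisymm hy h1
            subst e
            have := hends.1 ((1 - x) / 2) ⟨by linarith, by linarith⟩
            have h2 := this.trans (hG.jensenBregman_mono (b := 1 - x) le_rfl le_rfl (by linarith)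
              (by linarith) (by linarith))
            rw [jensenBregman_comm, ← jensenBregman_one_sub hsym ⟨by linarith, by linarith⟩
              (by simp)] at h2
            simpa using h2
        have : (1 : ℝ) ≤ jensenBregman G x y / β := by rwa [one_le_div hβ]
        calc ∑ j : Fin m, (if lab j x = lab j y then (0 : ℝ) else 1)
            ≤ ∑ _j : Fin m, (1 : ℝ) := Finset.sum_le_sum fun j _ => by split_ifs <;> norm_num
          _ = 2 ^ r := by simp [hm]
          _ ≤ 2 ^ r * (jensenBregman G x y / β) := le_mul_of_one_le_right (by positivity) this
          _ ≤ _ := by linarith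
      · have hux := unitClamp_of_mem (x := x) ⟨hx, hxy.trans hy⟩
        have huy := unitClamp_of_mem (x := y) ⟨hx.trans hxy, hy⟩
        have hNm : N x ≤ N y := stepCount_mono hG hs hx hxy hy
        have hle : ∀ j : Fin m, (if lab j x = lab j y then (0 : ℝ) else 1)
            ≤ ((N y + j) / m : ℕ) - ((N x + j) / m : ℕ) := by
          intro j
          have h1 : lab j x = (N x + j) / m + 2 := by
            simp only [hlab, hux]
            rw [if_neg (by tauto), if_neg (by intro h'; linarith [h'.2])]
          have h2 : lab j y = (N y + j) / m + 2 := by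
            simp only [hlab, huy]
            rw [if_neg (by intro h'; linarith [h'.2]), if_neg (by tauto)]
          have h3 : (N x + j) / m ≤ (N y + j) / m := Nat.div_le_div_right (by omega)
          rw [h1, h2]
          split_ifs with h4
          · rw [sub_nonneg]; exact_mod_cast h3
          · rw [le_sub_iff_add_le']
            exact_mod_cast (show (N x + j) / m + 1 ≤ (N y + j) / m by omega)
        have hsum : ∀ z, ∑ j : Fin m, (((N z + j) / m : ℕ) : ℝ) = N z := by
          intro z
          rw [Fin.sum_univ_eq_sum_range (fun j => (((N z + j) / m : ℕ) : ℝ)) m, ← Nat.cast_sum,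
            sum_range_add_div m hmpos]
        calc ∑ j : Fin m, (if lab j x = lab j y then (0 : ℝ) else 1)
            ≤ ∑ j : Fin m, ((((N y + j) / m : ℕ) : ℝ) - ((N x + j) / m : ℕ)) :=
              Finset.sum_le_sum fun j _ => hle j
          _ = N y - N x := by rw [Finset.sum_sub_distrib, hsum, hsum]
          _ ≤ 1 + jensenBregman G x y / s := by
            linarith [stepCount_le_add hG hs hx hxy hy]
          _ ≤ _ := le_add_of_nonneg_right (by positivity)
    intro x hx y hy
    simp only [Fin.mk.injEq]
    rcases le_total x y with hxy | hxy
    · exact key x y hx.1 hxy hy.2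
    · rw [jensenBregman_comm]
      simp only [eq_comm (a := lab _ x)]
      exact key y x hy.1 hxy hx.2

end Partition

/-! ### Conditional expectations of random variables with values in the unit interval -/

section ClampedFunction

variable {G : ℝ → ℝ}

/-- A convex function on `[0, 1]`, symmetric about `1 / 2`, extended to `ℝ` by constants. It is
upper semicontinuous even if it jumps at the endpoints, where it is largest. -/
theorem ConvexOn.upperSemicontinuous_comp_unitClamp (hG : ConvexOn ℝ (Icc 0 1) G)
    (hcont : ContinuousOn G (Ioo 0 1)) (hs : ∀ x ∈ Icc (0 : ℝ) 1, G (1 - x) = G x) :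
    UpperSemicontinuous fun x => G (unitClamp x) := by
  have h10 : G 1 = G 0 := by simpa using hs 0 (by simp)
  intro x y hy
  by_cases hx : x ∈ Ioo (0 : ℝ) 1
  · have h1 : ContinuousAt G (unitClamp x) := by
      rw [unitClamp_of_mem (Ioo_subset_Icc_self hx)]
      exact hcont.continuousAt (Ioo_mem_nhds hx.1 hx.2)
    have h2 := ContinuousAt.comp (f := unitClamp) h1 continuous_unitClamp.continuousAt
    exact h2.eventually_lt_const hy
  · have : G (unitClamp x) = G 0 := by
      rcases le_or_gt x 0 with h | h
      · congr 1
        rw [unitClamp, min_eq_right (by linarith), max_eq_left h]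
      · have h1 : 1 ≤ x := by
          by_contra! h'
          exact hx ⟨h, h'⟩
        rw [← h10]
        congr 1
        rw [unitClamp, min_eq_left h1, max_eq_right zero_le_one]
    refine Eventually.of_forall fun z => lt_of_le_of_lt ?_ (lt_of_eq_of_lt this.symm hy)
    exact hG.le_apply_zero hs (unitClamp_mem z)

theorem ConvexOn.exists_abs_comp_unitClamp_le (hG : ConvexOn ℝ (Icc 0 1) G)
    (hs : ∀ x ∈ Icc (0 : ℝ) 1, G (1 - x) = G x) : ∃ K, ∀ x, |G (unitClamp x)| ≤ K := by
  refine ⟨max |G (1 / 2)| |G 0|, fun x => abs_le_max_abs_abs ?_ ?_⟩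
  · exact hG.apply_half_le hs (unitClamp_mem x)
  · exact hG.le_apply_zero hs (unitClamp_mem x)

end ClampedFunction

section CondExp

variable {Ω : Type*} {m m' mΩ : MeasurableSpace Ω} {P : Measure Ω} {X Y : Ω → ℝ}

theorem integrable_of_ae_mem_Icc [IsFiniteMeasure P] (hX : Measurable X)
    (h : ∀ᵐ ω ∂P, X ω ∈ Icc (0 : ℝ) 1) : Integrable X P := by
  refine Integrable.of_bound hX.aestronglyMeasurable 1 ?_
  filter_upwards [h] with ω hω
  rw [Real.norm_eq_abs, abs_le]
  exact ⟨by linarith [hω.1], hω.2⟩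

theorem measurable_condExp (hm : m ≤ mΩ) : Measurable (P[X | m]) :=
  stronglyMeasurable_condExp.measurable.mono hm le_rfl

theorem condExp_ae_mem_Icc [IsFiniteMeasure P] (hm : m ≤ mΩ) (hX : Measurable X)
    (h : ∀ᵐ ω ∂P, X ω ∈ Icc (0 : ℝ) 1) : ∀ᵐ ω ∂P, P[X | m] ω ∈ Icc (0 : ℝ) 1 := by
  have hi := integrable_of_ae_mem_Icc hX h
  have h0 : (0 : Ω → ℝ) ≤ᵐ[P] P[X | m] := condExp_nonneg (by filter_upwards [h] with ω hω using hω.1)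
  have h1 : P[X | m] ≤ᵐ[P] P[(fun _ => (1 : ℝ)) | m] :=
    condExp_mono hi (integrable_const _) (by filter_upwards [h] with ω hω using hω.2)
  rw [condExp_const hm] at h1
  filter_upwards [h0, h1] with ω a b using ⟨a, b⟩

theorem integrable_comp_of_bounded [IsFiniteMeasure P] {g : ℝ → ℝ} (hg : Measurable g) {K : ℝ}
    (hK : ∀ x, |g x| ≤ K) (hX : Measurable X) : Integrable (fun ω => g (X ω)) P :=
  Integrable.of_bound (hg.comp hX).aestronglyMeasurable K (Eventually.of_forall fun ω => hK (X ω))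

theorem integral_mul_condExp_eq [IsFiniteMeasure P] (hm : m ≤ mΩ) (hX : Integrable X P)
    {e : Ω → ℝ} (he : Measurable[m] e) {K : ℝ} (hK : ∀ ω, |e ω| ≤ K) :
    ∫ ω, e ω * X ω ∂P = ∫ ω, e ω * P[X | m] ω ∂P := by
  have h := condExp_stronglyMeasurable_mul_of_bound hm (f := e) (g := X) (μ := P)
    (Measurable.stronglyMeasurable he) hX K (Eventually.of_forall hK)
  calc ∫ ω, e ω * X ω ∂P = ∫ ω, (P[fun ω => e ω * X ω | m]) ω ∂P := (integral_condExp hm).symm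
    _ = _ := integral_congr_ae h

/-- Where the conditional expectation of a nonnegative random variable vanishes, so does the random
variable. -/
theorem ae_eq_zero_of_condExp_eq_zero [IsFiniteMeasure P] (hm : m ≤ mΩ) (hX : Integrable X P)
    (h0 : 0 ≤ᵐ[P] X) : ∀ᵐ ω ∂P, P[X | m] ω = 0 → X ω = 0 := by
  have hmeas : MeasurableSet[m] {ω | P[X | m] ω = 0} :=
    stronglyMeasurable_condExp.measurable (measurableSet_singleton 0)
  have h1 : ∫ ω in {ω | P[X | m] ω = 0}, X ω ∂P = 0 := by
    rw [← setIntegral_condExp hm hX hmeas]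
    exact setIntegral_eq_zero_of_forall_eq_zero fun ω hω => hω
  rw [setIntegral_eq_zero_iff_of_nonneg_ae (ae_restrict_of_ae h0) hX.integrableOn] at h1
  exact (ae_restrict_iff' (hm _ hmeas)).1 h1

theorem ae_eq_of_condExp_eq_zero_or_one [IsFiniteMeasure P] (hm : m ≤ mΩ) (hX : Measurable X)
    (h : ∀ᵐ ω ∂P, X ω ∈ Icc (0 : ℝ) 1) :
    ∀ᵐ ω ∂P, P[X | m] ω ∉ Ioo (0 : ℝ) 1 → X ω = P[X | m] ω := by
  have hi := integrable_of_ae_mem_Icc hX h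
  have e1 := ae_eq_zero_of_condExp_eq_zero hm hi (by filter_upwards [h] with ω hω using hω.1)
  have e2 := ae_eq_zero_of_condExp_eq_zero hm (X := (fun _ => (1 : ℝ)) - X)
    ((integrable_const _).sub hi)
    (by filter_upwards [h] with ω hω using sub_nonneg.2 hω.2)
  have e3 := condExp_sub (integrable_const (1 : ℝ)) hi m (μ := P)
  rw [condExp_const hm] at e3
  filter_upwards [e1, e2, e3, condExp_ae_mem_Icc hm hX h] with ω h1 h2 h3 h4 hn
  rcases h4.1.eq_or_lt with h5 | h5
  · rw [h1 h5.symm, h5]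
  · have h6 : P[X | m] ω = 1 := le_antisymm h4.2 (by
      by_contra! h'
      exact hn ⟨h5, h'⟩)
    have := h2 (by rw [h3]; simp [h6])
    simp only [Pi.sub_apply] at this
    linarith

/-- If `m` and `m'` have the same trace on `C`, then on `C` conditioning on `m'` amounts to
conditioning the measure on `C` and then conditioning on `m`. -/
theorem condExp_cond_ae_eq [IsProbabilityMeasure P] (hm' : m' ≤ mΩ) (hmm : m ≤ m')
    {C : Set Ω} (hC : MeasurableSet[m'] C)
    (htr : ∀ B, MeasurableSet[m'] B → ∃ B', MeasurableSet[m] B' ∧ B ∩ C = B' ∩ C)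
    (hY : Integrable Y P) : (P[|C])[Y | m] =ᵐ[P.restrict C] P[Y | m'] := by
  have hCΩ := hm' _ hC
  by_cases h0 : P C = 0
  · rw [Measure.restrict_eq_zero.2 h0]; simp [Filter.EventuallyEq]
  have hfin : P C ≠ ⊤ := measure_ne_top _ _
  have hsmul : P.restrict C = P C • P[|C] := by
    rw [ProbabilityTheory.cond, smul_smul, ENNReal.mul_inv_cancel h0 hfin, one_smul]
  have : IsProbabilityMeasure (P[|C]) := cond_isProbabilityMeasure h0
  have hYQ : Integrable Y (P[|C]) := by
    rw [ProbabilityTheory.cond]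
    exact hY.restrict.smul_measure (by simp [h0])
  set Z := (P[|C])[Y | m] with hZ
  have hZi : Integrable Z (P.restrict C) := by
    rw [hsmul]
    exact integrable_condExp.smul_measure hfin
  have hZm : StronglyMeasurable[m] Z := stronglyMeasurable_condExp
  have key : C.indicator Z =ᵐ[P] P[C.indicator Y | m'] := by
    refine ae_eq_condExp_of_forall_setIntegral_eq hm' (hY.indicator hCΩ) (fun B _ _ => ?_)
      (fun B hB _ => ?_) ?_
    · exact ((integrable_indicator_iff hCΩ).2 hZi).integrableOn
    · obtain ⟨B', hB', hBB'⟩ := htr B hB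
      have hB'Ω := hm' _ (hmm _ hB')
      rw [setIntegral_indicator hCΩ, setIntegral_indicator hCΩ, hBB',
        ← Measure.restrict_restrict hB'Ω, hsmul, Measure.restrict_smul, integral_smul_measure,
        integral_smul_measure, setIntegral_condExp (hmm.trans hm') hYQ hB']
    · exact ((hZm.mono hmm).indicator hC).aestronglyMeasurable
  have h2 := condExp_indicator hY hC (m := m')
  have h3 := key.trans h2
  rw [Filter.EventuallyEq, ae_restrict_iff' hCΩ]
  filter_upwards [h3] with ω hω hωC
  simpa [hωC] using hω

end CondExp

/-! ### The expected Bregman divergence from a conditional expectation -/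

section Bregman

variable {G : ℝ → ℝ} {Ω : Type*} {m mΩ : MeasurableSpace Ω} {P : Measure Ω} {X : Ω → ℝ}

/-- The term `(X - E[X | m]) G'(E[X | m])` need not be bounded; the divergence is nevertheless
integrable because it is nonnegative and the term has mean zero on every event of `m` on which the
derivative is bounded. -/
theorem ConvexOn.bregman_condExp (hG : ConvexOn ℝ (Icc 0 1) G)
    (hd : DifferentiableOn ℝ G (Ioo 0 1)) (hs : ∀ x ∈ Icc (0 : ℝ) 1, G (1 - x) = G x)
    [IsProbabilityMeasure P] (hm : m ≤ mΩ) (hX : Measurable X)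
    (h : ∀ᵐ ω ∂P, X ω ∈ Icc (0 : ℝ) 1) :
    Integrable (fun ω => bregman G (X ω) (P[X | m] ω)) P ∧
      ∫ ω, bregman G (X ω) (P[X | m] ω) ∂P
        = ∫ ω, G (unitClamp (X ω)) ∂P - ∫ ω, G (unitClamp (P[X | m] ω)) ∂P := by
  classical
  set g : ℝ → ℝ := fun x => G (unitClamp x) with hg
  have hgm : Measurable g :=
    (hG.upperSemicontinuous_comp_unitClamp hd.continuousOn hs).measurable
  obtain ⟨K, hK⟩ := hG.exists_abs_comp_unitClamp_le hs
  set Z := P[X | m] with hZ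
  have hZm : Measurable[m] Z := stronglyMeasurable_condExp.measurable
  have hZΩ : Measurable Z := measurable_condExp hm
  have hZI : ∀ᵐ ω ∂P, Z ω ∈ Icc (0 : ℝ) 1 := condExp_ae_mem_Icc hm hX h
  have hZX : ∀ᵐ ω ∂P, Z ω ∉ Ioo (0 : ℝ) 1 → X ω = Z ω :=
    ae_eq_of_condExp_eq_zero_or_one hm hX h
  have hXi := integrable_of_ae_mem_Icc hX h
  have hZi : Integrable Z P := integrable_condExp
  have hgX : Integrable (fun ω => g (X ω)) P := integrable_comp_of_bounded hgm hK hX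
  have hgZ : Integrable (fun ω => g (Z ω)) P := integrable_comp_of_bounded hgm hK hZΩ
  set d : Ω → ℝ := fun ω => if Z ω ∈ Ioo (0 : ℝ) 1 then deriv G (Z ω) else 0 with hdd
  have hdm : Measurable[m] d :=
    Measurable.ite (hZm measurableSet_Ioo) ((measurable_deriv G).comp hZm) measurable_const
  set D : Ω → ℝ := fun ω => g (X ω) - g (Z ω) - (X ω - Z ω) * d ω with hD
  have hDae : (fun ω => bregman G (X ω) (Z ω)) =ᵐ[P] D := by
    filter_upwards [h, hZI, hZX] with ω hω hZω hend
    simp only [hD, hg, hdd, unitClamp_of_mem hω, unitClamp_of_mem hZω]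
    by_cases hIoo : Z ω ∈ Ioo (0 : ℝ) 1
    · rw [bregman_of_mem_Ioo hIoo, if_pos hIoo]
    · rw [if_neg hIoo, hend hIoo, bregman]; ring
  have hDnn : ∀ᵐ ω ∂P, 0 ≤ D ω := by
    filter_upwards [h, hZI, hZX] with ω hω hZω hend
    simp only [hD, hg, hdd, unitClamp_of_mem hω, unitClamp_of_mem hZω]
    by_cases hIoo : Z ω ∈ Ioo (0 : ℝ) 1
    · rw [if_pos hIoo]
      linarith [hG.tangent_le hd hIoo hω]
    · rw [if_neg hIoo, hend hIoo]; simp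
  set φ : ℕ → Set Ω := fun n => {ω | |d ω| ≤ n} with hφ
  have hφm : ∀ n, MeasurableSet[m] (φ n) := fun n =>
    measurableSet_le (measurable_norm.comp hdm) measurable_const
  have hcov : AECover P atTop φ := by
    refine ⟨Eventually.of_forall fun ω => ?_, fun n => hm _ (hφm n)⟩
    filter_upwards [eventually_ge_atTop (Nat.ceil (abs (d ω)))] with n hn
    exact (Nat.le_ceil (abs (d ω))).trans (by exact_mod_cast hn)
  have hterm : ∀ n, IntegrableOn (fun ω => (X ω - Z ω) * d ω) (φ n) P ∧
      ∫ ω in φ n, (X ω - Z ω) * d ω ∂P = 0 := by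
    intro n
    set e : Ω → ℝ := (φ n).indicator d with he
    have hem : Measurable[m] e := Measurable.indicator hdm (hφm n)
    have heb : ∀ ω, |e ω| ≤ n := by
      intro ω
      by_cases hω : ω ∈ φ n
      · rw [he, indicator_of_mem hω]; exact hω
      · rw [he, indicator_of_notMem hω]; simp
    have hind : (φ n).indicator (fun ω => (X ω - Z ω) * d ω)
        = fun ω => e ω * X ω - e ω * Z ω := by
      ext ω
      by_cases hω : ω ∈ φ n
      · rw [he, indicator_of_mem hω, indicator_of_mem hω]; ring
      · rw [he, indicator_of_notMem hω, indicator_of_notMem hω]; ring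
    have hi1 : Integrable (fun ω => e ω * X ω) P :=
      hXi.bdd_mul (c := n) (hem.mono hm le_rfl).aestronglyMeasurable (Eventually.of_forall heb)
    have hi2 : Integrable (fun ω => e ω * Z ω) P :=
      hZi.bdd_mul (c := n) (hem.mono hm le_rfl).aestronglyMeasurable (Eventually.of_forall heb)
    refine ⟨?_, ?_⟩
    · rw [← integrable_indicator_iff (hm _ (hφm n)), hind]
      exact hi1.sub hi2
    · rw [← integral_indicator (hm _ (hφm n)), hind, integral_sub hi1 hi2,
        integral_mul_condExp_eq hm hXi hem heb, sub_self]
  have hon : ∀ n, IntegrableOn D (φ n) P := fun n =>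
    (hgX.integrableOn.sub hgZ.integrableOn).sub (hterm n).1
  have heq : ∀ n, ∫ ω in φ n, D ω ∂P = ∫ ω in φ n, (g (X ω) - g (Z ω)) ∂P := by
    intro n
    have := integral_sub (μ := P.restrict (φ n))
      (hgX.integrableOn.sub hgZ.integrableOn) (hterm n).1
    rw [(hterm n).2, sub_zero] at this
    exact this
  have hDi : Integrable D P := by
    refine hcov.integrable_of_integral_bounded_of_nonneg_ae (K + K) hon hDnn
      (Eventually.of_forall fun n => ?_)
    rw [heq]
    have hb : ∀ ω, ‖g (X ω) - g (Z ω)‖ ≤ K + K := fun ω =>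
      (norm_sub_le _ _).trans (add_le_add (hK _) (hK _))
    have := norm_setIntegral_le_of_norm_le_const (μ := P) (s := φ n) (measure_lt_top _ _)
      (fun ω _ => hb ω)
    have hK0 : 0 ≤ K + K := (norm_nonneg _).trans (hb (Classical.choice P.nonempty_of_neZero))
    exact (le_abs_self _).trans (this.trans (mul_le_of_le_one_right hK0 measureReal_le_one))
  refine ⟨(integrable_congr hDae).2 hDi, ?_⟩
  rw [integral_congr_ae hDae, ← integral_sub hgX hgZ]
  have l1 := hcov.integral_tendsto_of_countably_generated hDi
  have l2 := hcov.integral_tendsto_of_countably_generated (hgX.sub hgZ)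
  simp only [heq] at l1
  exact tendsto_nhds_unique l1 l2

end Bregman

/-! ### Approximation by finite partitions into rectangles -/

section Fibers

variable {Ω : Type*} {ι κ : Type*} {m mΩ : MeasurableSpace Ω}

/-- All fibers of `V` belong to `m`. For a countable codomain this says that `V` is `m`-measurable
with respect to the discrete σ-algebra. -/
def FiberMeasurable (m : MeasurableSpace Ω) (V : Ω → κ) : Prop :=
  ∀ i, MeasurableSet[m] (V ⁻¹' {i})

theorem FiberMeasurable.preimage [Finite κ] {V : Ω → κ} (hV : FiberMeasurable m V) (s : Set κ) :
    MeasurableSet[m] (V ⁻¹' s) := by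
  rw [← biUnion_preimage_singleton]
  exact MeasurableSet.biUnion s.to_countable fun i _ => hV i

theorem FiberMeasurable.mem_fiber [Finite κ] {V : Ω → κ} (hV : FiberMeasurable m V)
    {b : κ → Set Ω} (hb : ∀ i, MeasurableSet[m] (b i)) : MeasurableSet[m] {ω | ω ∈ b (V ω)} := by
  have : {ω | ω ∈ b (V ω)} = ⋃ i, (V ⁻¹' {i} ∩ b i) := by
    ext ω; simp
  rw [this]
  exact MeasurableSet.iUnion fun i => (hV i).inter (hb i)

theorem FiberMeasurable.mono {m' : MeasurableSpace Ω} (h : m ≤ m') {V : Ω → κ}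
    (hV : FiberMeasurable m V) : FiberMeasurable m' V := fun i => h _ (hV i)

theorem FiberMeasurable.prodMk {V : Ω → κ} {W : Ω → ι} (hV : FiberMeasurable m V)
    (hW : FiberMeasurable m W) : FiberMeasurable m fun ω => (V ω, W ω) := by
  rintro ⟨i, j⟩
  have : (fun ω => (V ω, W ω)) ⁻¹' {(i, j)} = V ⁻¹' {i} ∩ W ⁻¹' {j} := by
    ext ω; simp
  rw [this]
  exact (hV i).inter (hW j)

theorem FiberMeasurable.pi {β : κ → Type*} [Finite κ] {V : ∀ i, Ω → β i}
    (hV : ∀ i, FiberMeasurable m (V i)) : FiberMeasurable m fun ω i => V i ω := by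
  intro v
  have : (fun ω i => V i ω) ⁻¹' {v} = ⋂ i, V i ⁻¹' {v i} := by
    ext ω; simp [funext_iff]
  rw [this]
  exact MeasurableSet.iInter fun i => hV i _

theorem FiberMeasurable.measurableSet_ne [Finite κ] {V W : Ω → κ} (hV : FiberMeasurable m V)
    (hW : FiberMeasurable m W) : MeasurableSet[m] {ω | V ω ≠ W ω} :=
  (hV.prodMk hW).preimage {x | x.1 ≠ x.2}

/-- The events known from `h` and from the value of `R` are determined by choosing, for each
possible value of `R`, an event of `h`. -/
theorem measurableSet_sup_comap_top {h : MeasurableSpace Ω} {R : Ω → ι} {B : Set Ω}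
    (hB : MeasurableSet[h ⊔ MeasurableSpace.comap R ⊤] B) :
    ∃ b : ι → Set Ω, (∀ i, MeasurableSet[h] (b i)) ∧ B = {ω | ω ∈ b (R ω)} := by
  let 𝒟 : MeasurableSpace Ω :=
    { MeasurableSet' := fun B => ∃ b : ι → Set Ω, (∀ i, MeasurableSet[h] (b i)) ∧
        B = {ω | ω ∈ b (R ω)}
      measurableSet_empty := ⟨fun _ => ∅, fun _ => MeasurableSet.empty, by simp⟩
      measurableSet_compl := by
        rintro _ ⟨b, hb, rfl⟩
        exact ⟨fun i => (b i)ᶜ, fun i => (hb i).compl, rfl⟩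
      measurableSet_iUnion := by
        intro f hf
        choose b hb hfb using hf
        refine ⟨fun i => ⋃ n, b n i, fun i => MeasurableSet.iUnion fun n => hb n i, ?_⟩
        ext ω; simp [hfb] }
  have hle : h ⊔ MeasurableSpace.comap R ⊤ ≤ 𝒟 := by
    refine sup_le (fun s hs => ⟨fun _ => s, fun _ => hs, rfl⟩) ?_
    rintro _ ⟨t, -, rfl⟩
    exact ⟨fun i => {_ω | i ∈ t}, fun i => @MeasurableSet.const _ h _, rfl⟩
  exact hle _ hB

theorem FiberMeasurable.comap_le [Finite κ] {V : Ω → κ} (hV : FiberMeasurable m V) :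
    MeasurableSpace.comap V ⊤ ≤ m := by
  rintro _ ⟨s, -, rfl⟩
  exact hV.preimage s

end Fibers

section Density

variable {Ω : Type*} {h 𝒢 mΩ : MeasurableSpace Ω} {P : Measure Ω}

/-- An event of `h ⊔ 𝒢` is approximated by events which depend on `𝒢` only through a random
variable with finitely many values. -/
theorem exists_finite_approx_set [IsFiniteMeasure P] (hh : h ≤ mΩ) (h𝒢 : 𝒢 ≤ mΩ) {E : Set Ω}
    (hE : MeasurableSet[h ⊔ 𝒢] E) {δ : ℝ} (hδ : 0 < δ) :
    ∃ (κ : Type) (_ : Finite κ) (V : Ω → κ) (b : κ → Set Ω), FiberMeasurable 𝒢 V ∧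
      (∀ i, MeasurableSet[h] (b i)) ∧ P.real (symmDiff E {ω | ω ∈ b (V ω)}) < δ := by
  set 𝒜 : Set (Set Ω) := {E | ∃ (κ : Type) (_ : Finite κ) (V : Ω → κ) (b : κ → Set Ω),
    FiberMeasurable 𝒢 V ∧ (∀ i, MeasurableSet[h] (b i)) ∧ E = {ω | ω ∈ b (V ω)}} with h𝒜
  have hm : h ⊔ 𝒢 ≤ mΩ := sup_le hh h𝒢
  have halg : IsSetAlgebra 𝒜 := by
    refine ⟨⟨Unit, inferInstance, fun _ => (), fun _ => ∅, fun i => ?_,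
      fun _ => @MeasurableSet.empty _ h,
      by simp⟩, ?_, ?_⟩
    · exact @MeasurableSet.const _ 𝒢 _
    · rintro _ ⟨κ, hκ, V, b, hV, hb, rfl⟩
      exact ⟨κ, hκ, V, fun i => (b i)ᶜ, hV, fun i => (hb i).compl, rfl⟩
    · rintro _ _ ⟨κ, hκ, V, b, hV, hb, rfl⟩ ⟨κ', hκ', V', b', hV', hb', rfl⟩
      exact ⟨κ × κ', inferInstance, fun ω => (V ω, V' ω), fun i => b i.1 ∪ b' i.2,
        hV.prodMk hV', fun i => (hb _).union (hb' _), rfl⟩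
  have hgen : h ⊔ 𝒢 = MeasurableSpace.generateFrom 𝒜 := by
    refine le_antisymm (sup_le (fun s hs => ?_) fun s hs => ?_)
      (MeasurableSpace.generateFrom_le ?_)
    · exact MeasurableSpace.measurableSet_generateFrom
        ⟨Unit, inferInstance, fun _ => (), fun _ => s, fun i => @MeasurableSet.const _ 𝒢 _,
          fun _ => hs, rfl⟩
    · refine MeasurableSpace.measurableSet_generateFrom
        ⟨Prop, inferInstance, fun ω => ω ∈ s, fun p => {_ω | p}, fun p => ?_,
          fun _ => @MeasurableSet.const _ h _, rfl⟩
      by_cases hp : p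
      · convert hs using 1; ext ω; simp [hp]
      · convert hs.compl using 1; ext ω; simp [hp]
    · rintro _ ⟨κ, hκ, V, b, hV, hb, rfl⟩
      exact (hV.mono le_sup_right).mem_fiber fun i => le_sup_left (a := h) (b := 𝒢) _ (hb i)
  have hdense := @Measure.MeasureDense.of_generateFrom_isSetAlgebra_finite Ω (h ⊔ 𝒢)
    (P.trim hm) 𝒜 inferInstance halg hgen
  obtain ⟨t, ⟨κ, hκ, V, b, hV, hb, rfl⟩, ht⟩ :=
    @Measure.MeasureDense.approx Ω (h ⊔ 𝒢) _ _ hdense E hE (measure_ne_top _ _) δ hδ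
  have htm : MeasurableSet[h ⊔ 𝒢] {ω | ω ∈ b (V ω)} :=
    @Measure.MeasureDense.measurable Ω (h ⊔ 𝒢) _ _ hdense _ ⟨κ, hκ, V, b, hV, hb, rfl⟩
  rw [trim_measurableSet_eq hm (hE.symmDiff htm)] at ht
  refine ⟨κ, hκ, V, b, hV, hb, ?_⟩
  rw [measureReal_def]
  exact ENNReal.toReal_lt_of_lt_ofReal ht

/-- A finite-valued random variable known from `h` and `𝒢` is approximated by ones which depend on
`𝒢` only through a random variable with finitely many values. -/
theorem exists_finite_approx [IsProbabilityMeasure P] (hh : h ≤ mΩ) (h𝒢 : 𝒢 ≤ mΩ) {κ : Type}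
    [Finite κ] {V : Ω → κ} (hV : FiberMeasurable (h ⊔ 𝒢) V) {δ : ℝ} (hδ : 0 < δ) :
    ∃ (κ' : Type) (_ : Finite κ') (V' : Ω → κ') (g : Ω → κ' → κ), FiberMeasurable 𝒢 V' ∧
      (∀ i, FiberMeasurable h (fun ω => g ω i)) ∧ P.real {ω | g ω (V' ω) ≠ V ω} < δ := by
  classical
  have := Fintype.ofFinite κ
  have hκ : Nonempty κ := ⟨V (Classical.choice P.nonempty_of_neZero)⟩
  have hcard : (0 : ℝ) < Fintype.card κ := by exact_mod_cast Fintype.card_pos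
  choose κ' hκ' V' b hV' hb hlt using fun i : κ => exists_finite_approx_set (P := P) hh h𝒢 (hV i)
    (div_pos hδ hcard)
  -- `dec` recovers a value from its indicator function
  let dec : (κ → Prop) → κ := fun p => if hp : ∃ i, p = fun j => j = i then hp.choose else
    Classical.choice hκ
  have hdec : ∀ i, dec (fun j => j = i) = i := by
    intro i
    have hp : ∃ i', (fun j : κ => j = i) = fun j => j = i' := ⟨i, rfl⟩
    simp only [dec, dif_pos hp]
    have := congrFun hp.choose_spec i
    exact (eq_iff_iff.1 this).1 rfl |>.symm
  refine ⟨∀ i, κ' i, inferInstance, fun ω i => V' i ω,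
    fun ω v => dec fun i => ω ∈ b i (v i), FiberMeasurable.pi hV', fun v => ?_, ?_⟩
  · have h1 : FiberMeasurable h fun ω (i : κ) => ω ∈ b i (v i) := by
      refine FiberMeasurable.pi (V := fun i ω => ω ∈ b i (v i)) fun i p => ?_
      by_cases hp : p
      · convert hb i (v i) using 1; ext ω; simp [hp]
      · convert (hb i (v i)).compl using 1; ext ω; simp [hp]
    intro i
    exact h1.preimage (dec ⁻¹' {i})
  · have hsub : {ω | dec (fun i => ω ∈ b i (V' i ω)) ≠ V ω}
        ⊆ ⋃ i, symmDiff (V ⁻¹' {i}) {ω | ω ∈ b i (V' i ω)} := by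
      intro ω hω
      by_contra hcon
      simp only [mem_iUnion, not_exists, mem_symmDiff, mem_preimage, mem_singleton_iff,
        mem_ofPred_eq] at hcon
      refine hω ?_
      have : (fun i => ω ∈ b i (V' i ω)) = fun i => i = V ω := by
        ext i
        have := hcon i
        constructor
        · intro h1
          by_contra h2
          exact this (Or.inr ⟨h1, fun h3 => h2 h3.symm⟩)
        · intro h1
          by_contra h2
          exact this (Or.inl ⟨h1.symm, h2⟩)
      rw [this, hdec]
    calc P.real _ ≤ P.real (⋃ i, symmDiff (V ⁻¹' {i}) {ω | ω ∈ b i (V' i ω)}) :=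
          measureReal_mono hsub
      _ ≤ ∑ i, P.real (symmDiff (V ⁻¹' {i}) {ω | ω ∈ b i (V' i ω)}) :=
          measureReal_iUnion_fintype_le _
      _ < ∑ _i : κ, δ / Fintype.card κ := Finset.sum_lt_sum_of_nonempty Finset.univ_nonempty
          fun i _ => hlt i
      _ = δ := by
        rw [Finset.sum_const, Finset.card_univ, nsmul_eq_mul]
        field_simp

end Density

section RectApprox

variable {Ω 𝒮 𝒯 : Type*} [mS : MeasurableSpace 𝒮] [mT : MeasurableSpace 𝒯]
  {𝒢 𝒢' mΩ : MeasurableSpace Ω} {P : Measure Ω} {σ : Ω → 𝒮} {τ : Ω → 𝒯}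

/-- The partition of `Ω` according to the value of `R` consists of rectangles
`{σ ∈ S, τ ∈ T}`. -/
def IsRectangular {ι : Type*} (σ : Ω → 𝒮) (τ : Ω → 𝒯) (R : Ω → ι) : Prop :=
  ∀ i, ∃ S T, MeasurableSet S ∧ MeasurableSet T ∧ R ⁻¹' {i} = σ ⁻¹' S ∩ τ ⁻¹' T

theorem IsRectangular.swap {ι : Type*} {R : Ω → ι} (h : IsRectangular σ τ R) :
    IsRectangular τ σ R := fun i => by
  obtain ⟨S, T, hS, hT, h⟩ := h i
  exact ⟨T, S, hT, hS, by rw [h, inter_comm]⟩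

theorem IsRectangular.fiberMeasurable {ι : Type*} {R : Ω → ι} (h : IsRectangular σ τ R)
    (hσ : Measurable σ) (hτ : Measurable τ) : FiberMeasurable mΩ R := fun i => by
  obtain ⟨S, T, hS, hT, h⟩ := h i
  rw [h]
  exact (hσ hS).inter (hτ hT)

/-- The σ-algebra `𝒢` is approximable by rectangles: every finite partition in `𝒢` has a finite
refinement in `𝒢` which coincides, up to an event of small probability, with a partition into
rectangles. This is what remains, when messages take a continuum of values, of the fact that
the signal pairs leading to a given transcript form a rectangle. -/
def RectApprox (P : Measure Ω) (σ : Ω → 𝒮) (τ : Ω → 𝒯) (𝒢 : MeasurableSpace Ω) : Prop :=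
  ∀ (κ : Type) [Finite κ] (V : Ω → κ), FiberMeasurable 𝒢 V → ∀ δ : ℝ, 0 < δ →
    ∃ (ι : Type) (_ : Finite ι) (U R : Ω → ι) (φ : ι → κ), FiberMeasurable 𝒢 U ∧
      IsRectangular σ τ R ∧ (∀ ω, φ (U ω) = V ω) ∧ P.real {ω | R ω ≠ U ω} < δ

theorem RectApprox.swap (h : RectApprox P σ τ 𝒢) : RectApprox P τ σ 𝒢 := by
  intro κ _ V hV δ hδ
  obtain ⟨ι, hι, U, R, φ, hU, hR, hφ, hlt⟩ := h κ V hV δ hδ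
  exact ⟨ι, hι, U, R, φ, hU, hR.swap, hφ, hlt⟩

theorem rectApprox_bot : RectApprox P σ τ ⊥ := by
  intro κ _ V hV δ hδ
  refine ⟨κ, inferInstance, V, V, id, hV, fun i => ?_, fun _ => rfl, by simpa using hδ⟩
  rcases MeasurableSpace.measurableSet_bot_iff.1 (hV i) with h | h
  · exact ⟨∅, ∅, .empty, .empty, by simp [h]⟩
  · exact ⟨univ, univ, .univ, .univ, by simp [h]⟩

/-- Approximability persists when the holder of `σ` reveals something known to her. -/
theorem RectApprox.of_le_sup [IsProbabilityMeasure P] (hσ : Measurable σ) (h𝒢 : 𝒢 ≤ mΩ)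
    (h : RectApprox P σ τ 𝒢) (hle : 𝒢 ≤ 𝒢') (hle' : 𝒢' ≤ mS.comap σ ⊔ 𝒢) :
    RectApprox P σ τ 𝒢' := by
  intro κ _ V hV δ hδ
  obtain ⟨κ', hκ', V', g, hV', hg, hlt⟩ :=
    exists_finite_approx (P := P) hσ.comap_le h𝒢 (hV.mono hle') (half_pos hδ)
  obtain ⟨ι, hι, U, R, φ, hU, hR, hφ, hltR⟩ := h κ' V' hV' (δ / 2) (half_pos hδ)
  refine ⟨ι × κ, inferInstance, fun ω => (U ω, V ω), fun ω => (R ω, g ω (φ (R ω))), Prod.snd,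
    (hU.mono hle).prodMk hV, ?_, fun _ => rfl, ?_⟩
  · rintro ⟨i, k⟩
    obtain ⟨S, T, hS, hT, hST⟩ := hR i
    obtain ⟨S', hS', hS'eq⟩ := hg (φ i) k
    refine ⟨S ∩ S', T, hS.inter hS', hT, ?_⟩
    have : (fun ω => (R ω, g ω (φ (R ω)))) ⁻¹' {(i, k)}
        = R ⁻¹' {i} ∩ (fun ω => g ω (φ i)) ⁻¹' {k} := by
      ext ω
      simp only [mem_preimage, mem_singleton_iff, Prod.mk.injEq, mem_inter_iff]
      constructor
      · rintro ⟨rfl, h⟩; exact ⟨rfl, h⟩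
      · rintro ⟨rfl, h⟩; exact ⟨rfl, h⟩
    rw [this, hST, ← hS'eq, preimage_inter]
    ext ω; simp only [mem_inter_iff]; tauto
  · have hsub : {ω | (R ω, g ω (φ (R ω))) ≠ (U ω, V ω)}
        ⊆ {ω | R ω ≠ U ω} ∪ {ω | g ω (V' ω) ≠ V ω} := by
      intro ω hω
      by_contra hcon
      simp only [mem_union, mem_ofPred_eq, not_or, not_not] at hcon
      refine hω ?_
      rw [hcon.1, hφ, hcon.2]
    calc P.real _ ≤ _ := measureReal_mono hsub
      _ ≤ _ := measureReal_union_le _ _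
      _ < δ := by linarith

/-- Approximability passes to limits. -/
theorem RectApprox.of_limit [IsFiniteMeasure P]
    (h : ∀ (κ : Type) [Finite κ] (V : Ω → κ), FiberMeasurable 𝒢 V → ∀ δ : ℝ, 0 < δ →
      ∃ 𝒢₁ : MeasurableSpace Ω, RectApprox P σ τ 𝒢₁ ∧
        (∀ (ι : Type) [Finite ι] (U₁ : Ω → ι), FiberMeasurable 𝒢₁ U₁ →
          ∃ U, FiberMeasurable 𝒢 U ∧ U =ᵐ[P] U₁) ∧
        ∃ V₁ : Ω → κ, FiberMeasurable 𝒢₁ V₁ ∧ P.real {ω | V₁ ω ≠ V ω} < δ) :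
    RectApprox P σ τ 𝒢 := by
  intro κ _ V hV δ hδ
  obtain ⟨𝒢₁, h₁, hae, V₁, hV₁, hlt₁⟩ := h κ V hV (δ / 2) (half_pos hδ)
  obtain ⟨ι, hι, U₁, R, φ, hU₁, hR, hφ, hlt⟩ := h₁ κ V₁ hV₁ (δ / 2) (half_pos hδ)
  obtain ⟨U, hU, hUae⟩ := hae ι U₁ hU₁
  refine ⟨ι × κ, inferInstance, fun ω => (U ω, V ω), fun ω => (R ω, φ (R ω)), Prod.snd,
    hU.prodMk hV, ?_, fun _ => rfl, ?_⟩
  · rintro ⟨i, k⟩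
    by_cases hk : φ i = k
    · obtain ⟨S, T, hS, hT, hST⟩ := hR i
      refine ⟨S, T, hS, hT, ?_⟩
      rw [← hST, ← hk]
      ext ω
      simp only [mem_preimage, mem_singleton_iff, Prod.mk.injEq]
      exact ⟨fun h => h.1, fun h => ⟨h, by rw [h]⟩⟩
    · refine ⟨∅, ∅, .empty, .empty, ?_⟩
      ext ω
      simp only [mem_preimage, mem_singleton_iff, Prod.mk.injEq, preimage_empty, inter_self,
        mem_empty_iff_false, iff_false, not_and]
      rintro rfl
      exact hk
  · have hsub : {ω | (R ω, φ (R ω)) ≠ (U ω, V ω)}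
        ⊆ ({ω | R ω ≠ U₁ ω} ∪ {ω | V₁ ω ≠ V ω}) ∪ {ω | U ω ≠ U₁ ω} := by
      intro ω hω
      by_contra hcon
      simp only [mem_union, mem_ofPred_eq, not_or, not_not] at hcon
      refine hω ?_
      rw [hcon.2, hcon.1.1, hφ, hcon.1.2]
    have h0 : P.real {ω | U ω ≠ U₁ ω} = 0 := by
      rw [measureReal_def, ae_iff.1 hUae, ENNReal.toReal_zero]
    calc P.real _ ≤ _ := measureReal_mono hsub
      _ ≤ P.real ({ω | R ω ≠ U₁ ω} ∪ {ω | V₁ ω ≠ V ω}) + P.real {ω | U ω ≠ U₁ ω} :=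
        measureReal_union_le _ _
      _ ≤ (P.real {ω | R ω ≠ U₁ ω} + P.real {ω | V₁ ω ≠ V ω}) + P.real {ω | U ω ≠ U₁ ω} := by
        gcongr; exact measureReal_union_le _ _
      _ < δ := by linarith

end RectApprox

/-! ### Stability of conditional expectations -/

section Stability

variable {Ω : Type*} {h 𝒢 mR mΩ : MeasurableSpace Ω} {P : Measure Ω}

theorem exists_finite_approx_real [IsProbabilityMeasure P] (hh : h ≤ mΩ) (h𝒢 : 𝒢 ≤ mΩ)
    {X : Ω → ℝ} (hX : Measurable[h ⊔ 𝒢] X) (hX1 : ∀ᵐ ω ∂P, X ω ∈ Icc (0 : ℝ) 1)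
    {η : ℝ} (hη : 0 < η) :
    ∃ (κ : Type) (_ : Finite κ) (V : Ω → κ) (f : Ω → κ → ℝ), FiberMeasurable 𝒢 V ∧
      (∀ i, Measurable[h] fun ω => f ω i) ∧ (∀ ω i, f ω i ∈ Icc (0 : ℝ) 1) ∧
      Measurable[mΩ] (fun ω => f ω (V ω)) ∧ ∫ ω, |X ω - f ω (V ω)| ∂P < η := by
  have hm : h ⊔ 𝒢 ≤ mΩ := sup_le hh h𝒢
  obtain ⟨n, hn⟩ := exists_nat_gt (2 / η)
  have hn0 : (0 : ℝ) < n := (by positivity : 0 < 2 / η).trans hn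
  have hfl : ∀ x, ⌊n * unitClamp x⌋₊ < n + 1 := by
    intro x
    rw [Nat.lt_succ_iff]
    refine Nat.floor_le_of_le ?_
    exact mul_le_of_le_one_right hn0.le (unitClamp_mem x).2
  let V₀ : Ω → Fin (n + 1) := fun ω => ⟨⌊n * unitClamp (X ω)⌋₊, hfl _⟩
  have hV₀ : FiberMeasurable (h ⊔ 𝒢) V₀ := by
    intro i
    have : V₀ ⁻¹' {i} = (fun ω => ⌊n * unitClamp (X ω)⌋₊) ⁻¹' {i.1} := by
      ext ω; simp [V₀, Fin.ext_iff]
    rw [this]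
    have h1 : Measurable fun x : ℝ => ⌊n * unitClamp x⌋₊ :=
      Nat.measurable_floor.comp (by have := continuous_unitClamp; fun_prop)
    exact (h1.comp hX) (measurableSet_singleton _)
  obtain ⟨κ, hκ, V, g, hV, hg, hlt⟩ := exists_finite_approx (P := P) hh h𝒢 hV₀ (half_pos hη)
  have hgV : FiberMeasurable mΩ fun ω => g ω (V ω) := fun i =>
    (hV.mono h𝒢).mem_fiber (b := fun j => (fun ω => g ω j) ⁻¹' {i}) fun j => hh _ (hg j i)
  have hmf : Measurable[mΩ] fun ω => ((g ω (V ω) : ℕ) : ℝ) / n := by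
    have h2 : Measurable fun ω => g ω (V ω) := measurable_to_countable' hgV
    exact (measurable_of_countable fun i : Fin (n + 1) => ((i : ℕ) : ℝ) / n).comp h2
  refine ⟨κ, hκ, V, fun ω i => ((g ω i : ℕ) : ℝ) / n, hV, fun i => ?_, fun ω i => ?_, hmf, ?_⟩
  · have h2 : Measurable[h] fun ω => g ω i := fun s _ => (hg i).preimage s
    exact (measurable_of_countable fun i : Fin (n + 1) => ((i : ℕ) : ℝ) / n).comp h2
  · refine ⟨by positivity, ?_⟩
    rw [div_le_one hn0]
    exact_mod_cast Nat.lt_succ_iff.1 (g ω i).2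
  · set B := {ω | g ω (V ω) ≠ V₀ ω} with hB
    have hBm : MeasurableSet B := by
      exact hgV.measurableSet_ne (hV₀.mono hm)
    have hbound : ∀ᵐ ω ∂P, |X ω - ((g ω (V ω) : ℕ) : ℝ) / n| ≤ 1 / n + B.indicator 1 ω := by
      filter_upwards [hX1] with ω hω
      by_cases hωB : ω ∈ B
      · rw [indicator_of_mem hωB, Pi.one_apply]
        have h1 : ((g ω (V ω) : ℕ) : ℝ) / n ≤ 1 := by
          rw [div_le_one hn0]
          exact_mod_cast Nat.lt_succ_iff.1 (g ω (V ω)).2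
        have h2 : 0 ≤ ((g ω (V ω) : ℕ) : ℝ) / n := by positivity
        have h3 : (0 : ℝ) ≤ 1 / n := by positivity
        rw [abs_le]
        constructor <;> linarith [hω.1, hω.2]
      · rw [indicator_of_notMem hωB, add_zero]
        have he : g ω (V ω) = V₀ ω := by
          by_contra h'; exact hωB h'
        rw [he]
        simp only [V₀, unitClamp_of_mem hω]
        have h1 := Nat.floor_le (mul_nonneg hn0.le hω.1)
        have h2 := Nat.lt_floor_add_one (n * X ω)
        have e : X ω = n * X ω / n := by field_simp
        rw [abs_le]
        constructor
        · rw [neg_le_sub_iff_le_add, div_le_iff₀ hn0, add_mul, one_div_mul_cancel hn0.ne']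
          linarith
        · rw [sub_le_iff_le_add, ← add_div, le_div_iff₀ hn0]
          linarith
    have hi : Integrable (fun ω => 1 / (n : ℝ) + B.indicator 1 ω) P :=
      (integrable_const _).add ((integrable_const (1 : ℝ)).indicator hBm)
    have hXm : Measurable[mΩ] X := hX.mono hm le_rfl
    calc ∫ ω, |X ω - ((g ω (V ω) : ℕ) : ℝ) / n| ∂P
        ≤ ∫ ω, (1 / (n : ℝ) + B.indicator 1 ω) ∂P := by
          refine integral_mono_ae (Integrable.mono' hi ?_ ?_) hi hbound
          · exact ((hXm.sub hmf).abs).aestronglyMeasurable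
          · filter_upwards [hbound] with ω hω
            rwa [Real.norm_eq_abs, abs_abs]
      _ = 1 / n + P.real B := by
          have := integral_add (μ := P) (integrable_const (1 / (n : ℝ)))
            ((integrable_const (1 : ℝ)).indicator hBm)
          refine this.trans ?_
          rw [← integral_indicator_one hBm]
          simp [Pi.one_def]
      _ < η := by
          have : 1 / (n : ℝ) < η / 2 := by
            rw [div_lt_iff₀ hn0]
            rw [div_lt_iff₀ hη] at hn
            linarith
          linarith

/-- If `R` and `U` agree outside an event of small probability, then the conditional expectation of
`Y` given `h` and `R` is close in mean to the one given `h` and a σ-algebra `𝒢` finer than `U`,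
provided that the latter is nearly a function of `h` and `U`. -/
theorem integral_abs_condExp_sub_le [IsProbabilityMeasure P] (hh : h ≤ mΩ) (h𝒢 : 𝒢 ≤ mΩ)
    {Y : Ω → ℝ} (hY : Measurable Y) (hY1 : ∀ ω, Y ω ∈ Icc (0 : ℝ) 1) {ι : Type} [Finite ι]
    {U R : Ω → ι} (hU : FiberMeasurable 𝒢 U) (hR : FiberMeasurable mΩ R)
    (hmR : mR = h ⊔ MeasurableSpace.comap R ⊤) {δ η : ℝ}
    (hδ : P.real {ω | R ω ≠ U ω} ≤ δ) {f : Ω → ι → ℝ} (hf : ∀ i, Measurable[h] fun ω => f ω i)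
    (hf1 : ∀ ω i, f ω i ∈ Icc (0 : ℝ) 1)
    (hη : ∫ ω, |P[Y | h ⊔ 𝒢] ω - f ω (U ω)| ∂P ≤ η) :
    ∫ ω, |P[Y | mR] ω - P[Y | h ⊔ 𝒢] ω| ∂P ≤ 4 * δ + 2 * η := by
  have hm : h ⊔ 𝒢 ≤ mΩ := sup_le hh h𝒢
  have hRm : mR ≤ mΩ := hmR ▸ sup_le hh hR.comap_le
  set X := P[Y | h ⊔ 𝒢] with hX
  have hYI : ∀ᵐ ω ∂P, Y ω ∈ Icc (0 : ℝ) 1 := Eventually.of_forall hY1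
  have hX1 : ∀ᵐ ω ∂P, X ω ∈ Icc (0 : ℝ) 1 := condExp_ae_mem_Icc hm hY hYI
  have hXm : Measurable X := measurable_condExp hm
  have hXi : Integrable X P := integrable_condExp
  have hYi := integrable_of_ae_mem_Icc hY hYI
  set D := {ω | R ω ≠ U ω} with hD
  have hDm : MeasurableSet D := hR.measurableSet_ne (hU.mono h𝒢)
  have fcomp : ∀ (m : MeasurableSpace Ω) (_ : h ≤ m) (W : Ω → ι), FiberMeasurable m W →
      Measurable[m] fun ω => f ω (W ω) := by
    intro m hm W hW s hs
    exact hW.mem_fiber (b := fun i => (fun ω => f ω i) ⁻¹' s) fun i => hm _ (hf i hs)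
  have hfU : Measurable fun ω => f ω (U ω) := fcomp mΩ hh U (hU.mono h𝒢)
  have hfR : Measurable fun ω => f ω (R ω) := fcomp mΩ hh R hR
  have hfRm : Measurable[mR] fun ω => f ω (R ω) := fcomp mR (hmR ▸ le_sup_left) R fun i =>
    hmR ▸ le_sup_right (a := h) (b := MeasurableSpace.comap R ⊤) _ ⟨{i}, trivial, rfl⟩
  have hfUi : Integrable (fun ω => f ω (U ω)) P :=
    integrable_of_ae_mem_Icc hfU (Eventually.of_forall fun ω => hf1 _ _)
  have hfRi : Integrable (fun ω => f ω (R ω)) P :=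
    integrable_of_ae_mem_Icc hfR (Eventually.of_forall fun ω => hf1 _ _)
  have hind : Integrable (D.indicator (1 : Ω → ℝ)) P := (integrable_const (1 : ℝ)).indicator hDm
  -- the approximation of `X` by a function of `h` and `R`
  have h1 : ∫ ω, |X ω - f ω (R ω)| ∂P ≤ η + δ := by
    calc ∫ ω, |X ω - f ω (R ω)| ∂P ≤ ∫ ω, (|X ω - f ω (U ω)| + D.indicator 1 ω) ∂P := by
          refine integral_mono (hXi.sub hfRi).abs ((hXi.sub hfUi).abs.add hind) fun ω => ?_
          show |X ω - f ω (R ω)| ≤ |X ω - f ω (U ω)| + D.indicator 1 ω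
          by_cases hω : ω ∈ D
          · rw [indicator_of_mem hω, Pi.one_apply]
            have e : X ω - f ω (R ω) = (X ω - f ω (U ω)) + (f ω (U ω) - f ω (R ω)) := by ring
            rw [e]
            refine (abs_add_le _ _).trans (add_le_add_right ?_ _)
            rw [abs_le]
            constructor <;> linarith [(hf1 ω (U ω)).1, (hf1 ω (U ω)).2, (hf1 ω (R ω)).1,
              (hf1 ω (R ω)).2]
          · have : R ω = U ω := by
              by_contra h'; exact hω h'
            rw [this]
            simp [hω]
      _ = ∫ ω, |X ω - f ω (U ω)| ∂P + P.real D := by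
          rw [← integral_indicator_one hDm]
          exact integral_add (hXi.sub hfUi).abs hind
      _ ≤ η + δ := add_le_add hη hδ
  -- `Y - X` is nearly orthogonal to the functions of `h` and `R`
  have hZi : Integrable (Y - X) P := hYi.sub hXi
  have h2 : ∀ B, MeasurableSet[mR] B → |∫ ω in B, (Y - X) ω ∂P| ≤ δ := by
    intro B hB
    obtain ⟨b, hb, rfl⟩ := measurableSet_sup_comap_top (hmR ▸ hB)
    have hB' : MeasurableSet[h ⊔ 𝒢] {ω | ω ∈ b (U ω)} :=
      (hU.mono le_sup_right).mem_fiber fun i => le_sup_left (a := h) (b := 𝒢) _ (hb i)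
    have h0 : ∫ ω in {ω | ω ∈ b (U ω)}, (Y - X) ω ∂P = 0 := by
      have := setIntegral_condExp hm hYi hB'
      simp only [Pi.sub_apply]
      rw [integral_sub hYi.integrableOn hXi.integrableOn, ← this, sub_self]
    rw [← sub_zero (∫ ω in _, (Y - X) ω ∂P), ← h0, ← integral_indicator (hRm _ hB),
      ← integral_indicator (hm _ hB'), ← integral_sub (hZi.indicator (hRm _ hB))
        (hZi.indicator (hm _ hB'))]
    calc |∫ ω, ({ω | ω ∈ b (R ω)}.indicator (Y - X) ω - {ω | ω ∈ b (U ω)}.indicator (Y - X) ω) ∂P|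
        ≤ ∫ ω, |{ω | ω ∈ b (R ω)}.indicator (Y - X) ω
            - {ω | ω ∈ b (U ω)}.indicator (Y - X) ω| ∂P := abs_integral_le_integral_abs
      _ ≤ ∫ ω, D.indicator 1 ω ∂P := by
          refine integral_mono_ae
            ((hZi.indicator (hRm _ hB)).sub (hZi.indicator (hm _ hB'))).abs hind ?_
          filter_upwards [hX1] with ω hω
          have hYX : |Y ω - X ω| ≤ 1 := by
            rw [abs_le]
            constructor <;> linarith [hω.1, hω.2, (hY1 ω).1, (hY1 ω).2]
          by_cases hωD : ω ∈ D
          · rw [indicator_of_mem hωD, Pi.one_apply]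
            have hXY : |X ω - Y ω| ≤ 1 := abs_sub_comm (Y ω) (X ω) ▸ hYX
            by_cases hωR : ω ∈ b (R ω) <;> by_cases hωU : ω ∈ b (U ω) <;>
              simp [indicator, hωR, hωU, hYX, hXY]
          · have : R ω = U ω := by
              by_contra h'; exact hωD h'
            have hiff : ω ∈ b (R ω) ↔ ω ∈ b (U ω) := by rw [this]
            by_cases hωU : ω ∈ b (U ω) <;> simp [indicator, hiff, hωU, hωD]
      _ = P.real D := integral_indicator_one hDm
      _ ≤ δ := hδ
  have h3 : ∫ ω, |P[Y - X | mR] ω| ∂P ≤ 2 * δ := by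
    set W := P[Y - X | mR] with hW
    have hWi : Integrable W P := integrable_condExp
    set B := {ω | 0 ≤ W ω} with hB
    have hBm : MeasurableSet[mR] B :=
      measurableSet_le measurable_const stronglyMeasurable_condExp.measurable
    have e1 : ∫ ω in B, |W ω| ∂P = ∫ ω in B, (Y - X) ω ∂P := by
      rw [← setIntegral_condExp hRm hZi hBm]
      exact setIntegral_congr_fun (hRm _ hBm) fun ω hω => abs_of_nonneg hω
    have e2 : ∫ ω in Bᶜ, |W ω| ∂P = -∫ ω in Bᶜ, (Y - X) ω ∂P := by
      rw [← setIntegral_condExp hRm hZi hBm.compl, ← integral_neg]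
      exact setIntegral_congr_fun (hRm _ hBm).compl fun ω hω => abs_of_neg (not_le.1 hω)
    rw [← integral_add_compl (hRm _ hBm) hWi.abs, e1, e2]
    have i1 := h2 B hBm
    have i2 := h2 Bᶜ hBm.compl
    linarith [le_abs_self (∫ ω in B, (Y - X) ω ∂P), neg_abs_le (∫ ω in Bᶜ, (Y - X) ω ∂P)]
  have hXfi : Integrable (fun ω => X ω - f ω (R ω)) P := hXi.sub hfRi
  have h4 : P[Y | mR] =ᵐ[P] fun ω => P[Y - X | mR] ω
      + P[fun ω => X ω - f ω (R ω) | mR] ω + f ω (R ω) := by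
    have a1 := condExp_add (m := mR) hZi hXfi
    have a2 := condExp_add (m := mR) (hZi.add hXfi) hfRi
    have a3 : P[fun ω => f ω (R ω) | mR] = fun ω => f ω (R ω) :=
      condExp_of_stronglyMeasurable hRm hfRm.stronglyMeasurable hfRi
    have a4 : (Y - X + fun ω => X ω - f ω (R ω)) + (fun ω => f ω (R ω)) = Y := by
      ext ω; simp
    rw [a4, a3] at a2
    filter_upwards [a1, a2] with ω b1 b2
    rw [b2, Pi.add_apply, b1, Pi.add_apply]
  have h5 : ∫ ω, |P[fun ω => X ω - f ω (R ω) | mR] ω| ∂P ≤ η + δ :=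
    (integral_abs_condExp_le _).trans h1
  calc ∫ ω, |P[Y | mR] ω - X ω| ∂P
      ≤ ∫ ω, (|P[Y - X | mR] ω| + |P[fun ω => X ω - f ω (R ω) | mR] ω|
          + |X ω - f ω (R ω)|) ∂P := by
        refine integral_mono_ae (integrable_condExp.sub hXi).abs
          ((integrable_condExp.abs.add integrable_condExp.abs).add hXfi.abs) ?_
        filter_upwards [h4] with ω hω
        rw [hω]
        have e : P[Y - X | mR] ω + P[fun ω => X ω - f ω (R ω) | mR] ω + f ω (R ω) - X ω
          = P[Y - X | mR] ω + P[fun ω => X ω - f ω (R ω) | mR] ω - (X ω - f ω (R ω)) := by ring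
        rw [e]
        exact (abs_sub _ _).trans (add_le_add_left (abs_add_le _ _) _)
    _ = ∫ ω, |P[Y - X | mR] ω| ∂P + ∫ ω, |P[fun ω => X ω - f ω (R ω) | mR] ω| ∂P
          + ∫ ω, |X ω - f ω (R ω)| ∂P := by
        have e1 := integral_add (μ := P) (f := fun ω => |P[Y - X | mR] ω|)
          (g := fun ω => |P[fun ω => X ω - f ω (R ω) | mR] ω|)
          integrable_condExp.abs integrable_condExp.abs
        rw [← e1]
        exact integral_add (integrable_condExp.abs.add integrable_condExp.abs) hXfi.abs
    _ ≤ 4 * δ + 2 * η := by linarith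

end Stability

/-! ### Rectangle substitutes for σ-algebras approximable by rectangles -/

section Submodular

variable {Ω 𝒮 𝒯 : Type*} [mS : MeasurableSpace 𝒮] [mT : MeasurableSpace 𝒯]
  {h 𝒢 m m' mΩ : MeasurableSpace Ω} {P : Measure Ω} {σ : Ω → 𝒮} {τ : Ω → 𝒯} {Y : Ω → ℝ}
  {g : ℝ → ℝ} {K : ℝ}

/-- Rectangle substitutes in terms of the expected values of `g` at conditional expectations:
conditionally on every rectangle, the two signals together contribute no more than the sum of their
separate contributions. The form is symmetric in the two signals. -/
def RectSubmodular (P : Measure Ω) (σ : Ω → 𝒮) (τ : Ω → 𝒯) (Y : Ω → ℝ) (g : ℝ → ℝ) : Prop :=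
  ∀ S T, MeasurableSet S → MeasurableSet T → P (σ ⁻¹' S ∩ τ ⁻¹' T) ≠ 0 →
    ∫ ω, g ((P[|σ ⁻¹' S ∩ τ ⁻¹' T])[Y | ⊥] ω) ∂P[|σ ⁻¹' S ∩ τ ⁻¹' T]
        + ∫ ω, g ((P[|σ ⁻¹' S ∩ τ ⁻¹' T])[Y | mS.comap σ ⊔ mT.comap τ] ω)
            ∂P[|σ ⁻¹' S ∩ τ ⁻¹' T]
      ≤ ∫ ω, g ((P[|σ ⁻¹' S ∩ τ ⁻¹' T])[Y | mT.comap τ] ω) ∂P[|σ ⁻¹' S ∩ τ ⁻¹' T]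
        + ∫ ω, g ((P[|σ ⁻¹' S ∩ τ ⁻¹' T])[Y | mS.comap σ] ω) ∂P[|σ ⁻¹' S ∩ τ ⁻¹' T]

theorem RectSubmodular.swap (H : RectSubmodular P σ τ Y g) : RectSubmodular P τ σ Y g := by
  intro T S hT hS h0
  have := H S T hS hT (by rwa [inter_comm])
  rw [inter_comm (τ ⁻¹' T), sup_comm (mT.comap τ)]
  linarith

theorem setIntegral_comp_condExp_eq [IsProbabilityMeasure P] (hm' : m' ≤ mΩ) (hmm : m ≤ m')
    {C : Set Ω} (hC : MeasurableSet[m'] C)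
    (htr : ∀ B, MeasurableSet[m'] B → ∃ B', MeasurableSet[m] B' ∧ B ∩ C = B' ∩ C)
    (hY : Integrable Y P) (h0 : P C ≠ 0) :
    ∫ ω in C, g (P[Y | m'] ω) ∂P = P.real C * ∫ ω, g ((P[|C])[Y | m] ω) ∂P[|C] := by
  have hsmul : P.restrict C = P C • P[|C] := by
    rw [ProbabilityTheory.cond, smul_smul, ENNReal.mul_inv_cancel h0 (measure_ne_top _ _), one_smul]
  have h1 := condExp_cond_ae_eq hm' hmm hC htr hY
  have h2 : ∫ ω in C, g (P[Y | m'] ω) ∂P = ∫ ω in C, g ((P[|C])[Y | m] ω) ∂P := by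
    refine integral_congr_ae ?_
    filter_upwards [h1] with ω hω
    rw [hω]
  rw [h2, hsmul, integral_smul_measure, smul_eq_mul, measureReal_def]

/-- The inequality of rectangle substitutes on one cell of a partition into rectangles, in terms of
conditional expectations under the unconditional measure. -/
theorem RectSubmodular.setIntegral_fiber_le [IsProbabilityMeasure P]
    (H : RectSubmodular P σ τ Y g) (hσ : Measurable σ) (hτ : Measurable τ) (hY : Integrable Y P)
    {ι : Type} [Finite ι] {R : Ω → ι} (hR : IsRectangular σ τ R) (i : ι) :
    ∫ ω in R ⁻¹' {i}, g (P[Y | ⊥ ⊔ MeasurableSpace.comap R ⊤] ω) ∂P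
        + ∫ ω in R ⁻¹' {i}, g (P[Y | mS.comap σ ⊔ mT.comap τ] ω) ∂P
      ≤ ∫ ω in R ⁻¹' {i}, g (P[Y | mT.comap τ ⊔ MeasurableSpace.comap R ⊤] ω) ∂P
        + ∫ ω in R ⁻¹' {i}, g (P[Y | mS.comap σ ⊔ MeasurableSpace.comap R ⊤] ω) ∂P := by
  obtain ⟨S, T, hS, hT, hC⟩ := hR i
  have hRm := hR.fiberMeasurable hσ hτ
  by_cases h0 : P (R ⁻¹' {i}) = 0
  · simp [Measure.restrict_eq_zero.2 h0]
  have key : ∀ h : MeasurableSpace Ω, h ≤ mΩ →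
      ∫ ω in R ⁻¹' {i}, g (P[Y | h ⊔ MeasurableSpace.comap R ⊤] ω) ∂P
        = P.real (R ⁻¹' {i}) * ∫ ω, g ((P[|R ⁻¹' {i}])[Y | h] ω) ∂P[|R ⁻¹' {i}] := by
    intro h hh
    refine setIntegral_comp_condExp_eq (sup_le hh hRm.comap_le) le_sup_left
      (le_sup_right (a := h) _ ⟨{i}, trivial, rfl⟩) (fun B hB => ?_) hY h0
    obtain ⟨b, hb, rfl⟩ := measurableSet_sup_comap_top hB
    refine ⟨b i, hb i, ?_⟩
    ext ω
    simp only [mem_inter_iff, mem_ofPred_eq, mem_preimage, mem_singleton_iff]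
    constructor
    · rintro ⟨h1, rfl⟩; exact ⟨h1, rfl⟩
    · rintro ⟨h1, rfl⟩; exact ⟨h1, rfl⟩
  have hCm : MeasurableSet[mS.comap σ ⊔ mT.comap τ] (R ⁻¹' {i}) := by
    rw [hC]
    exact (le_sup_left (a := mS.comap σ) (b := mT.comap τ) _ ⟨S, hS, rfl⟩).inter
      (le_sup_right (a := mS.comap σ) (b := mT.comap τ) _ ⟨T, hT, rfl⟩)
  rw [key ⊥ bot_le, key _ hσ.comap_le, key _ hτ.comap_le,
    setIntegral_comp_condExp_eq (sup_le hσ.comap_le hτ.comap_le) le_rfl hCm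
      (fun B hB => ⟨B, hB, rfl⟩) hY h0, ← mul_add, ← mul_add]
  refine mul_le_mul_of_nonneg_left ?_ measureReal_nonneg
  rw [hC] at h0 ⊢
  exact H S T hS hT h0

/-- A partition into finitely many rectangles whose conditional expectations are close in mean to
those for `𝒢`, and which nearly contains a given event `A` of `𝒢`. -/
theorem RectApprox.exists_partition [IsProbabilityMeasure P] (hσ : Measurable σ)
    (hτ : Measurable τ) (h𝒢 : 𝒢 ≤ mΩ) (H : RectApprox P σ τ 𝒢) (hY : Measurable Y)
    (hY1 : ∀ ω, Y ω ∈ Icc (0 : ℝ) 1) {A : Set Ω} (hA : MeasurableSet[𝒢] A) {η : ℝ} (hη : 0 < η) :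
    ∃ (ι : Type) (_ : Finite ι) (R : Ω → ι) (I : Set ι), IsRectangular σ τ R ∧
      P.real (symmDiff (R ⁻¹' I) A) ≤ η ∧
      (∀ h ∈ ({⊥, mS.comap σ, mT.comap τ} : Set (MeasurableSpace Ω)),
        ∫ ω, |P[Y | h ⊔ MeasurableSpace.comap R ⊤] ω - P[Y | h ⊔ 𝒢] ω| ∂P ≤ η) := by
  have hη6 : 0 < η / 6 := by positivity
  have approx : ∀ h : MeasurableSpace Ω, h ≤ mΩ → ∃ (κ : Type) (_ : Finite κ) (V : Ω → κ)
      (f : Ω → κ → ℝ), FiberMeasurable 𝒢 V ∧ (∀ i, Measurable[h] fun ω => f ω i) ∧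
      (∀ ω i, f ω i ∈ Icc (0 : ℝ) 1) ∧ Measurable[mΩ] (fun ω => f ω (V ω)) ∧
      ∫ ω, |P[Y | h ⊔ 𝒢] ω - f ω (V ω)| ∂P < η / 6 := fun h hh =>
    exists_finite_approx_real hh h𝒢 stronglyMeasurable_condExp.measurable
      (condExp_ae_mem_Icc (sup_le hh h𝒢) hY (Eventually.of_forall hY1)) hη6
  obtain ⟨κ₀, _, V₀, f₀, hV₀, hf₀, hf₀', -, hlt₀⟩ := approx ⊥ bot_le
  obtain ⟨κ₁, _, V₁, f₁, hV₁, hf₁, hf₁', -, hlt₁⟩ := approx _ hσ.comap_le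
  obtain ⟨κ₂, _, V₂, f₂, hV₂, hf₂, hf₂', -, hlt₂⟩ := approx _ hτ.comap_le
  have hVA : FiberMeasurable 𝒢 fun ω => ω ∈ A := by
    intro p
    by_cases hp : p
    · convert hA using 1; ext ω; simp [hp]
    · convert hA.compl using 1; ext ω; simp [hp]
  obtain ⟨ι, hι, U, R, φ, hU, hR, hφ, hlt⟩ := H (κ₀ × κ₁ × κ₂ × Prop)
    (fun ω => (V₀ ω, V₁ ω, V₂ ω, ω ∈ A)) (hV₀.prodMk (hV₁.prodMk (hV₂.prodMk hVA))) (η / 6) hη6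
  have hRm := hR.fiberMeasurable hσ hτ
  refine ⟨ι, hι, R, {i | (φ i).2.2.2}, hR, ?_, ?_⟩
  · refine le_trans (measureReal_mono ?_) (hlt.le.trans (by linarith : η / 6 ≤ η))
    intro ω hω
    by_contra hcon
    have hRU : R ω = U ω := by
      by_contra h'; exact hcon h'
    simp [mem_symmDiff, hRU, hφ] at hω
  · have fin : ∀ (h : MeasurableSpace Ω), h ≤ mΩ → ∀ (f : Ω → ι → ℝ),
        (∀ i, Measurable[h] fun ω => f ω i) → (∀ ω i, f ω i ∈ Icc (0 : ℝ) 1) →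
        ∫ ω, |P[Y | h ⊔ 𝒢] ω - f ω (U ω)| ∂P < η / 6 →
        ∫ ω, |P[Y | h ⊔ MeasurableSpace.comap R ⊤] ω - P[Y | h ⊔ 𝒢] ω| ∂P ≤ η := by
      intro h hh f hf hf' hlt'
      have := integral_abs_condExp_sub_le hh h𝒢 hY hY1 hU hRm rfl hlt.le hf hf' hlt'.le
      linarith
    rintro h (rfl | rfl | rfl)
    · exact fin _ bot_le (fun ω i => f₀ ω (φ i).1) (fun i => hf₀ _) (fun ω i => hf₀' _ _)
        (by simpa only [hφ] using hlt₀)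
    · exact fin _ hσ.comap_le (fun ω i => f₁ ω (φ i).2.1) (fun i => hf₁ _) (fun ω i => hf₁' _ _)
        (by simpa only [hφ] using hlt₁)
    · exact fin _ hτ.comap_le (fun ω i => f₂ ω (φ i).2.2.1) (fun i => hf₂ _)
        (fun ω i => hf₂' _ _) (by simpa only [hφ] using hlt₂)

theorem integral_add_sub_sub {f₁ f₂ f₃ f₄ : Ω → ℝ} (h₁ : Integrable f₁ P) (h₂ : Integrable f₂ P)
    (h₃ : Integrable f₃ P) (h₄ : Integrable f₄ P) :
    ∫ ω, (f₁ ω + f₂ ω - f₃ ω - f₄ ω) ∂P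
      = ∫ ω, f₁ ω ∂P + ∫ ω, f₂ ω ∂P - ∫ ω, f₃ ω ∂P - ∫ ω, f₄ ω ∂P := by
  have e1 := integral_sub ((h₁.add h₂).sub h₃) h₄
  have e2 := integral_sub (h₁.add h₂) h₃
  have e3 := integral_add h₁ h₂
  simp only [Pi.add_apply, Pi.sub_apply] at e1 e2
  rw [e1, e2, e3]

theorem exists_subseq_tendsto_zero [IsFiniteMeasure P] {E : ℕ → Ω → ℝ} (hE : ∀ n, Integrable (E n) P)
    (h0 : Tendsto (fun n => ∫ ω, |E n ω| ∂P) atTop (𝓝 0)) :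
    ∃ ns : ℕ → ℕ, StrictMono ns ∧ ∀ᵐ ω ∂P, Tendsto (fun k => E (ns k) ω) atTop (𝓝 0) := by
  have hmeas : TendstoInMeasure P E atTop 0 := by
    refine tendstoInMeasure_of_tendsto_eLpNorm (p := 1) one_ne_zero
      (fun n => (hE n).aestronglyMeasurable) aestronglyMeasurable_zero ?_
    have : ∀ n, eLpNorm (E n - 0) 1 P = ENNReal.ofReal (∫ ω, |E n ω| ∂P) := by
      intro n
      rw [sub_zero, eLpNorm_one_eq_lintegral_enorm, ← ofReal_integral_norm_eq_lintegral_enorm (hE n)]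
      rfl
    simp only [this]
    rw [← ENNReal.ofReal_zero]
    exact ENNReal.tendsto_ofReal h0
  obtain ⟨ns, hns, h⟩ := hmeas.exists_seq_tendsto_ae
  exact ⟨ns, hns, h⟩

/-- The rectangle inequality for a σ-algebra approximable by rectangles, such as that of a
transcript. Only rectangles which approximate the event that `E[Y | 𝒢]` lies in `(0, 1)` are used in
the limit, because `g` may jump at `0` and `1`. On the remaining event `E[Y | 𝒢] = Y` already and all
terms agree. -/
theorem RectSubmodular.integral_le [IsProbabilityMeasure P]
    (H : RectSubmodular P σ τ Y g) (hσ : Measurable σ) (hτ : Measurable τ) (hY : Measurable Y)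
    (hY1 : ∀ ω, Y ω ∈ Icc (0 : ℝ) 1) (hg : UpperSemicontinuous g) (hgc : ContinuousOn g (Ioo 0 1))
    (hK : ∀ x, |g x| ≤ K) (hR : RectApprox P σ τ 𝒢) (h𝒢 : 𝒢 ≤ mS.comap σ ⊔ mT.comap τ) :
    ∫ ω, g (P[Y | 𝒢] ω) ∂P + ∫ ω, g (P[Y | mS.comap σ ⊔ mT.comap τ] ω) ∂P
      ≤ ∫ ω, g (P[Y | mT.comap τ ⊔ 𝒢] ω) ∂P + ∫ ω, g (P[Y | mS.comap σ ⊔ 𝒢] ω) ∂P := by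
  have hστ : mS.comap σ ⊔ mT.comap τ ≤ mΩ := sup_le hσ.comap_le hτ.comap_le
  have h𝒢Ω : 𝒢 ≤ mΩ := h𝒢.trans hστ
  have hYI : ∀ᵐ ω ∂P, Y ω ∈ Icc (0 : ℝ) 1 := Eventually.of_forall hY1
  have hYi := integrable_of_ae_mem_Icc hY hYI
  have hgm : Measurable g := hg.measurable
  set r := P[Y | 𝒢] with hr
  set t := P[Y | mS.comap σ ⊔ mT.comap τ] with ht
  set b := P[Y | mT.comap τ ⊔ 𝒢] with hb
  set a := P[Y | mS.comap σ ⊔ 𝒢] with ha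
  have hrm : Measurable r := measurable_condExp h𝒢Ω
  have htm : Measurable t := measurable_condExp hστ
  have hbm : Measurable b := measurable_condExp (sup_le hτ.comap_le h𝒢Ω)
  have ham : Measurable a := measurable_condExp (sup_le hσ.comap_le h𝒢Ω)
  have hgi : ∀ {X : Ω → ℝ}, Measurable X → Integrable (fun ω => g (X ω)) P := fun hX =>
    integrable_comp_of_bounded hgm hK hX
  -- the event on which the outcome is not yet settled
  set A : Set Ω := r ⁻¹' Ioo 0 1 with hA
  have hA𝒢 : MeasurableSet[𝒢] A := stronglyMeasurable_condExp.measurable measurableSet_Ioo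
  have hAm : MeasurableSet A := h𝒢Ω _ hA𝒢
  have settled : ∀ m' : MeasurableSpace Ω, m' ≤ mΩ → 𝒢 ≤ m' →
      ∀ᵐ ω ∂P, ω ∉ A → P[Y | m'] ω = r ω := by
    intro m' hm' hle
    have h1 := ae_eq_of_condExp_eq_zero_or_one h𝒢Ω (measurable_condExp hm' (X := Y) (P := P))
      (condExp_ae_mem_Icc hm' hY hYI)
    have h2 : P[P[Y | m'] | 𝒢] =ᵐ[P] r := condExp_condExp_of_le hle hm'
    filter_upwards [h1, h2] with ω e1 e2 hω
    rw [e2] at e1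
    exact e1 hω
  set Ψ : Ω → ℝ := A.indicator fun ω => g (b ω) + g (a ω) - g (r ω) - g (t ω) with hΨ
  have hfull : Integrable (fun ω => g (b ω) + g (a ω) - g (r ω) - g (t ω)) P :=
    (((hgi hbm).add (hgi ham)).sub (hgi hrm)).sub (hgi htm)
  have hΨi : Integrable Ψ P := hfull.indicator hAm
  have hΨae : Ψ =ᵐ[P] fun ω => g (b ω) + g (a ω) - g (r ω) - g (t ω) := by
    filter_upwards [settled _ (sup_le hτ.comap_le h𝒢Ω) le_sup_right,
      settled _ (sup_le hσ.comap_le h𝒢Ω) le_sup_right, settled _ hστ h𝒢] with ω e1 e2 e3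
    by_cases hω : ω ∈ A
    · simp [hΨ, hω]
    · have f1 : b ω = r ω := e1 hω
      have f2 : a ω = r ω := e2 hω
      have f3 : t ω = r ω := e3 hω
      simp [hΨ, hω, f1, f2, f3]
  suffices hmain : 0 ≤ ∫ ω, Ψ ω ∂P by
    rw [integral_congr_ae hΨae,
      integral_add_sub_sub (hgi hbm) (hgi ham) (hgi hrm) (hgi htm)] at hmain
    linarith
  have hpos : ∀ n : ℕ, (0 : ℝ) < 1 / (n + 1) := fun n => by positivity
  choose ι hι R I hrect hsymm hclose using fun n : ℕ =>
    hR.exists_partition hσ hτ h𝒢Ω hY hY1 hA𝒢 (hpos n)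
  have hRm : ∀ n, FiberMeasurable mΩ (R n) := fun n => (hrect n).fiberMeasurable hσ hτ
  set rn : ℕ → Ω → ℝ := fun n => P[Y | ⊥ ⊔ MeasurableSpace.comap (R n) ⊤] with hrn
  set bn : ℕ → Ω → ℝ := fun n => P[Y | mT.comap τ ⊔ MeasurableSpace.comap (R n) ⊤] with hbn
  set an : ℕ → Ω → ℝ := fun n => P[Y | mS.comap σ ⊔ MeasurableSpace.comap (R n) ⊤] with han
  set Cn : ℕ → Set Ω := fun n => R n ⁻¹' I n with hCn
  have hCm : ∀ n, MeasurableSet (Cn n) := fun n => (hRm n).preimage _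
  have hrnm : ∀ n, Measurable (rn n) := fun n =>
    measurable_condExp (sup_le bot_le (hRm n).comap_le)
  have hbnm : ∀ n, Measurable (bn n) := fun n =>
    measurable_condExp (sup_le hτ.comap_le (hRm n).comap_le)
  have hanm : ∀ n, Measurable (an n) := fun n =>
    measurable_condExp (sup_le hσ.comap_le (hRm n).comap_le)
  have hcr : ∀ n : ℕ, ∫ ω, |rn n ω - r ω| ∂P ≤ 1 / (n + 1) := fun n => by
    have := hclose n ⊥ (by simp)
    rwa [bot_sup_eq 𝒢] at this
  have hcb : ∀ n : ℕ, ∫ ω, |bn n ω - b ω| ∂P ≤ 1 / (n + 1) := fun n =>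
    hclose n (mT.comap τ) (by simp)
  have hca : ∀ n : ℕ, ∫ ω, |an n ω - a ω| ∂P ≤ 1 / (n + 1) := fun n =>
    hclose n (mS.comap σ) (by simp)
  set D : ℕ → Set Ω := fun n => symmDiff (Cn n) A with hD
  have hDm : ∀ n, MeasurableSet (D n) := fun n => (hCm n).symmDiff hAm
  -- one sequence that controls all four approximations
  set E : ℕ → Ω → ℝ := fun n ω =>
    |rn n ω - r ω| + |bn n ω - b ω| + |an n ω - a ω| + (D n).indicator 1 ω with hE
  have i1 : ∀ n, Integrable (fun ω => |rn n ω - r ω|) P := fun n =>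
    (integrable_condExp.sub integrable_condExp).abs
  have i2 : ∀ n, Integrable (fun ω => |bn n ω - b ω|) P := fun n =>
    (integrable_condExp.sub integrable_condExp).abs
  have i3 : ∀ n, Integrable (fun ω => |an n ω - a ω|) P := fun n =>
    (integrable_condExp.sub integrable_condExp).abs
  have i4 : ∀ n, Integrable ((D n).indicator (1 : Ω → ℝ)) P := fun n =>
    (integrable_const (1 : ℝ)).indicator (hDm n)
  have hind0 : ∀ n ω, 0 ≤ (D n).indicator (1 : Ω → ℝ) ω := fun n ω =>
    indicator_nonneg (fun _ _ => zero_le_one) ω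
  have hE0 : ∀ n ω, 0 ≤ E n ω := fun n ω => by
    have := hind0 n ω
    simp only [hE]; positivity
  have hEi : ∀ n, Integrable (E n) P := fun n => (((i1 n).add (i2 n)).add (i3 n)).add (i4 n)
  have hElim : Tendsto (fun n => ∫ ω, |E n ω| ∂P) atTop (𝓝 0) := by
    have hle : ∀ n : ℕ, ∫ ω, |E n ω| ∂P ≤ 4 * (1 / (n + 1)) := by
      intro n
      have e0 : ∫ ω, |E n ω| ∂P = ∫ ω, E n ω ∂P :=
        integral_congr_ae (Eventually.of_forall fun ω => abs_of_nonneg (hE0 n ω))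
      have e1 := integral_add ((i1 n).add (i2 n)) (i3 n)
      have e2 := integral_add (i1 n) (i2 n)
      have e3 := integral_add (((i1 n).add (i2 n)).add (i3 n)) (i4 n)
      have e4 := integral_indicator_one (μ := P) (hDm n)
      simp only [Pi.add_apply] at e1 e2 e3
      rw [e0]
      simp only [hE]
      rw [e3, e1, e2, e4]
      linarith [hcr n, hcb n, hca n, hsymm n]
    refine squeeze_zero (fun n => integral_nonneg fun ω => abs_nonneg _) hle ?_
    simpa using (tendsto_one_div_add_atTop_nhds_zero_nat (𝕜 := ℝ)).const_mul 4
  obtain ⟨ns, hns, hconv⟩ := exists_subseq_tendsto_zero hEi hElim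
  set Ψn : ℕ → Ω → ℝ := fun n =>
    (Cn n).indicator fun ω => g (bn n ω) + g (an n ω) - g (rn n ω) - g (t ω) with hΨn
  have hfn : ∀ n, Integrable (fun ω => g (bn n ω) + g (an n ω) - g (rn n ω) - g (t ω)) P :=
    fun n => (((hgi (hbnm n)).add (hgi (hanm n))).sub (hgi (hrnm n))).sub (hgi htm)
  have hΨni : ∀ n, Integrable (Ψn n) P := fun n => (hfn n).indicator (hCm n)
  have hΨn0 : ∀ n, 0 ≤ ∫ ω, Ψn n ω ∂P := by
    intro n
    classical
    have := hι n
    have := Fintype.ofFinite (ι n)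
    have hCU : Cn n = ⋃ i ∈ (I n).toFinset, R n ⁻¹' {i} := by
      ext ω; simp [hCn]
    simp only [hΨn]
    rw [integral_indicator (hCm n), hCU, integral_biUnion_finset]
    · refine Finset.sum_nonneg fun i _ => ?_
      have := H.setIntegral_fiber_le hσ hτ hYi (hrect n) i
      rw [integral_add_sub_sub (hgi (hbnm n)).integrableOn (hgi (hanm n)).integrableOn
        (hgi (hrnm n)).integrableOn (hgi htm).integrableOn]
      linarith
    · exact fun i _ => hRm n i
    · intro i _ j _ hij
      rw [Function.onFun, disjoint_left]
      rintro ω rfl hω'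
      exact hij hω'
    · exact fun i _ => (hfn n).integrableOn
  set e : ℕ → Ω → ℝ := fun k ω => max (Ψn (ns k) ω - Ψ ω) 0 with he
  have hK0 : 0 ≤ K := (abs_nonneg _).trans (hK 0)
  have hbound : ∀ x y z w : ℝ, |g x + g y - g z - g w| ≤ 4 * K := by
    intro x y z w
    have h1 := abs_le.1 (hK x)
    have h2 := abs_le.1 (hK y)
    have h3 := abs_le.1 (hK z)
    have h4 := abs_le.1 (hK w)
    rw [abs_le]
    constructor <;> linarith [h1.1, h1.2, h2.1, h2.2, h3.1, h3.2, h4.1, h4.2]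
  have hΨb : ∀ ω, |Ψ ω| ≤ 4 * K := by
    intro ω
    by_cases hω : ω ∈ A
    · rw [hΨ, indicator_of_mem hω]; exact hbound _ _ _ _
    · rw [hΨ, indicator_of_notMem hω]; simpa using hK0
  have hΨnb : ∀ n ω, |Ψn n ω| ≤ 4 * K := by
    intro n ω
    by_cases hω : ω ∈ Cn n
    · simp only [hΨn]; rw [indicator_of_mem hω]; exact hbound _ _ _ _
    · simp only [hΨn]; rw [indicator_of_notMem hω]; simpa using hK0
  have hei : ∀ k, Integrable (e k) P := fun k => ((hΨni (ns k)).sub hΨi).pos_part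
  have helim : Tendsto (fun k => ∫ ω, e k ω ∂P) atTop (𝓝 (∫ _ω, (0 : ℝ) ∂P)) := by
    refine tendsto_integral_of_dominated_convergence (fun _ => 8 * K)
      (fun k => (hei k).aestronglyMeasurable) (integrable_const _) (fun k => ?_) ?_
    · refine Eventually.of_forall fun ω => ?_
      have h1 := abs_le.1 (hΨb ω)
      have h2 := abs_le.1 (hΨnb (ns k) ω)
      rw [Real.norm_eq_abs, abs_of_nonneg (le_max_right _ _)]
      exact max_le (by linarith [h1.1, h2.2]) (by linarith)
    · filter_upwards [hconv] with ω hω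
      have hcomp : ∀ (X : ℕ → Ω → ℝ) (x : Ω → ℝ), (∀ n, |X n ω - x ω| ≤ E n ω) →
          Tendsto (fun k => X (ns k) ω) atTop (𝓝 (x ω)) := by
        intro X x hX
        rw [tendsto_iff_norm_sub_tendsto_zero]
        exact squeeze_zero (fun k => norm_nonneg _) (fun k => hX (ns k)) hω
      have hr' : Tendsto (fun k => rn (ns k) ω) atTop (𝓝 (r ω)) := hcomp rn r fun n => by
        have := hind0 n ω
        simp only [hE]
        linarith [abs_nonneg (bn n ω - b ω), abs_nonneg (an n ω - a ω)]
      have hb' : Tendsto (fun k => bn (ns k) ω) atTop (𝓝 (b ω)) := hcomp bn b fun n => by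
        have := hind0 n ω
        simp only [hE]
        linarith [abs_nonneg (rn n ω - r ω), abs_nonneg (an n ω - a ω)]
      have ha' : Tendsto (fun k => an (ns k) ω) atTop (𝓝 (a ω)) := hcomp an a fun n => by
        have := hind0 n ω
        simp only [hE]
        linarith [abs_nonneg (rn n ω - r ω), abs_nonneg (bn n ω - b ω)]
      have hmem : ∀ᶠ k in atTop, (ω ∈ Cn (ns k) ↔ ω ∈ A) := by
        filter_upwards [hω.eventually_lt_const zero_lt_one] with k hk
        by_contra hcon
        have hωD : ω ∈ D (ns k) := by
          simp only [hD, mem_symmDiff]; tauto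
        have : (1 : ℝ) ≤ E (ns k) ω := by
          simp only [hE]
          rw [indicator_of_mem hωD, Pi.one_apply]
          linarith [abs_nonneg (rn (ns k) ω - r ω), abs_nonneg (bn (ns k) ω - b ω),
            abs_nonneg (an (ns k) ω - a ω)]
        linarith
      rw [Metric.tendsto_nhds]
      intro η hη
      by_cases hωA : ω ∈ A
      · have c1 := hb'.eventually (hg (b ω) (g (b ω) + η / 3) (by linarith))
        have c2 := ha'.eventually (hg (a ω) (g (a ω) + η / 3) (by linarith))
        have c3 := ((hgc.continuousAt (Ioo_mem_nhds hωA.1 hωA.2)).tendsto.comp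
          hr').eventually_const_lt (show g (r ω) - η / 3 < g (r ω) by linarith)
        filter_upwards [hmem, c1, c2, c3] with k hk d1 d2 d3
        simp only [Function.comp_apply] at d3
        have hlt : Ψn (ns k) ω - Ψ ω < η := by
          simp only [hΨn, hΨ]
          rw [indicator_of_mem (hk.2 hωA), indicator_of_mem hωA]
          linarith
        rw [dist_zero_right, Real.norm_eq_abs, abs_of_nonneg (le_max_right _ _)]
        exact max_lt hlt hη
      · filter_upwards [hmem] with k hk
        have hz : Ψn (ns k) ω - Ψ ω = 0 := by
          simp only [hΨn, hΨ]
          rw [indicator_of_notMem (fun h' => hωA (hk.1 h')), indicator_of_notMem hωA, sub_zero]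
        simp only [he, hz, max_self, dist_self]
        exact hη
  rw [integral_zero] at helim
  have hlow : ∀ k, -∫ ω, e k ω ∂P ≤ ∫ ω, Ψ ω ∂P := by
    intro k
    have h1 : ∫ ω, Ψn (ns k) ω ∂P ≤ ∫ ω, (Ψ ω + e k ω) ∂P :=
      integral_mono (hΨni _) (hΨi.add (hei k)) fun ω => by
        have := le_max_left (Ψn (ns k) ω - Ψ ω) 0
        simp only [he]; linarith
    rw [integral_add hΨi (hei k)] at h1
    linarith [hΨn0 (ns k)]
  have h2 := le_of_tendsto' helim.neg hlow
  simpa using h2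

end Submodular

/-! ### Jensen gaps under a change of information -/

section Gaps

variable {Ω : Type*} {m m' mΩ : MeasurableSpace Ω} {P : Measure Ω} {X Y : Ω → ℝ} {G : ℝ → ℝ}

theorem integral_eq_sum_fiber {κ : Type*} [Fintype κ] {V : Ω → κ} (hV : FiberMeasurable mΩ V)
    {f : Ω → ℝ} (hf : Integrable f P) : ∫ ω, f ω ∂P = ∑ i, ∫ ω in V ⁻¹' {i}, f ω ∂P := by
  rw [← integral_iUnion_fintype hV _ fun i => hf.integrableOn]
  · have : ⋃ i, V ⁻¹' {i} = univ := by ext ω; simp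
    rw [this, Measure.restrict_univ]
  · intro i j hij
    rw [Function.onFun, disjoint_left]
    rintro ω rfl hω'
    exact hij hω'

theorem condExp_ae_eq_const_of_ae_eq_const [IsFiniteMeasure P] (hm : m ≤ mΩ) (hX : Integrable X P)
    {E : Set Ω} (hE : MeasurableSet[m] E) {v : ℝ} (h : ∀ᵐ ω ∂P, ω ∈ E → X ω = v) :
    ∀ᵐ ω ∂P, ω ∈ E → P[X | m] ω = v := by
  have h1 := condExp_indicator (m := m) hX hE
  have h2 : E.indicator X =ᵐ[P] E.indicator fun _ => v := by
    filter_upwards [h] with ω hω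
    by_cases hE' : ω ∈ E
    · simp [hE', hω hE']
    · simp [hE']
  have h3 : P[E.indicator fun _ => v | m] = E.indicator fun _ => v :=
    condExp_of_stronglyMeasurable hm (stronglyMeasurable_const.indicator hE)
      ((integrable_const v).indicator (hm _ hE))
  have h4 := condExp_congr_ae (m := m) h2
  rw [h3] at h4
  filter_upwards [h1, h4] with ω e1 e2 hω
  rw [e1] at e2
  simpa [hω] using e2

/-- If `m` knows in which cell of small Jensen–Bregman diameter `X` lies, then little is lost by
replacing `X` by its conditional expectation. -/
theorem ConvexOn.integral_sub_condExp_le (hG : ConvexOn ℝ (Icc 0 1) G)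
    (hd : DifferentiableOn ℝ G (Ioo 0 1)) (hs : ∀ x ∈ Icc (0 : ℝ) 1, G (1 - x) = G x)
    [IsProbabilityMeasure P] (hm : m ≤ mΩ) (hX : Measurable X)
    (h : ∀ᵐ ω ∂P, X ω ∈ Icc (0 : ℝ) 1) {n : ℕ} {k : ℝ → Fin n} {D : ℝ} (hD : 0 ≤ D)
    (hk : FiberMeasurable m fun ω => k (X ω))
    (hcell : ∀ x ∈ Icc (0 : ℝ) 1, ∀ y ∈ Icc (0 : ℝ) 1, k x = k y → jensenBregman G x y ≤ D) :
    ∫ ω, G (unitClamp (X ω)) ∂P - ∫ ω, G (unitClamp (P[X | m] ω)) ∂P ≤ 2 * D := by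
  set g : ℝ → ℝ := fun x => G (unitClamp x) with hg
  have hgm : Measurable g :=
    (hG.upperSemicontinuous_comp_unitClamp hd.continuousOn hs).measurable
  obtain ⟨K, hK⟩ := hG.exists_abs_comp_unitClamp_le hs
  set r := P[X | m] with hr
  have hXi := integrable_of_ae_mem_Icc hX h
  have hri : Integrable r P := integrable_condExp
  have hgX : Integrable (fun ω => g (X ω)) P := integrable_comp_of_bounded hgm hK hX
  have hgr : Integrable (fun ω => g (r ω)) P :=
    integrable_comp_of_bounded hgm hK (measurable_condExp hm)
  have hrI : ∀ᵐ ω ∂P, r ω ∈ Icc (0 : ℝ) 1 := condExp_ae_mem_Icc hm hX h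
  have hk' := hk.mono hm
  have hsum : Integrable (fun ω => g (r ω) + 2 * D) P := hgr.add (integrable_const _)
  have cell : ∀ j : Fin n, ∫ ω in (fun ω => k (X ω)) ⁻¹' {j}, g (X ω) ∂P
      ≤ ∫ ω in (fun ω => k (X ω)) ⁻¹' {j}, (g (r ω) + 2 * D) ∂P := by
    intro j
    have const : ∀ v : ℝ, {x | x ∈ Icc (0 : ℝ) 1 ∧ k x = j} ⊆ {v} →
        ∫ ω in (fun ω => k (X ω)) ⁻¹' {j}, g (X ω) ∂P
          ≤ ∫ ω in (fun ω => k (X ω)) ⁻¹' {j}, (g (r ω) + 2 * D) ∂P := by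
      intro v hv
      have h1 : ∀ᵐ ω ∂P, ω ∈ (fun ω => k (X ω)) ⁻¹' {j} → X ω = v := by
        filter_upwards [h] with ω hω hj using hv ⟨hω, hj⟩
      have h2 := condExp_ae_eq_const_of_ae_eq_const hm hXi (hk j) h1
      refine integral_mono_ae hgX.integrableOn hsum.integrableOn ?_
      rw [EventuallyLE, ae_restrict_iff' (hk' j)]
      filter_upwards [h1, h2] with ω e1 e2 hω
      rw [e1 hω, show r ω = v from e2 hω]
      linarith
    rcases hG.exists_affine_minorant hd (C := {x | x ∈ Icc (0 : ℝ) 1 ∧ k x = j})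
      (fun x hx => hx.1) (D := D) (fun x hx y hy => hcell x hx.1 y hy.1 (hx.2.trans hy.2.symm))
      with h0 | h1 | ⟨p, q, hup, hlow⟩
    · exact const 0 h0
    · exact const 1 h1
    · have hpX : Integrable (fun ω => p + q * X ω + 2 * D) P :=
        ((integrable_const p).add (hXi.const_mul q)).add (integrable_const _)
      have hpr : Integrable (fun ω => p + q * r ω + 2 * D) P :=
        ((integrable_const p).add (hri.const_mul q)).add (integrable_const _)
      have heq : ∫ ω in (fun ω => k (X ω)) ⁻¹' {j}, (p + q * X ω + 2 * D) ∂P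
          = ∫ ω in (fun ω => k (X ω)) ⁻¹' {j}, (p + q * r ω + 2 * D) ∂P := by
        have e : ∀ Z : Ω → ℝ, Integrable Z P →
            ∫ ω in (fun ω => k (X ω)) ⁻¹' {j}, (p + q * Z ω + 2 * D) ∂P
              = P.real ((fun ω => k (X ω)) ⁻¹' {j}) * (p + 2 * D)
                + q * ∫ ω in (fun ω => k (X ω)) ⁻¹' {j}, Z ω ∂P := by
          intro Z hZ
          have : ∀ ω, p + q * Z ω + 2 * D = (p + 2 * D) + q * Z ω := fun ω => by ring
          simp only [this]
          rw [integral_add (integrable_const _) (hZ.const_mul q).integrableOn, integral_const,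
            integral_const_mul, smul_eq_mul, measureReal_restrict_apply_univ]
        rw [e X hXi, e r hri, setIntegral_condExp hm hXi (hk j)]
      calc ∫ ω in (fun ω => k (X ω)) ⁻¹' {j}, g (X ω) ∂P
          ≤ ∫ ω in (fun ω => k (X ω)) ⁻¹' {j}, (p + q * X ω + 2 * D) ∂P := by
            refine integral_mono_ae hgX.integrableOn hpX.integrableOn ?_
            rw [EventuallyLE, ae_restrict_iff' (hk' j)]
            filter_upwards [h] with ω hω hj
            simp only [hg]
            rw [unitClamp_of_mem hω]
            exact hup _ ⟨hω, hj⟩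
        _ = ∫ ω in (fun ω => k (X ω)) ⁻¹' {j}, (p + q * r ω + 2 * D) ∂P := heq
        _ ≤ _ := by
            refine integral_mono_ae hpr.integrableOn hsum.integrableOn ?_
            refine ae_restrict_of_ae ?_
            filter_upwards [hrI] with ω hω
            simp only [hg]
            rw [unitClamp_of_mem hω]
            linarith [hlow _ hω]
  have htot : ∫ ω, g (X ω) ∂P ≤ ∫ ω, (g (r ω) + 2 * D) ∂P := by
    rw [integral_eq_sum_fiber hk' hgX, integral_eq_sum_fiber hk' hsum]
    exact Finset.sum_le_sum fun j _ => cell j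
  rw [integral_add hgr (integrable_const _)] at htot
  simp only [integral_const, probReal_univ, smul_eq_mul, one_mul] at htot
  linarith

/-- If `m'` knows no more than `m` on a likely event `B`, then the additional information in `m'` is
worth little. -/
theorem ConvexOn.integral_condExp_sub_le (hG : ConvexOn ℝ (Icc 0 1) G)
    (hcont : ContinuousOn G (Ioo 0 1)) (hs : ∀ x ∈ Icc (0 : ℝ) 1, G (1 - x) = G x)
    [IsProbabilityMeasure P] (hm' : m' ≤ mΩ) (hmm : m ≤ m') (hY : Measurable Y)
    (hY1 : ∀ ω, Y ω ∈ Icc (0 : ℝ) 1) {B : Set Ω} (hB : MeasurableSet[m'] B)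
    (htr : ∀ S, MeasurableSet[m'] S → ∃ S', MeasurableSet[m] S' ∧ S ∩ B = S' ∩ B)
    {γ : ℝ} (hγ0 : 0 ≤ γ) (hγ : γ ≤ 1 / 2) (hγB : γ = 0 → P.real Bᶜ = 0) :
    ∫ ω, G (unitClamp (P[Y | m'] ω)) ∂P - ∫ ω, G (unitClamp (P[Y | m] ω)) ∂P
      ≤ 3 / 2 * (1 + P.real Bᶜ / γ) * (G 0 - G γ) := by
  have hm : m ≤ mΩ := hmm.trans hm'
  set g : ℝ → ℝ := fun x => G (unitClamp x) with hg
  have hgm : Measurable g := (hG.upperSemicontinuous_comp_unitClamp hcont hs).measurable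
  obtain ⟨K, hK⟩ := hG.exists_abs_comp_unitClamp_le hs
  have hYI : ∀ᵐ ω ∂P, Y ω ∈ Icc (0 : ℝ) 1 := Eventually.of_forall hY1
  have hYi := integrable_of_ae_mem_Icc hY hYI
  have hBm : MeasurableSet B := hm' _ hB
  set b' := P[Y | m'] with hb'
  set b := P[Y | m] with hb
  have hb'm : Measurable b' := measurable_condExp hm'
  have hbm : Measurable b := measurable_condExp hm
  have hb'I : ∀ᵐ ω ∂P, b' ω ∈ Icc (0 : ℝ) 1 := condExp_ae_mem_Icc hm' hY hYI
  have hbI : ∀ᵐ ω ∂P, b ω ∈ Icc (0 : ℝ) 1 := condExp_ae_mem_Icc hm hY hYI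
  have hb'i : Integrable b' P := integrable_condExp
  -- the value of `b'` on `B`, as an `m`-measurable function
  set x : Ω → ℝ := fun ω => unitClamp ((P[|B])[Y | m] ω) with hx
  have hxm : Measurable[m] x :=
    continuous_unitClamp.measurable.comp stronglyMeasurable_condExp.measurable
  have hxI : ∀ ω, x ω ∈ Icc (0 : ℝ) 1 := fun ω => unitClamp_mem _
  have hxb : ∀ᵐ ω ∂P, ω ∈ B → x ω = b' ω := by
    have h1 := condExp_cond_ae_eq hm' hmm hB htr hYi
    rw [EventuallyEq, ae_restrict_iff' hBm] at h1
    filter_upwards [h1, hb'I] with ω e1 e2 hω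
    simp only [hx]
    rw [e1 hω, unitClamp_of_mem e2]
  set u : Ω → ℝ := Bᶜ.indicator 1 with hu
  have hum : Measurable u := measurable_one.indicator hBm.compl
  have hu01 : ∀ ω, u ω ∈ Icc (0 : ℝ) 1 := by
    intro ω
    by_cases hω : ω ∈ B <;> simp [hu, hω]
  have hui : Integrable u P := integrable_of_ae_mem_Icc hum (Eventually.of_forall hu01)
  set p := P[u | m] with hp
  have hpi : Integrable p P := integrable_condExp
  have hpI : ∀ᵐ ω ∂P, p ω ∈ Icc (0 : ℝ) 1 :=
    condExp_ae_mem_Icc hm hum (Eventually.of_forall hu01)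
  set v : Ω → ℝ := fun ω => u ω * b' ω with hv
  have hvm : Measurable v := hum.mul hb'm
  have hvI : ∀ᵐ ω ∂P, 0 ≤ v ω ∧ v ω ≤ u ω := by
    filter_upwards [hb'I] with ω hω
    exact ⟨mul_nonneg (hu01 ω).1 hω.1, mul_le_of_le_one_right (hu01 ω).1 hω.2⟩
  have hvi : Integrable v P := integrable_of_ae_mem_Icc hvm (by
    filter_upwards [hvI] with ω hω using ⟨hω.1, hω.2.trans (hu01 ω).2⟩)
  set w := P[v | m] with hw
  have hw0 : ∀ᵐ ω ∂P, 0 ≤ w ω := condExp_nonneg (by filter_upwards [hvI] with ω hω using hω.1)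
  have hwp : ∀ᵐ ω ∂P, w ω ≤ p ω :=
    condExp_mono hvi hui (by filter_upwards [hvI] with ω hω using hω.2)
  have hxΩ : Measurable x := hxm.mono hm le_rfl
  have hxi : Integrable x P := integrable_of_ae_mem_Icc hxΩ (Eventually.of_forall hxI)
  have hxui : Integrable (fun ω => x ω * u ω) P :=
    hui.bdd_mul (c := 1) hxΩ.aestronglyMeasurable (Eventually.of_forall fun ω => by
      rw [Real.norm_eq_abs, abs_of_nonneg (hxI ω).1]; exact (hxI ω).2)
  have hbeq : ∀ᵐ ω ∂P, b ω = (1 - p ω) * x ω + w ω := by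
    have h1 : P[b' | m] =ᵐ[P] b := condExp_condExp_of_le hmm hm'
    have h2 : b' =ᵐ[P] (x - fun ω => x ω * u ω) + v := by
      filter_upwards [hxb] with ω hω
      by_cases hωB : ω ∈ B
      · simp [hv, hu, hωB, hω hωB]
      · simp [hv, hu, hωB]
    have h3 := condExp_congr_ae (m := m) h2
    have h4 := condExp_add (m := m) (hxi.sub hxui) hvi
    have h5 := condExp_sub (m := m) hxi hxui
    have h6 : P[x | m] = x := condExp_of_stronglyMeasurable hm hxm.stronglyMeasurable hxi
    have h7 : P[fun ω => x ω * u ω | m] =ᵐ[P] fun ω => x ω * p ω :=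
      condExp_stronglyMeasurable_mul_of_bound hm hxm.stronglyMeasurable hui 1
        (Eventually.of_forall fun ω => by
          rw [Real.norm_eq_abs, abs_of_nonneg (hxI ω).1]; exact (hxI ω).2)
    filter_upwards [h1, h3, h4, h5, h7] with ω e1 e3 e4 e5 e7
    rw [← e1, e3, e4, Pi.add_apply, e5, Pi.sub_apply, h6, e7]
    ring
  have hgx : Measurable[m] fun ω => g (x ω) := hgm.comp hxm
  have hgxi : Integrable (fun ω => g (x ω)) P := integrable_comp_of_bounded hgm hK hxΩ
  have hgxu : Integrable (fun ω => g (x ω) * u ω) P :=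
    hui.bdd_mul (c := K) (hgm.comp hxΩ).aestronglyMeasurable (Eventually.of_forall fun ω => hK _)
  have hgxp : Integrable (fun ω => g (x ω) * p ω) P :=
    hpi.bdd_mul (c := K) (hgm.comp hxΩ).aestronglyMeasurable (Eventually.of_forall fun ω => hK _)
  have hgb' : Integrable (fun ω => g (b' ω)) P := integrable_comp_of_bounded hgm hK hb'm
  have hgb : Integrable (fun ω => g (b ω)) P := integrable_comp_of_bounded hgm hK hbm
  have hpu : ∫ ω, p ω ∂P = ∫ ω, u ω ∂P := integral_condExp hm
  have huB : ∫ ω, u ω ∂P = P.real Bᶜ := integral_indicator_one hBm.compl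
  have hup : ∫ ω, g (b' ω) ∂P ≤ ∫ ω, ((1 - p ω) * g (x ω) + p ω * G 0) ∂P := by
    calc ∫ ω, g (b' ω) ∂P ≤ ∫ ω, (g (x ω) - g (x ω) * u ω + u ω * G 0) ∂P := by
          refine integral_mono_ae hgb' ((hgxi.sub hgxu).add (hui.mul_const _)) ?_
          filter_upwards [hxb] with ω hω
          by_cases hωB : ω ∈ B
          · simp [hu, hωB, hω hωB]
          · have := hG.le_apply_zero hs (unitClamp_mem (b' ω))
            simpa [hu, hωB, hg] using this
      _ = ∫ ω, (g (x ω) - g (x ω) * p ω + p ω * G 0) ∂P := by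
          have e : ∀ f : Ω → ℝ, Integrable f P → Integrable (fun ω => g (x ω) * f ω) P →
              ∫ ω, (g (x ω) - g (x ω) * f ω + f ω * G 0) ∂P
                = ∫ ω, g (x ω) ∂P - ∫ ω, g (x ω) * f ω ∂P + (∫ ω, f ω ∂P) * G 0 := by
            intro f hf hgf
            have e1 := integral_add (hgxi.sub hgf) (hf.mul_const (G 0))
            have e2 := integral_sub hgxi hgf
            simp only [Pi.sub_apply] at e1
            rw [e1, e2, integral_mul_const]
          rw [e u hui hgxu, e p hpi hgxp, integral_mul_condExp_eq hm hui hgx fun ω => hK _, hpu]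
      _ = _ := by
          refine integral_congr_ae (Eventually.of_forall fun ω => ?_)
          simp only
          ring
  have hp0 : γ = 0 → ∀ᵐ ω ∂P, p ω = 0 := by
    intro h0
    have h1 : ∫ ω, p ω ∂P = 0 := by rw [hpu, huB, hγB h0]
    exact (integral_eq_zero_iff_of_nonneg_ae (by
      filter_upwards [hpI] with ω hω using hω.1) hpi).1 h1
  have hi1 : Integrable (fun ω => (1 - p ω) * g (x ω) + p ω * G 0) P := by
    refine ((hgxi.sub hgxp).add (hpi.mul_const (G 0))).congr (Eventually.of_forall fun ω => ?_)
    simp only [Pi.add_apply, Pi.sub_apply]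
    ring
  have hi2 : Integrable (fun ω => 3 / 2 * (1 + p ω / γ) * (G 0 - G γ)) P :=
    ((((integrable_const (1 : ℝ)).add (hpi.div_const γ)).const_mul (3 / 2)).mul_const _)
  have hpt : ∀ᵐ ω ∂P, (1 - p ω) * g (x ω) + p ω * G 0 - g (b ω)
      ≤ 3 / 2 * (1 + p ω / γ) * (G 0 - G γ) := by
    have hp0' : ∀ᵐ ω ∂P, γ = 0 → p ω = 0 := by
      by_cases h0 : γ = 0
      · filter_upwards [hp0 h0] with ω hω _ using hω
      · exact Eventually.of_forall fun ω h => absurd h h0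
    filter_upwards [hp0', hpI, hw0, hwp, hbeq, hbI] with ω e0 e1 e2 e3 e4 e5
    simp only [hg]
    rw [unitClamp_of_mem (hxI ω), unitClamp_of_mem e5, e4]
    exact hG.jensenGap_le hs hγ0 hγ e1.1 e1.2 (hxI ω) e2 e3 e0
  calc ∫ ω, g (b' ω) ∂P - ∫ ω, g (b ω) ∂P
      ≤ ∫ ω, ((1 - p ω) * g (x ω) + p ω * G 0 - g (b ω)) ∂P := by
        rw [integral_sub hi1 hgb]; linarith
    _ ≤ ∫ ω, 3 / 2 * (1 + p ω / γ) * (G 0 - G γ) ∂P := integral_mono_ae (hi1.sub hgb) hi2 hpt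
    _ = _ := by
        rw [integral_mul_const, integral_const_mul,
          integral_add (integrable_const _) (hpi.div_const γ), integral_div, hpu, huB]
        simp

end Gaps

/-! ### From agreement to accuracy -/

section Agreement

theorem half_rpow_eq {c : ℝ} (hc : 0 < c) (hc1 : c ≤ 1) :
    (c / 2) ^ (1 / (1 - Real.logb 2 c)) = 1 / 2 := by
  have hl : Real.logb 2 c ≤ 0 := Real.logb_nonpos (by norm_num) hc.le hc1
  have h1 : c / 2 = 2 ^ (Real.logb 2 c - 1) := by
    rw [Real.rpow_sub (by norm_num), Real.rpow_logb (by norm_num) (by norm_num) hc, Real.rpow_one]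
  have h2 : 1 - Real.logb 2 c ≠ 0 := by linarith
  rw [h1, ← Real.rpow_mul (by norm_num),
    show (Real.logb 2 c - 1) * (1 / (1 - Real.logb 2 c)) = -1 by field_simp; ring,
    Real.rpow_neg_one]
  norm_num

variable {Ω : Type*} {mΩ : MeasurableSpace Ω} {P : Measure Ω} {a b : Ω → ℝ} {G : ℝ → ℝ}
  {c β ε : ℝ}

/-- If the expectations `a` and `b` nearly agree, then some partition of `[0, 1]` into cells of small
Jensen–Bregman diameter rarely separates them. The scale `s = ε` makes the random offset separate
them with probability at most `2 / 2 ^ r`, where `2 ^ r` is of order `(β / ε) ^ (1 / (1 - log₂ c))`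
because `2 / c` raised to this exponent is `2`. -/
theorem exists_partition_of_agreement (hGs : StrictConvexOn ℝ (Icc 0 1) G)
    (hd : DifferentiableOn ℝ G (Ioo 0 1)) (hs : ∀ x ∈ Icc (0 : ℝ) 1, G (1 - x) = G x)
    (hc : 0 < c) (hT : ApproxTriangle G c) [IsProbabilityMeasure P] (ha : Measurable a)
    (hb : Measurable b) (haI : ∀ᵐ ω ∂P, a ω ∈ Icc (0 : ℝ) 1) (hbI : ∀ᵐ ω ∂P, b ω ∈ Icc (0 : ℝ) 1)
    (hε : ∫ ω, jensenBregman G (a ω) (b ω) ∂P ≤ ε) (hβ0 : 0 < β) (hβ : 2 / c * ε ≤ β) :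
    0 ≤ (ε / β) ^ (1 / (1 - Real.logb 2 c)) ∧ (ε / β) ^ (1 / (1 - Real.logb 2 c)) ≤ 1 / 2 ∧
    ∃ (n : ℕ) (k : ℝ → Fin n), Measurable k ∧
      (∀ x ∈ Icc (0 : ℝ) 1, ∀ y ∈ Icc (0 : ℝ) 1, k x = k y →
        jensenBregman G x y ≤ 4 * β / c ^ 2) ∧
      P.real {ω | k (a ω) ≠ k (b ω)} ≤ 5 * (ε / β) ^ (1 / (1 - Real.logb 2 c)) := by
  have hG := hGs.convexOn
  have hc1 := hT.le_one hGs
  set g : ℝ → ℝ := fun x => G (unitClamp x) with hg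
  have hgm : Measurable g :=
    (hG.upperSemicontinuous_comp_unitClamp hd.continuousOn hs).measurable
  obtain ⟨K, hK⟩ := hG.exists_abs_comp_unitClamp_le hs
  set q := 1 / (1 - Real.logb 2 c) with hq
  have hl : Real.logb 2 c ≤ 0 := Real.logb_nonpos (by norm_num) hc.le hc1
  have hq0 : 0 < q := by rw [hq]; apply div_pos one_pos; linarith
  have hq1 : q ≤ 1 := by rw [hq, div_le_one (by linarith)]; linarith
  have hhalf : (c / 2) ^ q = 1 / 2 := half_rpow_eq hc hc1
  have hJ0 : ∀ᵐ ω ∂P, 0 ≤ jensenBregman G (a ω) (b ω) := by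
    filter_upwards [haI, hbI] with ω h1 h2 using hG.jensenBregman_nonneg h1 h2
  have hε0 : 0 ≤ ε := (integral_nonneg_of_ae hJ0).trans hε
  have hJi : Integrable (fun ω => jensenBregman G (a ω) (b ω)) P := by
    have h1 : Integrable (fun ω => (g (a ω) + g (b ω)) / 2 - g ((a ω + b ω) / 2)) P :=
      (((integrable_comp_of_bounded hgm hK ha).add
        (integrable_comp_of_bounded hgm hK hb)).div_const 2).sub
        (integrable_comp_of_bounded hgm hK ((ha.add hb).div_const 2))
    refine h1.congr ?_
    filter_upwards [haI, hbI] with ω e1 e2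
    simp only [hg]
    rw [jensenBregman_eq, unitClamp_of_mem e1, unitClamp_of_mem e2, unitClamp_of_mem
      ⟨by linarith [e1.1, e2.1], by linarith [e1.2, e2.2]⟩]
  have hεβ : ε / β ≤ c / 2 := by
    rw [div_le_iff₀ hβ0]
    have : c / 2 * (2 / c * ε) = ε := by field_simp
    nlinarith
  have hεβ0 : 0 ≤ ε / β := div_nonneg hε0 hβ0.le
  refine ⟨Real.rpow_nonneg hεβ0 _, hhalf ▸ Real.rpow_le_rpow hεβ0 hεβ hq0.le, ?_⟩
  have hmono : ε / β ≤ (ε / β) ^ q := by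
    rcases hεβ0.eq_or_lt with h0 | h0
    · rw [← h0, Real.zero_rpow hq0.ne']
    · have := Real.rpow_le_rpow_of_exponent_ge h0 (by linarith) hq1
      rwa [Real.rpow_one] at this
  have sep_meas : ∀ {n : ℕ} {k : ℝ → Fin n}, Measurable k →
      MeasurableSet {ω | k (a ω) ≠ k (b ω)} := fun hk =>
    (measurableSet_eq_fun (hk.comp ha) (hk.comp hb)).compl
  rcases hε0.eq_or_lt with h0 | hεpos
  · -- without disagreement `a = b` almost surely, and every partition will do
    obtain ⟨n, k, hk, hcell, -⟩ := exists_partitions hGs hd.continuousOn hs hc hT hβ0 hβ0 0 (by simp)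
    refine ⟨n, k 0, hk 0, hcell 0, ?_⟩
    have hJz : ∀ᵐ ω ∂P, jensenBregman G (a ω) (b ω) = 0 := by
      have : ∫ ω, jensenBregman G (a ω) (b ω) ∂P = 0 :=
        le_antisymm (h0 ▸ hε) (integral_nonneg_of_ae hJ0)
      exact (integral_eq_zero_iff_of_nonneg_ae hJ0 hJi).1 this
    have hz : P.real {ω | k 0 (a ω) ≠ k 0 (b ω)} = 0 := by
      rw [measureReal_def]
      have : ∀ᵐ ω ∂P, k 0 (a ω) = k 0 (b ω) := by
        filter_upwards [hJz, haI, hbI] with ω e0 e1 e2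
        rw [hGs.eq_of_jensenBregman_eq_zero e1 e2 e0]
      rw [ae_iff.1 this, ENNReal.toReal_zero]
    rw [hz]
    positivity
  · have h2c : 2 / c > 1 := by rw [gt_iff_lt, one_lt_div hc]; linarith
    have hβε : 1 ≤ β / ε := by
      rw [one_le_div hεpos]
      nlinarith
    obtain ⟨r, hr1, hr2⟩ := exists_nat_pow_near hβε h2c
    have hr1' : (2 / c) ^ r * ε ≤ β := by rwa [le_div_iff₀ hεpos] at hr1
    obtain ⟨n, k, hk, hcell, hsep⟩ :=
      exists_partitions hGs hd.continuousOn hs hc hT hβ0 hεpos r hr1'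
    have hpow : (1 / 2 : ℝ) ^ (r + 1) ≤ (ε / β) ^ q := by
      have h1 : (c / 2) ^ (r + 1) ≤ ε / β := by
        rw [le_div_iff₀ hβ0]
        rw [div_lt_iff₀ hεpos] at hr2
        have h3 : (c / 2) ^ (r + 1) * (2 / c) ^ (r + 1) = 1 := by
          rw [← mul_pow, show c / 2 * (2 / c) = 1 by field_simp, one_pow]
        calc (c / 2) ^ (r + 1) * β ≤ (c / 2) ^ (r + 1) * ((2 / c) ^ (r + 1) * ε) := by gcongr
          _ = ε := by rw [← mul_assoc, h3, one_mul]
      calc (1 / 2 : ℝ) ^ (r + 1) = ((c / 2) ^ q) ^ (r + 1) := by rw [hhalf]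
        _ = ((c / 2) ^ (r + 1)) ^ q := by
          rw [← Real.rpow_natCast, ← Real.rpow_natCast, ← Real.rpow_mul (by positivity),
            ← Real.rpow_mul (by positivity), mul_comm]
        _ ≤ (ε / β) ^ q := Real.rpow_le_rpow (by positivity) h1 hq0.le
    have hsum : ∑ j, P.real {ω | k j (a ω) ≠ k j (b ω)} ≤ 2 + 2 ^ r * (ε / β) := by
      have e1 : ∀ j, P.real {ω | k j (a ω) ≠ k j (b ω)}
          = ∫ ω, {ω | k j (a ω) ≠ k j (b ω)}.indicator 1 ω ∂P := fun j =>
        (integral_indicator_one (sep_meas (hk j))).symm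
      simp only [e1]
      have hint : ∀ j, Integrable ({ω | k j (a ω) ≠ k j (b ω)}.indicator (1 : Ω → ℝ)) P := fun j =>
        (integrable_const (1 : ℝ)).indicator (sep_meas (hk j))
      rw [← integral_finsetSum _ fun j _ => hint j]
      have hi : Integrable (fun ω => 1 + jensenBregman G (a ω) (b ω) / ε
          + 2 ^ r * (jensenBregman G (a ω) (b ω) / β)) P :=
        ((integrable_const (1 : ℝ)).add (hJi.div_const ε)).add ((hJi.div_const β).const_mul _)
      calc ∫ ω, ∑ j, {ω | k j (a ω) ≠ k j (b ω)}.indicator (1 : Ω → ℝ) ω ∂P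
          ≤ ∫ ω, (1 + jensenBregman G (a ω) (b ω) / ε
              + 2 ^ r * (jensenBregman G (a ω) (b ω) / β)) ∂P := by
            refine integral_mono_ae (integrable_finsetSum _ fun j _ => hint j) hi ?_
            filter_upwards [haI, hbI] with ω h1 h2
            refine le_trans (le_of_eq ?_) (hsep _ h1 _ h2)
            refine Finset.sum_congr rfl fun j _ => ?_
            by_cases hj : k j (a ω) = k j (b ω) <;> simp [hj]
        _ = 1 + (∫ ω, jensenBregman G (a ω) (b ω) ∂P) / ε
              + 2 ^ r * ((∫ ω, jensenBregman G (a ω) (b ω) ∂P) / β) := by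
            have e1 := integral_add ((integrable_const (1 : ℝ)).add (hJi.div_const ε))
              ((hJi.div_const β).const_mul (2 ^ r))
            have e2 := integral_add (integrable_const (1 : ℝ)) (hJi.div_const ε)
            simp only [Pi.add_apply] at e1
            rw [e1, e2, integral_const_mul, integral_div, integral_div]
            simp
        _ ≤ 1 + 1 + 2 ^ r * (ε / β) := by
            gcongr
            rwa [div_le_one hεpos]
        _ = _ := by ring
    obtain ⟨j, hj⟩ : ∃ j, P.real {ω | k j (a ω) ≠ k j (b ω)}
        ≤ (2 + 2 ^ r * (ε / β)) / 2 ^ r := by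
      by_contra! hcon
      have h1 := Finset.sum_lt_sum_of_nonempty (s := Finset.univ)
        ⟨⟨0, by positivity⟩, Finset.mem_univ _⟩ fun j _ => hcon j
      rw [Finset.sum_const, Finset.card_univ, Fintype.card_fin, nsmul_eq_mul] at h1
      push_cast at h1
      rw [mul_div_cancel₀ _ (by positivity)] at h1
      linarith
    refine ⟨n, k j, hk j, hcell j, hj.trans ?_⟩
    have e : (2 + 2 ^ r * (ε / β)) / 2 ^ r = 4 * (1 / 2 : ℝ) ^ (r + 1) + ε / β := by
      rw [pow_succ, one_div, inv_pow]
      field_simp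
      ring
    rw [e]
    linarith

end Agreement

section Accuracy

variable {Ω 𝒮 𝒯 : Type*} [mS : MeasurableSpace 𝒮] [mT : MeasurableSpace 𝒯]
  {𝒢 mΩ : MeasurableSpace Ω} {P : Measure Ω} {σ : Ω → 𝒮} {τ : Ω → 𝒯} {Y : Ω → ℝ} {G : ℝ → ℝ}
  {c β ε : ℝ}

/-- Agreement implies accuracy, for the holder of `τ` and a σ-algebra `𝒢` of common knowledge which is
approximable by rectangles. Let the holder of `σ` also reveal the cell of her expectation. By
rectangle substitutes the value of `σ` to the holder of `τ` is then at most what the exact expectation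
adds to the cell, which is little; and he could nearly always have guessed the cell, so that being
told it is of little value to him. -/
theorem RectSubmodular.accurate (hGs : StrictConvexOn ℝ (Icc 0 1) G)
    (hd : DifferentiableOn ℝ G (Ioo 0 1)) (hs : ∀ x ∈ Icc (0 : ℝ) 1, G (1 - x) = G x)
    (hc : 0 < c) (hT : ApproxTriangle G c) [IsProbabilityMeasure P]
    (H : RectSubmodular P σ τ Y fun x => G (unitClamp x)) (hσ : Measurable σ) (hτ : Measurable τ)
    (hY : Measurable Y) (hY1 : ∀ ω, Y ω ∈ Icc (0 : ℝ) 1) (hR : RectApprox P σ τ 𝒢)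
    (h𝒢 : 𝒢 ≤ mS.comap σ ⊔ mT.comap τ)
    (hε : ∫ ω, jensenBregman G (P[Y | mS.comap σ ⊔ 𝒢] ω) (P[Y | mT.comap τ ⊔ 𝒢] ω) ∂P ≤ ε)
    (hβ0 : 0 < β) (hβ : 2 / c * ε ≤ β) :
    Integrable (fun ω => bregman G (P[Y | mS.comap σ ⊔ mT.comap τ] ω)
        (P[Y | mT.comap τ ⊔ 𝒢] ω)) P ∧
      ∫ ω, bregman G (P[Y | mS.comap σ ⊔ mT.comap τ] ω) (P[Y | mT.comap τ ⊔ 𝒢] ω) ∂P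
        ≤ 8 / c ^ 2 * β + 16 * (G 0 - G ((ε / β) ^ (1 / (1 - Real.logb 2 c)))) := by
  have hG := hGs.convexOn
  have hcont := hd.continuousOn
  obtain ⟨K, hK⟩ := hG.exists_abs_comp_unitClamp_le hs
  have husc := hG.upperSemicontinuous_comp_unitClamp hcont hs
  have hgc : ContinuousOn (fun x => G (unitClamp x)) (Ioo 0 1) :=
    hcont.congr fun x hx => by rw [unitClamp_of_mem (Ioo_subset_Icc_self hx)]
  have hστ : mS.comap σ ⊔ mT.comap τ ≤ mΩ := sup_le hσ.comap_le hτ.comap_le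
  have h𝒢Ω : 𝒢 ≤ mΩ := h𝒢.trans hστ
  have hYI : ∀ᵐ ω ∂P, Y ω ∈ Icc (0 : ℝ) 1 := Eventually.of_forall hY1
  have hma : mS.comap σ ⊔ 𝒢 ≤ mΩ := sup_le hσ.comap_le h𝒢Ω
  have hmb : mT.comap τ ⊔ 𝒢 ≤ mΩ := sup_le hτ.comap_le h𝒢Ω
  set t := P[Y | mS.comap σ ⊔ mT.comap τ] with ht
  set a := P[Y | mS.comap σ ⊔ 𝒢] with ha
  set b := P[Y | mT.comap τ ⊔ 𝒢] with hb
  have htI : ∀ᵐ ω ∂P, t ω ∈ Icc (0 : ℝ) 1 := condExp_ae_mem_Icc hστ hY hYI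
  have haI : ∀ᵐ ω ∂P, a ω ∈ Icc (0 : ℝ) 1 := condExp_ae_mem_Icc hma hY hYI
  have hbI : ∀ᵐ ω ∂P, b ω ∈ Icc (0 : ℝ) 1 := condExp_ae_mem_Icc hmb hY hYI
  have ham : Measurable a := measurable_condExp hma
  have hbm : Measurable b := measurable_condExp hmb
  obtain ⟨hγ0, hγ, n, k, hk, hcell, hsep⟩ :=
    exists_partition_of_agreement hGs hd hs hc hT ham hbm haI hbI hε hβ0 hβ
  set γ := (ε / β) ^ (1 / (1 - Real.logb 2 c))
  -- the common knowledge after the cell of `a` has been revealed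
  set 𝒢' := 𝒢 ⊔ MeasurableSpace.comap (fun ω => k (a ω)) ⊤ with h𝒢'
  have hka : FiberMeasurable (mS.comap σ ⊔ 𝒢) fun ω => k (a ω) := fun i =>
    (hk.comp stronglyMeasurable_condExp.measurable) (measurableSet_singleton i)
  have hkb : FiberMeasurable (mT.comap τ ⊔ 𝒢) fun ω => k (b ω) := fun i =>
    (hk.comp stronglyMeasurable_condExp.measurable) (measurableSet_singleton i)
  have h𝒢'a : 𝒢' ≤ mS.comap σ ⊔ 𝒢 := sup_le le_sup_right hka.comap_le
  have h𝒢'Ω : 𝒢' ≤ mΩ := h𝒢'a.trans hma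
  have hR' : RectApprox P σ τ 𝒢' := hR.of_le_sup hσ h𝒢Ω le_sup_left h𝒢'a
  have h𝒢'στ : 𝒢' ≤ mS.comap σ ⊔ mT.comap τ := h𝒢'a.trans (sup_le le_sup_left h𝒢)
  have hsub := H.integral_le hσ hτ hY hY1 husc hgc hK hR' h𝒢'στ
  have heqa : mS.comap σ ⊔ 𝒢' = mS.comap σ ⊔ 𝒢 :=
    le_antisymm (sup_le le_sup_left h𝒢'a) (sup_le_sup_left le_sup_left _)
  rw [heqa] at hsub
  have hka' : FiberMeasurable 𝒢' fun ω => k (a ω) := fun i =>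
    le_sup_right (a := 𝒢) _ ⟨{i}, trivial, rfl⟩
  have hgap1 := hG.integral_sub_condExp_le hd hs h𝒢'Ω ham haI (D := 4 * β / c ^ 2) (by positivity)
    hka' hcell
  have htower : P[a | 𝒢'] =ᵐ[P] P[Y | 𝒢'] := condExp_condExp_of_le h𝒢'a hma
  have hint1 : ∫ ω, G (unitClamp (P[a | 𝒢'] ω)) ∂P = ∫ ω, G (unitClamp (P[Y | 𝒢'] ω)) ∂P := by
    refine integral_congr_ae ?_
    filter_upwards [htower] with ω hω
    rw [hω]
  rw [hint1] at hgap1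
  have heqb : mT.comap τ ⊔ 𝒢'
      = (mT.comap τ ⊔ 𝒢) ⊔ MeasurableSpace.comap (fun ω => k (a ω)) ⊤ := by
    rw [h𝒢', sup_assoc]
  have hgap2 := hG.integral_condExp_sub_le (P := P) (m := mT.comap τ ⊔ 𝒢) (m' := mT.comap τ ⊔ 𝒢')
    (B := {ω | k (a ω) ≠ k (b ω)}ᶜ) hcont hs (sup_le hτ.comap_le h𝒢'Ω)
    (sup_le_sup_left le_sup_left _) hY hY1
    ((hka'.mono le_sup_right).measurableSet_ne
      (hkb.mono (sup_le_sup_left le_sup_left _))).compl (fun S hS => by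
        rw [heqb] at hS
        obtain ⟨s, hs', rfl⟩ := measurableSet_sup_comap_top hS
        refine ⟨{ω | ω ∈ s (k (b ω))}, hkb.mem_fiber hs', ?_⟩
        ext ω
        simp only [mem_inter_iff, mem_ofPred_eq, mem_compl_iff, not_not]
        constructor
        · rintro ⟨h1, h2⟩; exact ⟨h2 ▸ h1, h2⟩
        · rintro ⟨h1, h2⟩; exact ⟨h2 ▸ h1, h2⟩) hγ0 hγ (fun h0 => by
        rw [compl_compl]
        refine le_antisymm (hsep.trans ?_) measureReal_nonneg
        rw [h0, mul_zero])
  rw [compl_compl] at hgap2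
  have hγI : γ ∈ Icc (0 : ℝ) 1 := ⟨hγ0, by linarith⟩
  have hhγ := hG.le_apply_zero hs hγI
  have hratio : P.real {ω | k (a ω) ≠ k (b ω)} / γ ≤ 5 := by
    rcases hγ0.eq_or_lt with h0 | h0
    · rw [← h0, div_zero]; norm_num
    · rwa [div_le_iff₀ h0]
  have hbreg := hG.bregman_condExp (P := P) (m := mT.comap τ ⊔ 𝒢) hd hs hmb
    (measurable_condExp hστ (X := Y) (P := P)) htI
  have htb : P[t | mT.comap τ ⊔ 𝒢] =ᵐ[P] b :=
    condExp_condExp_of_le (sup_le le_sup_right h𝒢) hστ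
  have hcongr : (fun ω => bregman G (t ω) (P[t | mT.comap τ ⊔ 𝒢] ω))
      =ᵐ[P] fun ω => bregman G (t ω) (b ω) := by
    filter_upwards [htb] with ω hω
    rw [hω]
  have hint2 : ∫ ω, G (unitClamp (P[t | mT.comap τ ⊔ 𝒢] ω)) ∂P = ∫ ω, G (unitClamp (b ω)) ∂P := by
    refine integral_congr_ae ?_
    filter_upwards [htb] with ω hω
    rw [hω]
  refine ⟨(integrable_congr hcongr).1 hbreg.1, ?_⟩
  rw [← integral_congr_ae hcongr]
  refine (le_of_eq (hbreg.2.trans (by rw [hint2]))).trans ?_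
  have e1 : 2 * (4 * β / c ^ 2) = 8 / c ^ 2 * β := by ring
  have e2 : 3 / 2 * (1 + P.real {ω | k (a ω) ≠ k (b ω)} / γ) * (G 0 - G γ)
      ≤ 16 * (G 0 - G γ) := by
    apply mul_le_mul_of_nonneg_right _ (by linarith)
    linarith
  linarith

end Accuracy

/-! ### Rectangle substitutes as an inequality between entropies -/

/-- Conditioning on an event of `m` does not change conditional expectations given `m`. -/
theorem condExp_cond_eq_self {Ω : Type*} {m mΩ : MeasurableSpace Ω} {P : Measure Ω} {Y : Ω → ℝ}
    {A C : Set Ω} [IsProbabilityMeasure P] (hm : m ≤ mΩ) (hA : MeasurableSet A)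
    (hC : MeasurableSet[m] C) (h0 : P (A ∩ C) ≠ 0) (hY : ∀ ω, Y ω ∈ Icc (0 : ℝ) 1)
    (hYm : Measurable Y) : (P[|A])[Y | m] =ᵐ[P[|A ∩ C]] (P[|A ∩ C])[Y | m] := by
  have : IsProbabilityMeasure P[|A] :=
    cond_isProbabilityMeasure fun h => h0 (measure_mono_null inter_subset_left h)
  have h1 := condExp_cond_ae_eq (P := P[|A]) hm le_rfl hC (fun B hB => ⟨B, hB, rfl⟩)
    (integrable_of_ae_mem_Icc hYm (Eventually.of_forall hY))
  have h2 : P[|A][|C] ≪ (P[|A]).restrict C := Measure.smul_absolutelyContinuous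
  rw [cond_cond_eq_cond_inter hA (hm _ hC)] at h1 h2
  exact (h2.ae_eq h1).symm

theorem ConvexOn.integral_bregman_of_ae_eq {Ω : Type*} {m mΩ : MeasurableSpace Ω} {P : Measure Ω}
    {G : ℝ → ℝ} {X Y : Ω → ℝ} (hG : ConvexOn ℝ (Icc 0 1) G) (hd : DifferentiableOn ℝ G (Ioo 0 1))
    (hs : ∀ x ∈ Icc (0 : ℝ) 1, G (1 - x) = G x) [IsProbabilityMeasure P] (hm : m ≤ mΩ)
    (hY : Measurable Y) (hY1 : ∀ ω, Y ω ∈ Icc (0 : ℝ) 1) (hX : X =ᵐ[P] P[Y | m]) :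
    ∫ ω, bregman G (Y ω) (X ω) ∂P
      = ∫ ω, G (unitClamp (Y ω)) ∂P - ∫ ω, G (unitClamp (P[Y | m] ω)) ∂P := by
  rw [← (hG.bregman_condExp hd hs hm hY (Eventually.of_forall hY1)).2]
  exact integral_congr_ae (hX.mono fun ω hω => by simp only [hω])

namespace InformationStructure

variable {Ω 𝒮 𝒯 : Type*} [mΩ : MeasurableSpace Ω] [mS : MeasurableSpace 𝒮]
  [mT : MeasurableSpace 𝒯] {I : InformationStructure Ω 𝒮 𝒯} {G : ℝ → ℝ}

/-- The expected Bregman divergences of `Y` from its conditional expectations all share the term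
`E[G(Y)]`, which cancels from the condition of rectangle substitutes. -/
theorem RectangleSubstitutes.rectSubmodular (h : I.RectangleSubstitutes G)
    (hG : ConvexOn ℝ (Icc 0 1) G) (hd : DifferentiableOn ℝ G (Ioo 0 1))
    (hs : ∀ x ∈ Icc (0 : ℝ) 1, G (1 - x) = G x) :
    RectSubmodular I.P I.σ I.τ I.Y fun x => G (unitClamp x) := by
  intro S T hS hT h0
  have hAS := I.measurable_σ hS
  have hAT := I.measurable_τ hT
  have hσ := I.measurable_σ.comap_le
  have hτ := I.measurable_τ.comap_le
  have hp : IsProbabilityMeasure I.P[|I.σ ⁻¹' S ∩ I.τ ⁻¹' T] := cond_isProbabilityMeasure h0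
  have hBob := hG.integral_bregman_of_ae_eq hd hs hτ I.measurable_Y I.Y_mem (X := I.muBob S)
    (condExp_cond_eq_self hτ hAS ⟨T, hT, rfl⟩ h0 I.Y_mem I.measurable_Y)
  have hAlice := hG.integral_bregman_of_ae_eq hd hs hσ I.measurable_Y I.Y_mem
    (P := I.P[|I.σ ⁻¹' S ∩ I.τ ⁻¹' T]) (X := I.muAlice T) (by
    rw [inter_comm] at h0 ⊢
    exact condExp_cond_eq_self hσ hAT ⟨S, hS, rfl⟩ h0 I.Y_mem I.measurable_Y)
  have hC : MeasurableSet[mS.comap I.σ ⊔ mT.comap I.τ] (I.σ ⁻¹' S ∩ I.τ ⁻¹' T) :=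
    MeasurableSet.inter (le_sup_left (a := mS.comap I.σ) (b := mT.comap I.τ) _ ⟨S, hS, rfl⟩)
      (le_sup_right (a := mS.comap I.σ) (b := mT.comap I.τ) _ ⟨T, hT, rfl⟩)
  have hTruth := hG.integral_bregman_of_ae_eq hd hs (sup_le hσ hτ) I.measurable_Y I.Y_mem
    (P := I.P[|I.σ ⁻¹' S ∩ I.τ ⁻¹' T]) (X := I.truth) (by
    have := condExp_cond_eq_self (P := I.P) (sup_le hσ hτ) MeasurableSet.univ hC
      (by rwa [univ_inter]) I.Y_mem I.measurable_Y
    rwa [univ_inter, cond_univ] at this)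
  have hRect := hG.integral_bregman_of_ae_eq hd hs (P := I.P[|I.σ ⁻¹' S ∩ I.τ ⁻¹' T]) bot_le
    I.measurable_Y I.Y_mem (X := fun _ => I.muRect S T) (by
    rw [condExp_bot]; rfl)
  have := h S T hS hT
  simp only [condRect] at this
  rw [hBob, hAlice, hTruth, hRect] at this
  linarith

end InformationStructure

/-! ### Transcripts are approximable by rectangles -/

theorem FiberMeasurable.exists_factor {Ω β κ : Type*} [mβ : MeasurableSpace β] [Finite κ]
    [Nonempty κ] {f : Ω → β} {V : Ω → κ} (hV : FiberMeasurable (mβ.comap f) V) :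
    ∃ v : β → κ, FiberMeasurable mβ v ∧ V = v ∘ f := by
  let _ : MeasurableSpace κ := ⊤
  have hm : Measurable[mβ.comap f] V := fun _ _ => hV.preimage _
  obtain ⟨v, hv, h⟩ := hm.exists_eq_measurable_comp
  exact ⟨v, fun i => hv (measurableSet_singleton i), h⟩

section Cut

variable {M : Type*}

theorem measurable_of_sigma {α γ : Type*} {β : α → Type*} [∀ a, MeasurableSpace (β a)]
    [MeasurableSpace γ] {f : (Σ a, β a) → γ} (h : ∀ a, Measurable fun x : β a => f ⟨a, x⟩) :
    Measurable f := fun _ hs =>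
  MeasurableSpace.measurableSet_iInf.2 fun a => h a hs

theorem measurable_sigmaMk {α : Type*} {β : α → Type*} [∀ a, MeasurableSpace (β a)] (a : α) :
    Measurable fun x : β a => (⟨a, x⟩ : Σ a, β a) := fun _ hs =>
  MeasurableSpace.measurableSet_iInf.1 hs a

/-- The first `L` entries of a finite sequence, or the whole sequence if it is shorter. -/
def cutAt (L : ℕ) (p : Σ n : ℕ, (Fin n → M)) : Σ n : ℕ, (Fin n → M) :=
  if h : L ≤ p.1 then ⟨L, fun i => p.2 (Fin.castLE h i)⟩ else p

theorem measurable_cutAt [MeasurableSpace M] (L : ℕ) : Measurable (cutAt (M := M) L) := by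
  refine measurable_of_sigma fun n => ?_
  by_cases h : L ≤ n
  · simp only [cutAt, dif_pos h]
    exact (measurable_sigmaMk L).comp
      (measurable_pi_lambda _ fun i => measurable_pi_apply (Fin.castLE h i))
  · simp only [cutAt, dif_neg h]
    exact measurable_sigmaMk n

/-- The entries of a sequence of length `L`; an arbitrary value `x₀` for other lengths. -/
def entriesOr (L : ℕ) (x₀ : Fin L → M) (p : Σ n : ℕ, (Fin n → M)) : Fin L → M :=
  if h : p.1 = L then h ▸ p.2 else x₀

theorem entriesOr_mk {L : ℕ} {x₀ x : Fin L → M} : entriesOr L x₀ ⟨L, x⟩ = x := by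
  simp [entriesOr]

theorem measurable_entriesOr [MeasurableSpace M] (L : ℕ) (x₀ : Fin L → M) : Measurable (entriesOr L x₀) := by
  refine measurable_of_sigma fun n => ?_
  by_cases h : n = L
  · subst h
    simp only [entriesOr_mk]
    exact measurable_id
  · simp only [entriesOr, dif_neg h]
    exact measurable_const

theorem measurable_ite_snoc [MeasurableSpace M] {Ω Θ : Type*} [MeasurableSpace Ω]
    [MeasurableSpace Θ] {L : ℕ} {q : Ω → Σ n : ℕ, (Fin n → M)} {θ : Ω → Θ}
    {e : (Σ n : ℕ, (Fin n → M)) → Fin L → M} {f : Θ × (Fin L → M) → M}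
    {D : Set (Σ n : ℕ, (Fin n → M))} [DecidablePred (· ∈ D)] (hq : Measurable q)
    (hθ : Measurable θ) (he : Measurable e) (hf : Measurable f) (hD : MeasurableSet D) :
    Measurable fun ω => if q ω ∈ D then
      (⟨L + 1, Fin.snoc (α := fun _ => M) (e (q ω)) (f (θ ω, e (q ω)))⟩ : Σ n : ℕ, (Fin n → M))
      else q ω := by
  have heq := he.comp hq
  refine Measurable.ite (hq hD) ((measurable_sigmaMk (L + 1)).comp ?_) hq
  refine measurable_pi_lambda _ fun i => ?_
  refine Fin.lastCases ?_ (fun j => ?_) i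
  · simp only [Fin.snoc_last]
    exact hf.comp (hθ.prodMk heq)
  · simp only [Fin.snoc_castSucc]
    exact (measurable_pi_apply j).comp heq

end Cut

namespace Protocol

variable {Ω 𝒮 𝒯 M : Type*} [mΩ : MeasurableSpace Ω] [mS : MeasurableSpace 𝒮]
  [mT : MeasurableSpace 𝒯] [MeasurableSpace M] (π : Protocol 𝒮 𝒯 M)
  (I : InformationStructure Ω 𝒮 𝒯)

/-- The protocol `π` stopped after `L` messages, unless it stops earlier by its own rule. -/
def truncate (L : ℕ) : Protocol 𝒮 𝒯 M where
  aliceSpeaks := π.aliceSpeaks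
  alice := π.alice
  measurable_alice := π.measurable_alice
  bob := π.bob
  measurable_bob := π.measurable_bob
  halts n := {x | L ≤ n ∨ x ∈ π.halts n}
  measurableSet_halts n := (MeasurableSet.const _).union (π.measurableSet_halts n)

theorem transcript_truncate (L : ℕ) (s : 𝒮) (t : 𝒯) (n : ℕ) :
    (π.truncate L).transcript s t n = π.transcript s t n := by
  induction n with
  | zero => rfl
  | succ n ih => simp only [transcript, ih]; rfl

theorem truncate_truncate_succ (L : ℕ) : (π.truncate (L + 1)).truncate L = π.truncate L := by
  have : ∀ n (x : Fin n → M), (L ≤ n ∨ L + 1 ≤ n ∨ x ∈ π.halts n) ↔ (L ≤ n ∨ x ∈ π.halts n) := by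
    intro n x
    constructor
    · rintro (h | h | h)
      exacts [Or.inl h, Or.inl (by omega), Or.inr h]
    · rintro (h | h)
      exacts [Or.inl h, Or.inr (Or.inr h)]
  simp only [truncate, mem_ofPred_eq, this]

theorem exists_mem_halts_truncate (L : ℕ) (s : 𝒮) (t : 𝒯) :
    ∃ n, (π.truncate L).transcript s t n ∈ (π.truncate L).halts n :=
  ⟨L, Or.inl le_rfl⟩

variable {π} in
theorem haltTime_truncate (L : ℕ) {s : 𝒮} {t : 𝒯} (h : ∃ n, π.transcript s t n ∈ π.halts n) :
    (π.truncate L).haltTime s t = min L (π.haltTime s t) := by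
  have h1 : π.transcript s t (π.haltTime s t) ∈ π.halts (π.haltTime s t) := Nat.sInf_mem h
  apply le_antisymm
  · refine le_min (Nat.sInf_le (Or.inl le_rfl)) (Nat.sInf_le ?_)
    rw [mem_ofPred_eq, transcript_truncate]
    exact Or.inr h1
  · have h2 : (π.truncate L).transcript s t ((π.truncate L).haltTime s t)
        ∈ (π.truncate L).halts ((π.truncate L).haltTime s t) :=
      Nat.sInf_mem (π.exists_mem_halts_truncate L s t)
    rw [transcript_truncate] at h2
    rcases h2 with h2 | h2
    · exact (min_le_left _ _).trans h2
    · exact (min_le_right _ _).trans (Nat.sInf_le h2)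

theorem transcript_castLE (s : 𝒮) (t : 𝒯) {L n : ℕ} (h : L ≤ n) :
    (fun i => π.transcript s t n (Fin.castLE h i)) = π.transcript s t L := by
  induction n, h using Nat.le_induction with
  | base => rfl
  | succ n h ih =>
    rw [← ih]
    funext i
    exact Fin.snoc_castSucc (α := fun _ => M) _ _ (Fin.castLE h i)

theorem cutAt_transcript (s : 𝒮) (t : 𝒯) (L n : ℕ) :
    cutAt L ⟨n, π.transcript s t n⟩ = ⟨min L n, π.transcript s t (min L n)⟩ := by
  rcases le_or_gt L n with h | h
  · rw [cutAt, dif_pos h, min_eq_left h]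
    simp only [transcript_castLE]
  · rw [cutAt, dif_neg (not_le.2 h), min_eq_right h.le]

variable {π I} in
theorem finalTranscript_truncate_eq_mk {L N : ℕ} {ω : Ω}
    (h : (π.truncate L).haltTime (I.σ ω) (I.τ ω) = N) :
    (π.truncate L).finalTranscript I ω = ⟨N, π.transcript (I.σ ω) (I.τ ω) N⟩ := by
  subst h
  simp only [finalTranscript, transcript_truncate]

variable {π I} in
theorem finalTranscript_truncate (L : ℕ) {ω : Ω}
    (h : ∃ n, π.transcript (I.σ ω) (I.τ ω) n ∈ π.halts n) :
    (π.truncate L).finalTranscript I ω = cutAt L (π.finalTranscript I ω) :=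
  (finalTranscript_truncate_eq_mk (haltTime_truncate L h)).trans
    (π.cutAt_transcript _ _ L _).symm

theorem finalTranscript_truncate_succ (L : ℕ) (ω : Ω) :
    (π.truncate L).finalTranscript I ω = cutAt L ((π.truncate (L + 1)).finalTranscript I ω) := by
  rw [← finalTranscript_truncate L (π.exists_mem_halts_truncate _ _ _), truncate_truncate_succ]

/-- The information conveyed by the messages of the protocol. -/
noncomputable abbrev transcriptSpace : MeasurableSpace Ω :=
  MeasurableSpace.comap (π.finalTranscript I) inferInstance

theorem transcriptSpace_truncate_zero : (π.truncate 0).transcriptSpace I = ⊥ := by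
  have : (π.truncate 0).finalTranscript I = fun _ => ⟨0, Fin.elim0⟩ := by
    funext ω
    exact finalTranscript_truncate_eq_mk (Nat.le_zero.1 (Nat.sInf_le (Or.inl le_rfl)))
  rw [transcriptSpace, this, MeasurableSpace.comap_const]

theorem transcriptSpace_truncate_le_succ (L : ℕ) :
    (π.truncate L).transcriptSpace I ≤ (π.truncate (L + 1)).transcriptSpace I := by
  have : (π.truncate L).finalTranscript I = cutAt L ∘ (π.truncate (L + 1)).finalTranscript I :=
    funext (π.finalTranscript_truncate_succ I L)
  rw [transcriptSpace, this, ← MeasurableSpace.comap_comp]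
  exact MeasurableSpace.comap_mono (measurable_cutAt L).comap_le

/-- One more message reveals only something known to its sender, who holds the signal `θ`. -/
theorem transcriptSpace_truncate_succ_le {Θ : Type*} [mΘ : MeasurableSpace Θ] {θ : Ω → Θ} (L : ℕ)
    {f : Θ × (Fin L → M) → M} (hf : Measurable f)
    (h : ∀ ω, π.transcript (I.σ ω) (I.τ ω) (L + 1) = Fin.snoc (α := fun _ => M)
      (π.transcript (I.σ ω) (I.τ ω) L) (f (θ ω, π.transcript (I.σ ω) (I.τ ω) L))) :
    (π.truncate (L + 1)).transcriptSpace I ≤ mΘ.comap θ ⊔ (π.truncate L).transcriptSpace I := by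
  classical
  have := I.isProb.neZero
  obtain ⟨ω₀⟩ := I.P.nonempty_of_neZero
  set q := (π.truncate L).finalTranscript I with hq
  set e := entriesOr (M := M) L (π.transcript (I.σ ω₀) (I.τ ω₀) L)
  have he : Measurable e := measurable_entriesOr L _
  have he_mk : ∀ x, e ⟨L, x⟩ = x := fun x => entriesOr_mk
  set D : Set (Σ n : ℕ, (Fin n → M)) := {p | p.1 = L ∧ e p ∉ π.halts L} with hD
  have hDm : MeasurableSet D := by
    have hfst : Measurable (Sigma.fst : (Σ n : ℕ, (Fin n → M)) → ℕ) :=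
      measurable_of_sigma fun n => measurable_const
    exact (hfst (measurableSet_singleton L)).inter (he (π.measurableSet_halts L).compl)
  have hstep : (π.truncate (L + 1)).finalTranscript I = fun ω => if q ω ∈ D then
      ⟨L + 1, Fin.snoc (α := fun _ => M) (e (q ω)) (f (θ ω, e (q ω)))⟩ else q ω := by
    funext ω
    have hcut := π.finalTranscript_truncate_succ I L ω
    rw [← hq] at hcut
    set N := (π.truncate (L + 1)).haltTime (I.σ ω) (I.τ ω) with hN
    have hNle : N ≤ L + 1 := Nat.sInf_le (Or.inl le_rfl)
    have hp : (π.truncate (L + 1)).finalTranscript I ω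
        = ⟨N, π.transcript (I.σ ω) (I.τ ω) N⟩ := finalTranscript_truncate_eq_mk hN.symm
    have hNmem : N = L + 1 ∨ π.transcript (I.σ ω) (I.τ ω) N ∈ π.halts N := by
      have : (π.truncate (L + 1)).transcript (I.σ ω) (I.τ ω) N ∈ (π.truncate (L + 1)).halts N :=
        Nat.sInf_mem (π.exists_mem_halts_truncate (L + 1) (I.σ ω) (I.τ ω))
      rw [transcript_truncate] at this
      exact this.imp_left fun h => le_antisymm hNle h
    rw [hp, cutAt_transcript] at hcut
    rw [hp]
    rcases hNle.lt_or_eq with hlt | heq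
    · -- the protocol has stopped by itself after at most `L` messages
      have hN' := hNmem.resolve_left hlt.ne
      have hqω : q ω = ⟨N, π.transcript (I.σ ω) (I.τ ω) N⟩ := by
        rw [hcut, min_eq_right (Nat.lt_succ_iff.1 hlt)]
      rw [if_neg, hqω]
      rintro ⟨h1, h2⟩
      rw [hqω] at h1 h2
      simp only at h1
      rw [h1] at hN' h2
      rw [he_mk] at h2
      exact h2 hN'
    · have hqω : q ω = ⟨L, π.transcript (I.σ ω) (I.τ ω) L⟩ := by
        rw [hcut, min_eq_left (by omega)]
      have hmem : q ω ∈ D := by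
        refine ⟨by rw [hqω], fun h' => ?_⟩
        rw [hqω, he_mk] at h'
        have : N ≤ L := Nat.sInf_le (by
          rw [mem_ofPred_eq, transcript_truncate]
          exact Or.inr h')
        omega
      rw [if_pos hmem, hqω, he_mk, ← h, heq]
  refine Measurable.comap_le ?_
  rw [hstep]
  exact @measurable_ite_snoc _ _ _ _ (_) _ _ _ _ _ _ _ _
    ((comap_measurable q).mono le_sup_right le_rfl) ((comap_measurable θ).mono le_sup_left le_rfl)
    he hf hDm

theorem rectApprox_truncate (L : ℕ) :
    RectApprox I.P I.σ I.τ ((π.truncate L).transcriptSpace I) := by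
  induction L with
  | zero =>
    rw [transcriptSpace_truncate_zero]
    exact rectApprox_bot
  | succ L ih =>
    have hle := π.transcriptSpace_truncate_le_succ I L
    have hm := ((π.truncate L).measurable_finalTranscript I).comap_le
    cases hs : π.aliceSpeaks L
    · exact (ih.swap.of_le_sup I.measurable_τ hm hle
        (π.transcriptSpace_truncate_succ_le I L (π.measurable_bob L)
          fun ω => by simp [transcript, hs])).swap
    · exact ih.of_le_sup I.measurable_σ hm hle
        (π.transcriptSpace_truncate_succ_le I L (π.measurable_alice L)
          fun ω => by simp [transcript, hs])

variable {π I} in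
/-- Truncation at a late time changes little, so that approximability passes to the full
transcript. -/
theorem Terminates.rectApprox (h : π.Terminates I) :
    RectApprox I.P I.σ I.τ (π.transcriptSpace I) := by
  have := I.isProb.neZero
  obtain ⟨ω₀⟩ := I.P.nonempty_of_neZero
  refine RectApprox.of_limit fun κ _ V hV δ hδ => ?_
  have : Nonempty κ := ⟨V ω₀⟩
  obtain ⟨v, hv, hVv⟩ := hV.exists_factor
  set A : ℕ → Set Ω := fun L => (fun ω => π.haltTime (I.σ ω) (I.τ ω)) ⁻¹' Ioi L with hA
  have hlim : Tendsto (fun L => I.P (A L)) atTop (𝓝 0) := by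
    have h0 : ⋂ L, A L = ∅ := by
      refine eq_empty_of_forall_notMem fun ω hω => ?_
      have h1 : ω ∈ A (π.haltTime (I.σ ω) (I.τ ω)) := mem_iInter.1 hω _
      exact lt_irrefl (π.haltTime (I.σ ω) (I.τ ω)) h1
    rw [← measure_empty (μ := I.P), ← h0]
    exact tendsto_measure_iInter_atTop
      (fun L => (π.measurable_haltTime I measurableSet_Ioi).nullMeasurableSet)
      (fun L L' hL ω (hω : L' < _) => hL.trans_lt hω) ⟨0, measure_ne_top _ _⟩
  obtain ⟨L, hL⟩ := (hlim.eventually_lt_const (ENNReal.ofReal_pos.2 hδ)).exists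
  refine ⟨(π.truncate L).transcriptSpace I, π.rectApprox_truncate I L, ?_,
    v ∘ (π.truncate L).finalTranscript I, fun i => ⟨_, hv i, rfl⟩, ?_⟩
  · intro ι _ U₁ hU₁
    have : Nonempty ι := ⟨U₁ ω₀⟩
    obtain ⟨u, hu, rfl⟩ := hU₁.exists_factor
    refine ⟨u ∘ cutAt L ∘ π.finalTranscript I,
      fun i => ⟨_, measurable_cutAt L (hu i), rfl⟩, ?_⟩
    filter_upwards [h] with ω hω
    simp only [Function.comp_apply, finalTranscript_truncate L hω]
  · rw [measureReal_def]
    refine ENNReal.toReal_lt_of_lt_ofReal (lt_of_le_of_lt (measure_mono_ae ?_) hL)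
    filter_upwards [h] with ω hω hne
    by_contra hcon
    refine hne ?_
    have hle : π.haltTime (I.σ ω) (I.τ ω) ≤ L := not_lt.1 hcon
    have : (π.truncate L).finalTranscript I ω = π.finalTranscript I ω :=
      finalTranscript_truncate_eq_mk ((haltTime_truncate L hω).trans (min_eq_right hle))
    simp only [hVv, Function.comp_apply, this]

theorem transcriptSpace_le : π.transcriptSpace I ≤ mS.comap I.σ ⊔ mT.comap I.τ := by
  -- the signals, viewed on the space of signal pairs, form an information structure
  let J : InformationStructure (𝒮 × 𝒯) 𝒮 𝒯 :=
    { P := I.P.map fun ω => (I.σ ω, I.τ ω)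
      isProb := Measure.isProbabilityMeasure_map
        (I.measurable_σ.prodMk I.measurable_τ).aemeasurable
      σ := Prod.fst
      measurable_σ := measurable_fst
      τ := Prod.snd
      measurable_τ := measurable_snd
      Y := fun _ => 0
      measurable_Y := measurable_const
      Y_mem := fun _ => ⟨le_rfl, zero_le_one⟩ }
  have hcomp : π.finalTranscript I = π.finalTranscript J ∘ fun ω => (I.σ ω, I.τ ω) := rfl
  rw [transcriptSpace, hcomp, ← MeasurableSpace.comap_comp, ← MeasurableSpace.comap_prodMk]
  exact MeasurableSpace.comap_mono (π.measurable_finalTranscript J).comap_le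

end Protocol

theorem theorem4p4 {Ω 𝒮 𝒯 M : Type*} [MeasurableSpace Ω] [MeasurableSpace 𝒮] [MeasurableSpace 𝒯]
    [MeasurableSpace M] [StandardBorelSpace M]
    (G : ℝ → ℝ) (hG_convex : StrictConvexOn ℝ (Set.Icc 0 1) G)
    (hG_diff : DifferentiableOn ℝ G (Set.Ioo 0 1))
    (hG_symm : ∀ x ∈ Set.Icc (0 : ℝ) 1, G (1 - x) = G x)
    (c : ℝ) (hc : 0 < c) (hG_triangle : ApproxTriangle G c)
    (I : InformationStructure Ω 𝒮 𝒯) (hI : I.RectangleSubstitutes G)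
    (π : Protocol 𝒮 𝒯 M) (ε : ℝ) (hπ : π.CausesAgreement I G ε)
    (β : ℝ) (hβ_pos : 0 < β) (hβ : 2 / c * ε ≤ β) :
    I.Accurate G
        (8 / c ^ 2 * β + 16 * (G 0 - G ((ε / β) ^ (1 / (1 - Real.logb 2 c)))))
        (π.aliceExpectation I) ∧
      I.Accurate G
        (8 / c ^ 2 * β + 16 * (G 0 - G ((ε / β) ^ (1 / (1 - Real.logb 2 c)))))
        (π.bobExpectation I) := by
  have H := hI.rectSubmodular hG_convex.convexOn hG_diff hG_symm
  have hR := hπ.1.rectApprox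
  have hle := π.transcriptSpace_le I
  constructor
  · have h := H.swap.accurate hG_convex hG_diff hG_symm hc hG_triangle I.measurable_τ
      I.measurable_σ I.measurable_Y I.Y_mem hR.swap (by rwa [sup_comm])
      ((integral_congr_ae (Eventually.of_forall fun _ => jensenBregman_comm G _ _)).trans_le hπ.2)
      hβ_pos hβ
    rw [sup_comm] at h
    exact h
  · exact H.accurate hG_convex hG_diff hG_symm hc hG_triangle I.measurable_σ I.measurable_τ
      I.measurable_Y I.Y_mem hR hle hπ.2 hβ_pos hβ
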